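/- **Setting.** Let $n\ge 2$ and $k\ge 1$. For $d\ge 1$ let $\mathcal I(d,q)$ be the set of labels $I=(i_1<\dots<i_q)$ with entries in $\{1,\dots,d\}$; a $q$-form on $\mathbb R^d$ is $f=\sum_{I\in\mathcal I(d,q)}f_I\,dx^I$ with real-valued coefficients. Let $\mathcal S(n,k)$ be the set of multi-indices $\alpha\in\{0,\dots,k\}^n$ with $\alpha_1+\dots+\alpha_n=k$. An integer $\ell$ with $1\le \ell\le k$ is an *admissible degree increment* for $(n,k)$ if there is a positive integer $N$ such that $$\binom N\ell=\binom{n-1+k}{k},\qquad N\ge n-1+\ell. \tag{1}$$ Given such $\ell$ and $N$ (so $N\ge n$), let $i:\mathbb R^n\to\mathbb R^N$, $i(x)=(x,0,\dots,0)$, let $\pi:\mathbb R^N\to\mathbb R^n$ be the projection onto the first $n$ coordinates, write $i\alpha=(\alpha,0,\dots,0)$ for $\alpha\in\mathcal S(n,k)$, and let $\aleph:\{i\alpha:\alpha\in\mathcal S(n,k)\}\to\mathcal I(N,\ell)$ be a bijection. For tuples $A,B$ and a label $C$ let $\epsilon^{AB}_C$ be the sign of the permutation carrying the concatenation $AB$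 to $C$ if these have identical content, and $0$ otherwise. For forms $F$ on $\mathbb R^N$ of degree $q$ put $$T_{\ell,\aleph}F=\sum_{L\in\mathcal I(N,q+\ell)}\Big(\sum_{I\in\mathcal I(N,q),\ \alpha\in\mathcal S(n,k)}\epsilon_L^{\aleph(i\alpha)I}\,\frac{\partial^kF_I}{\partial z^{i\alpha}}\Big)dz^L ,$$ and for smooth compactly supported $q$-forms on $\mathbb R^n$ put $$\mathcal T_{\ell,\aleph}:=i^*\,T_{\ell,\aleph}\,\pi^*,$$ with formal adjoint, mapping $(q+\ell)$-forms to $q$-forms when $q+\ell\le n$, $$\mathcal T^*_{\ell,\aleph}:=(-1)^{k+q(n-\ell-q)}*\mathcal T_{\ell,\aleph}\,*,$$ where $*$ is the Hodge star of $\mathbb R^n$. Write $\langle f,h\rangle=\int_{\mathbb R^n}\sum_I f_Ih_I\,dx$. For integrable $f$ and $g$ of degrees $q$ and $p$, "$\mathcal T_{\ell,\aleph}f=0$ in the sense of distributions" means $\langle f,\mathcal T^*_{\ell,\aleph}\varphi\rangle=0$ for all smooth compactly supported $(q+\ell)$-forms $\varphi$, and "$\mathcal T^*_{\ell,\aleph}g=0$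 in the sense of distributions" means $\langle g,\mathcal T_{\ell,\aleph}\varphi\rangle=0$ for all smooth compactly supported $(p-\ell)$-forms $\varphi$. The spaces $L^r_q$ and $W^{1,n}_q$ consist of the $q$-forms on $\mathbb R^n$ with coefficients in $L^r(\mathbb R^n)$ and $W^{1,n}(\mathbb R^n)$; $\|f\|_{L^1_q}$ and $\|\nabla h\|_{L^n_q}$ are the $L^1$ and $L^n$ norms of the pointwise Euclidean lengths of $(f_I)_I$ and of the weak gradient $(\partial_jh_I)_{j,I}$. **Theorem.** Let $n\ge2$ and $k\ge1$. There is a constant $\mathcal C$ depending only on $n$ and $k$ such that for every admissible degree increment $\ell$ for $(n,k)$ with $n\ge\ell$, every $N$ as in (1) and every bijection $\aleph$ as above, the following hold. - For any $0\le q\le n-\ell$ and any $f\in L^1_q(\mathbb R^n)$, if $\mathcal T_{\ell,\aleph}f=0$ in the sense of distributions, then $$|\langle f,h\rangle|\le\mathcal C\,\|f\|_{L^1_q}\,\|\nabla h\|_{L^n_q}\qquad\text{for all }h\in (L^\infty_q\cap W^{1,n}_q)(\mathbb R^n).$$ - For any $\ell\le p\le n$ and any $g\in L^1_p(\mathbb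 R^n)$, if $\mathcal T^*_{\ell,\aleph}g=0$ in the sense of distributions, then $$|\langle g,h\rangle|\le\mathcal C\,\|g\|_{L^1_p}\,\|\nabla h\|_{L^n_p}\qquad\text{for all }h\in (L^\infty_p\cap W^{1,n}_p)(\mathbb R^n).$$ -/

import Mathlib

open MeasureTheory
open scoped ContDiff ENNReal

noncomputable section

namespace KthOrderComplex

/-- Euclidean space of dimension `d`, with its Euclidean norm and Lebesgue measure. -/
abbrev Eucl (d : ℕ) : Type := EuclideanSpace ℝ (Fin d)

/-! ### Labels, multi-indices and signs -/

/-- The set of `q`-labels `I = (i₁ < ⋯ < i_q)` with entries among `d` coordinate indices. -/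
abbrev Label (d q : ℕ) : Type := {I : Fin q → Fin d // StrictMono I}

instance (d q : ℕ) : Fintype (Label d q) := Fintype.ofFinite _

/-- The set of `k`-multi-indices in dimension `n`. -/
abbrev MultiIndex (n k : ℕ) : Type := {α : Fin n → Fin (k + 1) // ∑ t, (α t : ℕ) = k}

/-- The multi-index `(α₁, …, αₙ, 0, …, 0)` in dimension `N`. -/
def MultiIndex.extend {n k : ℕ} (N : ℕ) (α : MultiIndex n k) : Fin N → ℕ :=
  fun t => if h : (t : ℕ) < n then (α.1 ⟨t, h⟩ : ℕ) else 0

/-- For a label `C`: the sign of the permutation that carries the concatenation `AB` to `C` if they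
have identical content, and zero otherwise. As `C` has no repeated entry, at most one permutation
contributes to the sum. -/
def labelSign {a b c d : ℕ} (h : a + b = c) (A : Fin a → Fin d) (B : Fin b → Fin d)
    (C : Fin c → Fin d) : ℤ :=
  ∑ σ : Equiv.Perm (Fin c),
    if (∀ t, Fin.append A B (Fin.cast h.symm (σ t)) = C t) then (Equiv.Perm.sign σ : ℤ) else 0

/-! ### Admissible degree increments -/

/-- `N` is a solution of the equation `binom(N, ℓ) = binom(n - 1 + k, k)` that is a positive
integer and is at least `n - 1 + ℓ`. -/
structure IsInflatedDim (n k ℓ N : ℕ) : Prop where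
  pos : 0 < N
  choose_eq : N.choose ℓ = (n - 1 + k).choose k
  ge : n - 1 + ℓ ≤ N

theorem IsInflatedDim.le {n k ℓ N : ℕ} (h : IsInflatedDim n k ℓ N) (hℓ : 1 ≤ ℓ) : n ≤ N := by
  have := h.ge
  omega

/-- `ℓ` is an admissible degree increment for the pair `(n, k)`. -/
def IsAdmissible (n k ℓ : ℕ) : Prop :=
  1 ≤ ℓ ∧ ℓ ≤ k ∧ ∃ N : ℕ, IsInflatedDim n k ℓ N

/-! ### Differential forms -/

/-- A `q`-form `∑ f_I dx^I` on Euclidean `d`-space, given by its coefficient functions. -/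
abbrev Form (d q : ℕ) : Type := Label d q → Eucl d → ℝ

/-- The pointwise partial derivative in the `j`-th coordinate direction. -/
def partialDeriv {d : ℕ} (j : Fin d) (u : Eucl d → ℝ) : Eucl d → ℝ :=
  fun x => fderiv ℝ u x (EuclideanSpace.single j 1)

/-- The derivative `∂^β u = ∂₁^{β₁} ⋯ ∂_d^{β_d} u`. -/
def multiDeriv {d : ℕ} (β : Fin d → ℕ) (u : Eucl d → ℝ) : Eucl d → ℝ :=
  (List.finRange d).foldr (fun j v => (partialDeriv j)^[β j] v) u

/-- Smooth compactly supported forms. -/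
def IsTestForm {d q : ℕ} (φ : Form d q) : Prop :=
  ∀ I, ContDiff ℝ ∞ (φ I) ∧ HasCompactSupport (φ I)

/-- Forms with coefficients in `L^p`. -/
def MemLpForm {d q : ℕ} (p : ℝ≥0∞) (f : Form d q) : Prop :=
  ∀ I, MemLp (f I) p volume

/-- The `L^p` norm of a form: the `L^p` norm of its pointwise Euclidean length. -/
def lpNormForm {d q : ℕ} (p : ℝ≥0∞) (f : Form d q) : ℝ :=
  (eLpNorm (fun x => √(∑ I, f I x ^ 2)) p volume).toReal

/-- The pairing `⟨f, h⟩ = ∫ f ∧ *h = ∫ ∑ f_I h_I`. -/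
def pairing {d q : ℕ} (f h : Form d q) : ℝ :=
  ∫ x, ∑ I, f I x * h I x

/-- The Hodge star from `q`-forms to `r`-forms, `q + r = d`: it is linear over functions and
`* dx^I = ε dx^J`, where `J` is the complement of `I` and `dx^I ∧ (ε dx^J)` is the volume form. -/
def hodgeStar {d q r : ℕ} (h : q + r = d) (f : Form d q) : Form d r :=
  fun J x => ∑ I : Label d q, (labelSign h I.1 J.1 id : ℝ) * f I x

/-! ### Sobolev forms -/

/-- `v` is the weak derivative of `u` in the `j`-th coordinate direction. -/
def IsWeakPartial {d : ℕ} (j : Fin d) (u v : Eucl d → ℝ) : Prop :=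
  LocallyIntegrable u volume ∧ LocallyIntegrable v volume ∧
    ∀ φ : Eucl d → ℝ, ContDiff ℝ ∞ φ → HasCompactSupport φ →
      ∫ x, u x * partialDeriv j φ x = -∫ x, v x * φ x

/-- `h` lies in `W^{1,p}` and `Dh` is its weak gradient: `Dh j I` is the weak derivative `∂_j h_I`. -/
def MemW1WithGrad {d q : ℕ} (p : ℝ≥0∞) (h : Form d q) (Dh : Fin d → Form d q) : Prop :=
  MemLpForm p h ∧ (∀ j, MemLpForm p (Dh j)) ∧ ∀ j I, IsWeakPartial j (h I) (Dh j I)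

/-- The `L^p` norm of a gradient: the `L^p` norm of its pointwise Euclidean length. -/
def lpNormGrad {d q : ℕ} (p : ℝ≥0∞) (Dh : Fin d → Form d q) : ℝ :=
  (eLpNorm (fun x => √(∑ j, ∑ I, Dh j I x ^ 2)) p volume).toReal

/-! ### The embedding and the projection -/

/-- The embedding `i (x₁, …, xₙ) = (x₁, …, xₙ, 0, …, 0)`. -/
def embed (n N : ℕ) (x : Eucl n) : Eucl N :=
  WithLp.toLp 2 fun t => if h : (t : ℕ) < n then x ⟨t, h⟩ else 0

/-- The projection `π (z₁, …, z_N) = (z₁, …, zₙ)`. -/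
def proj {n N : ℕ} (hnN : n ≤ N) (z : Eucl N) : Eucl n :=
  WithLp.toLp 2 fun t => z (Fin.castLE hnN t)

/-- A label for dimension `n` regarded as a label for dimension `N`. -/
def Label.lift {n N q : ℕ} (hnN : n ≤ N) (I : Label n q) : Label N q :=
  ⟨fun t => Fin.castLE hnN (I.1 t), fun _ _ h => I.2 h⟩

/-- The pullback `i^*`: as `i^* dz_t` is `dx_t` for `t ≤ n` and is zero for `t > n`, only the
coefficients with labels among the first `n` indices survive. -/
def pullbackEmbed {n N q : ℕ} (hnN : n ≤ N) (F : Form N q) : Form n q :=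
  fun I x => F (I.lift hnN) (embed n N x)

open Classical in
/-- The pullback `π^*`: `π^* (∑ f_I dx^I) = ∑ (f_I ∘ π) dz^I`. -/
def pullbackProj {n N q : ℕ} (hnN : n ≤ N) (f : Form n q) : Form N q :=
  fun J z => ∑ I : Label n q, if I.lift hnN = J then f I (proj hnN z) else 0

/-! ### The operators -/

/-- The `k`-th order operator on forms on `N`-space, from `q`-forms to `p`-forms, `p = ℓ + q`:
its `L`-coefficient is the sum over `I` and `α` of `ε^{ℵ(iα) I}_L ∂^{iα} F_I`. -/
def opT {n k ℓ N q p : ℕ} (aleph : MultiIndex n k ≃ Label N ℓ) (h : ℓ + q = p)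
    (F : Form N q) : Form N p :=
  fun L z => ∑ I : Label N q, ∑ α : MultiIndex n k,
    (labelSign h (aleph α).1 I.1 L.1 : ℝ) * multiDeriv (α.extend N) (F I) z

/-- The operator `i^* T π^*` on forms on `n`-space. -/
def opCalT {n k ℓ N q p : ℕ} (hnN : n ≤ N) (aleph : MultiIndex n k ≃ Label N ℓ) (h : ℓ + q = p)
    (f : Form n q) : Form n p :=
  pullbackEmbed hnN (opT aleph h (pullbackProj hnN f))

/-- The formal adjoint `(-1)^{k + q (n - ℓ - q)} * (i^* T π^*) *`, from `p`-forms to `q`-forms,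
`p = ℓ + q ≤ n`. -/
def opCalTAdj {n k ℓ N q p : ℕ} (hnN : n ≤ N) (aleph : MultiIndex n k ≃ Label N ℓ)
    (h : ℓ + q = p) (hp : p ≤ n) (g : Form n p) : Form n q :=
  fun I x => (-1 : ℝ) ^ (k + q * (n - p)) *
    hodgeStar (q := ℓ + (n - p)) (by omega)
      (opCalT hnN aleph rfl (hodgeStar (r := n - p) (by omega) g)) I x

/-- `𝒯 f = 0` in the sense of distributions, for a `q`-form `f`: `⟨f, 𝒯^* φ⟩ = 0` for all smooth
compactly supported `(ℓ + q)`-forms `φ`. -/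
def CalTVanishes {n k ℓ N q : ℕ} (hnN : n ≤ N) (aleph : MultiIndex n k ≃ Label N ℓ)
    (f : Form n q) : Prop :=
  ∀ (p : ℕ) (h : ℓ + q = p) (hp : p ≤ n) (φ : Form n p), IsTestForm φ →
    pairing f (opCalTAdj hnN aleph h hp φ) = 0

/-- `𝒯^* g = 0` in the sense of distributions, for a `p`-form `g`: `⟨g, 𝒯 φ⟩ = 0` for all smooth
compactly supported `(p - ℓ)`-forms `φ`. -/
def CalTAdjVanishes {n k ℓ N p : ℕ} (hnN : n ≤ N) (aleph : MultiIndex n k ≃ Label N ℓ)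
    (g : Form n p) : Prop :=
  ∀ (q : ℕ) (h : ℓ + q = p) (φ : Form n q), IsTestForm φ →
    pairing g (opCalT hnN aleph h φ) = 0

end KthOrderComplex

end

/-!
# `L¹` estimates for the `k`-th order complex

Both assertions reduce to an estimate of Van Schaftingen, `exists_abs_integral_le_of_divFree`: if
integrable functions `f_α`, `|α| = k`, on `n`-space satisfy `∑ ∂^α f_α = 0`, then
`|∫ f_α h| ≤ C (∑ ‖f_β‖₁) ‖∇h‖_n` for each `α`.

**Reduction.** The equation `𝒯 f = 0`, tested against forms `ψ dx^L` with one component, says that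
each of certain families of signed sums of components of `f`, indexed by `α`, is annihilated by
`∑ ∂^α`. As `ℵ` is a bijection onto all labels of length `ℓ` of `N`-space, every label `A` of
length `ℓ` with entries at most `n` is the label of some `α₀`; the sum of index `α₀` is a single
component, up to sign, because `A` and `L` determine the remaining label. Since `ℓ ≤ n - q` one can
choose `A` disjoint from a given label `I₀` and `L = A ⊔ I₀`, so every component `f_{I₀}` is
obtained in this way (`isolates_of_calTVanishes`). The equation `𝒯^* g = 0` is dual: there `A` is
chosen inside the given label (`isolates_of_calTAdjVanishes`). The coefficients are bounded in
terms of `n` alone, so that the constant does not depend on `ℓ`, `N` or `ℵ`.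

**The estimate for one direction.** For a direction `e` with `e 0 = 1` write `λ = ∑ eⱼ xⱼ` and
consider the component `∑ e^α f_α`. If `W` is a compactly supported approximate `k`-th primitive of
a bump `w` on the line, truncated at scale `s`, and `θ` varies at scale `s`, then
`∂^α (W(λ) θ) = e^α w(λ) θ` up to an error of size `s⁻¹ ‖w‖₁ ‖θ‖_∞`. The equation
`∑ ∂^α f_α = 0` thus bounds the pairing of `∑ e^α f_α` with `w(λ) θ` by this error times `‖f‖₁`
(`exists_abs_integral_dirComp_le`). Decomposing a Hölder function `u` of exponent `γ` into its
dyadic mollifications gives, for every `ε`, a bound for the pairing with `w(λ) u` in terms of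
`ε ^ γ ∫ |f| w(λ) + ε ^ (γ - 1) ‖w‖₁ ‖f‖₁` (`exists_abs_integral_slab_le`).

A test function `φ` is now cut into slabs `σ ≤ λ ≤ σ + 2τ`. On each slab it is replaced by its
values on one hyperplane `λ = t` on which the energy `∫ |∇φ| ^ n` is at most its mean over
`[σ, σ + τ]`. By Morrey's inequality in dimension `n - 1` these values are Hölder continuous with
`γ = 1 / n`. Optimizing `ε` on each slab and summing by Hölder's inequality gives the bound
`C ‖f‖₁ ‖∇φ‖_n`, while the error of the replacement is `O(τ)` and disappears as `τ → 0`
(`exists_abs_integral_dirComp_mul_le`).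

**Conclusion.** The vectors `(e^α)_α` with `e 0 = 1` span (`span_monomialVec_eq_top`), so the
estimate holds for each `f_α`. Bounded functions in `W^{1,n}` are limits of test functions, almost
everywhere and boundedly, with gradients that are asymptotically no larger (`exists_approx`), which
suffices because `f_α` is only integrable.
-/

noncomputable section

namespace KthOrderComplex

/-! ### Iterated partial derivatives along lists of coordinates -/

/-- The iterated partial derivative `∂_{j₁} ⋯ ∂_{jₘ} u` along the list `[j₁, …, jₘ]`. -/
def iterPartial {d : ℕ} (L : List (Fin d)) (u : Eucl d → ℝ) : Eucl d → ℝ :=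
  L.foldr partialDeriv u

/-- The nondecreasing list of coordinates in which `j` occurs `β j` times. -/
def indexList {d : ℕ} (β : Fin d → ℕ) : List (Fin d) :=
  (List.finRange d).flatMap fun j => List.replicate (β j) j

@[simp] theorem iterPartial_nil {d : ℕ} (u : Eucl d → ℝ) : iterPartial [] u = u := rfl

@[simp] theorem iterPartial_cons {d : ℕ} (j : Fin d) (L : List (Fin d)) (u : Eucl d → ℝ) :
    iterPartial (j :: L) u = partialDeriv j (iterPartial L u) := rfl

theorem iterPartial_concat {d : ℕ} (L : List (Fin d)) (j : Fin d) (u : Eucl d → ℝ) :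
    iterPartial (L ++ [j]) u = iterPartial L (partialDeriv j u) := by
  simp [iterPartial]

theorem multiDeriv_eq_iterPartial {d : ℕ} (β : Fin d → ℕ) (u : Eucl d → ℝ) :
    multiDeriv β u = iterPartial (indexList β) u := by
  have key : ∀ (j : Fin d) (m : ℕ) (v : Eucl d → ℝ),
      (partialDeriv j)^[m] v = (List.replicate m j).foldr partialDeriv v := by
    intro j m v
    induction m with
    | zero => rfl
    | succ m ih => rw [Function.iterate_succ_apply', ih, List.replicate_succ, List.foldr_cons]
  unfold multiDeriv iterPartial indexList
  rw [List.foldr_flatMap]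
  congr 1
  funext j v
  exact key j _ v

theorem length_indexList {d : ℕ} (β : Fin d → ℕ) : (indexList β).length = ∑ j, β j := by
  simp [indexList, List.length_flatMap, Fin.sum_univ_def]

theorem prod_map_indexList {d : ℕ} (β : Fin d → ℕ) (e : Fin d → ℝ) :
    ((indexList β).map e).prod = ∏ j, e j ^ β j := by
  rw [indexList, List.map_flatMap, Fin.prod_univ_def]
  generalize List.finRange d = l
  induction l with
  | nil => simp
  | cons a l ih =>
    rw [List.flatMap_cons, List.prod_append, ih]
    simp

theorem contDiff_partialDeriv {d : ℕ} {u : Eucl d → ℝ} (hu : ContDiff ℝ ∞ u) (j : Fin d) :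
    ContDiff ℝ ∞ (partialDeriv j u) :=
  (hu.fderiv_right (m := ∞) (by simp)).clm_apply contDiff_const

theorem contDiff_iterPartial {d : ℕ} {u : Eucl d → ℝ} (hu : ContDiff ℝ ∞ u) (L : List (Fin d)) :
    ContDiff ℝ ∞ (iterPartial L u) := by
  induction L with
  | nil => exact hu
  | cons j L ih => exact contDiff_partialDeriv ih j

theorem hasCompactSupport_partialDeriv {d : ℕ} {u : Eucl d → ℝ} (hu : HasCompactSupport u)
    (j : Fin d) : HasCompactSupport (partialDeriv j u) :=
  hu.fderiv_apply ℝ _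

theorem hasCompactSupport_iterPartial {d : ℕ} {u : Eucl d → ℝ} (hu : HasCompactSupport u)
    (L : List (Fin d)) : HasCompactSupport (iterPartial L u) := by
  induction L with
  | nil => exact hu
  | cons j L ih => exact hasCompactSupport_partialDeriv ih j

theorem partialDeriv_add {d : ℕ} {u v : Eucl d → ℝ} (hu : ContDiff ℝ ∞ u) (hv : ContDiff ℝ ∞ v)
    (j : Fin d) :
    partialDeriv j (fun x => u x + v x) = fun x => partialDeriv j u x + partialDeriv j v x := by
  funext x
  simp only [partialDeriv]
  rw [fderiv_fun_add (hu.differentiable (by simp) x) (hv.differentiable (by simp) x)]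
  rfl

theorem partialDeriv_const_mul {d : ℕ} {u : Eucl d → ℝ} (hu : ContDiff ℝ ∞ u) (c : ℝ)
    (j : Fin d) :
    partialDeriv j (fun x => c * u x) = fun x => c * partialDeriv j u x := by
  funext x
  simp only [partialDeriv]
  rw [fderiv_const_mul (hu.differentiable (by simp) x)]
  rfl

theorem partialDeriv_mul {d : ℕ} {u v : Eucl d → ℝ} (hu : ContDiff ℝ ∞ u) (hv : ContDiff ℝ ∞ v)
    (j : Fin d) :
    partialDeriv j (fun x => u x * v x) =
      fun x => partialDeriv j u x * v x + u x * partialDeriv j v x := by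
  funext x
  simp only [partialDeriv]
  rw [fderiv_fun_mul (hu.differentiable (by simp) x) (hv.differentiable (by simp) x)]
  simp
  ring

theorem iterPartial_add {d : ℕ} {u v : Eucl d → ℝ} (hu : ContDiff ℝ ∞ u) (hv : ContDiff ℝ ∞ v)
    (L : List (Fin d)) :
    iterPartial L (fun x => u x + v x) = fun x => iterPartial L u x + iterPartial L v x := by
  induction L with
  | nil => rfl
  | cons j L ih =>
    simp only [iterPartial_cons, ih]
    exact partialDeriv_add (contDiff_iterPartial hu L) (contDiff_iterPartial hv L) j

theorem iterPartial_const_mul {d : ℕ} {u : Eucl d → ℝ} (hu : ContDiff ℝ ∞ u) (c : ℝ)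
    (L : List (Fin d)) :
    iterPartial L (fun x => c * u x) = fun x => c * iterPartial L u x := by
  induction L with
  | nil => rfl
  | cons j L ih =>
    simp only [iterPartial_cons, ih]
    exact partialDeriv_const_mul (contDiff_iterPartial hu L) c j

theorem iterPartial_sub {d : ℕ} {u v : Eucl d → ℝ} (hu : ContDiff ℝ ∞ u) (hv : ContDiff ℝ ∞ v)
    (L : List (Fin d)) :
    iterPartial L (fun x => u x - v x) = fun x => iterPartial L u x - iterPartial L v x := by
  have h1 := iterPartial_add hu (contDiff_const.mul hv : ContDiff ℝ ∞ fun x => (-1 : ℝ) * v x) L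
  rw [iterPartial_const_mul hv] at h1
  simpa [sub_eq_add_neg] using h1

/-- Derivatives of a dilation: `∂_L (u (c ·)) = c^{|L|} (∂_L u) (c ·)`. -/
theorem iterPartial_comp_smul {d : ℕ} {u : Eucl d → ℝ} (hu : ContDiff ℝ ∞ u) (c : ℝ)
    (L : List (Fin d)) :
    iterPartial L (fun x => u (c • x)) = fun x => c ^ L.length * iterPartial L u (c • x) := by
  induction L with
  | nil => simp
  | cons j L ih =>
    have hs := contDiff_iterPartial hu L
    have hsc : ContDiff ℝ ∞ (fun x : Eucl d => iterPartial L u (c • x)) :=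
      hs.comp (contDiff_const_smul c)
    simp only [iterPartial_cons, ih, partialDeriv_const_mul hsc]
    funext x
    have : partialDeriv j (fun x => iterPartial L u (c • x)) x
        = c * partialDeriv j (iterPartial L u) (c • x) := by
      simp only [partialDeriv]
      have h1 : HasFDerivAt (fun x : Eucl d => c • x) (c • ContinuousLinearMap.id ℝ (Eucl d)) x :=
        (hasFDerivAt_id x).const_smul c
      have h2 := ((hs.differentiable (by simp) (c • x)).hasFDerivAt).comp x h1
      have h3 : fderiv ℝ (fun x => iterPartial L u (c • x)) x = _ := h2.fderiv
      rw [h3]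
      simp
    rw [this, List.length_cons]
    ring

/-- Convolution with a smooth compactly supported kernel: derivatives fall on the kernel. -/
theorem iterPartial_convolution {d : ℕ} {u ρ : Eucl d → ℝ} (hu : LocallyIntegrable u volume)
    (hρ : ContDiff ℝ ∞ ρ) (hc : HasCompactSupport ρ) (L : List (Fin d)) :
    iterPartial L (convolution u ρ (ContinuousLinearMap.lsmul ℝ ℝ) volume) =
      convolution u (iterPartial L ρ) (ContinuousLinearMap.lsmul ℝ ℝ) volume := by
  induction L with
  | nil => rfl
  | cons j L ih =>
    rw [iterPartial_cons, ih]
    have hs := contDiff_iterPartial hρ L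
    have hcs := hasCompactSupport_iterPartial hc L
    funext x
    have h1 := HasCompactSupport.hasFDerivAt_convolution_right (μ := volume)
      (ContinuousLinearMap.lsmul ℝ ℝ : ℝ →L[ℝ] ℝ →L[ℝ] ℝ) hcs hu (hs.of_le (by simp)) x
    simp only [partialDeriv]
    rw [h1.fderiv, convolution_precompR_apply _ hu (hcs.fderiv ℝ)
      (hs.continuous_fderiv (by simp))]
    rfl

theorem contDiff_convolution_kernel {d : ℕ} {u ρ : Eucl d → ℝ} (hu : LocallyIntegrable u volume)
    (hρ : ContDiff ℝ ∞ ρ) (hc : HasCompactSupport ρ) :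
    ContDiff ℝ ∞ (convolution u ρ (ContinuousLinearMap.lsmul ℝ ℝ) volume) :=
  hc.contDiff_convolution_right _ hu hρ

theorem integral_partialDeriv_eq_zero {d : ℕ} {u : Eucl d → ℝ} (hu : ContDiff ℝ ∞ u)
    (hc : HasCompactSupport u) (j : Fin d) : ∫ x, partialDeriv j u x = 0 := by
  have hi : Integrable (partialDeriv j u) volume :=
    (contDiff_partialDeriv hu j).continuous.integrable_of_hasCompactSupport
      (hasCompactSupport_partialDeriv hc j)
  have h := integral_mul_fderiv_eq_neg_fderiv_mul_of_integrable (μ := (volume : Measure (Eucl d)))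
    (f := fun _ : Eucl d => (1 : ℝ)) (g := u) (v := EuclideanSpace.single j 1)
    (by simp) (by simp only [one_mul]; exact hi)
    (by simpa using hu.continuous.integrable_of_hasCompactSupport hc)
    (fun x _ => differentiableAt_const _) (fun x _ => hu.differentiable (by simp) x)
  simpa [partialDeriv] using h

/-! ### Leibniz' rule for plane-wave modulated functions -/

/-- The linear form `x ↦ ∑ eⱼ xⱼ`. -/
def linForm {d : ℕ} (e : Fin d → ℝ) : Eucl d →L[ℝ] ℝ :=
  ∑ j, e j • (EuclideanSpace.proj j : Eucl d →L[ℝ] ℝ)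

theorem linForm_apply {d : ℕ} (e : Fin d → ℝ) (x : Eucl d) : linForm e x = ∑ j, e j * x j := by
  simp [linForm]

theorem linForm_single {d : ℕ} (e : Fin d → ℝ) (j : Fin d) :
    linForm e (EuclideanSpace.single j 1) = e j := by
  simp [linForm_apply]

theorem contDiff_comp_linForm {d : ℕ} (e : Fin d → ℝ) {W : ℝ → ℝ} (hW : ContDiff ℝ ∞ W) :
    ContDiff ℝ ∞ fun x : Eucl d => W (linForm e x) :=
  hW.comp (linForm e).contDiff

theorem partialDeriv_comp_linForm {d : ℕ} (e : Fin d → ℝ) {W : ℝ → ℝ} (hW : ContDiff ℝ ∞ W)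
    (j : Fin d) :
    partialDeriv j (fun x : Eucl d => W (linForm e x)) = fun x => e j * deriv W (linForm e x) := by
  funext x
  simp only [partialDeriv]
  have h := ((hW.differentiable (by simp) (linForm e x)).hasDerivAt).comp_hasFDerivAt x
    (linForm e).hasFDerivAt
  have h3 : fderiv ℝ (fun x => W (linForm e x)) x = _ := h.fderiv
  rw [h3]
  simp [linForm_single, mul_comm]

theorem contDiff_deriv_infty {W : ℝ → ℝ} (hW : ContDiff ℝ ∞ W) : ContDiff ℝ ∞ (deriv W) := by
  exact (contDiff_infty_iff_deriv.1 hW).2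

theorem abs_prod_map_le {d : ℕ} {e : Fin d → ℝ} {K : ℝ} (hK : ∀ j, |e j| ≤ K)
    (L : List (Fin d)) : |(L.map e).prod| ≤ K ^ L.length := by
  induction L with
  | nil => simp
  | cons j L ih =>
    simp only [List.map_cons, List.prod_cons, List.length_cons, abs_mul, pow_succ']
    exact mul_le_mul (hK j) ih (abs_nonneg _) ((abs_nonneg _).trans (hK j))

/-- If `W` varies at scale `r⁻¹` up to order `|L| - 1` with amplitude `A`, and `θ` varies at scale
`r⁻¹` with amplitude `B`, then in `∂_L (W(λ) θ)`, `λ = linForm e`, all terms but the one in which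
every derivative falls on `W` are of size `A B r^{|L|}`. -/
theorem iterPartial_planeWave_mul {d : ℕ} {e : Fin d → ℝ} {K : ℝ} (hK : ∀ j, |e j| ≤ K)
    (hK1 : 1 ≤ K) (L : List (Fin d)) {r : ℝ} (hr : 0 ≤ r) :
    ∀ (W : ℝ → ℝ) (θ : Eucl d → ℝ) (A B : ℝ), ContDiff ℝ ∞ W → ContDiff ℝ ∞ θ → 0 ≤ A → 0 ≤ B →
      (∀ j < L.length, ∀ x, |iteratedDeriv j W x| ≤ A * r ^ j) →
      (∀ L' : List (Fin d), L'.length ≤ L.length → ∀ x, |iterPartial L' θ x| ≤ B * r ^ L'.length) →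
      ∀ x, |iterPartial L (fun x => W (linForm e x) * θ x) x -
        (L.map e).prod * iteratedDeriv L.length W (linForm e x) * θ x| ≤
          (3 * K) ^ L.length * A * B * r ^ L.length := by
  induction L using List.reverseRecOn with
  | nil =>
    intro W θ A B _ _ hA hB _ _ x
    simp
    positivity
  | append_singleton L j ih =>
    intro W θ A B hW hθ hA hB hWb hθb x
    have hK0 : 0 ≤ K := by linarith
    have hW' := contDiff_deriv_infty hW
    have hθ' := contDiff_partialDeriv hθ j
    have hstep : iterPartial (L ++ [j]) (fun x => W (linForm e x) * θ x) =
        fun x => e j * iterPartial L (fun x => deriv W (linForm e x) * θ x) x +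
          iterPartial L (fun x => W (linForm e x) * partialDeriv j θ x) x := by
      rw [iterPartial_concat, partialDeriv_mul (contDiff_comp_linForm e hW) hθ,
        partialDeriv_comp_linForm e hW]
      rw [iterPartial_add (u := fun x => e j * deriv W (linForm e x) * θ x)
        ((contDiff_const.mul (contDiff_comp_linForm e hW')).mul hθ)
        ((contDiff_comp_linForm e hW).mul hθ')]
      have : (fun x => e j * deriv W (linForm e x) * θ x) =
          fun x => e j * (deriv W (linForm e x) * θ x) := by funext x; ring
      rw [this, iterPartial_const_mul ((contDiff_comp_linForm e hW').mul hθ)]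
    have hlen : (L ++ [j]).length = L.length + 1 := by simp
    have h1 := ih (deriv W) θ (A * r) B hW' hθ (by positivity) hB
      (fun i hi x => by
        have := hWb (i + 1) (by rw [hlen]; omega) x
        rw [iteratedDeriv_succ'] at this
        calc _ ≤ _ := this
          _ = _ := by ring)
      (fun L' hL' x => hθb L' (by rw [hlen]; omega) x) x
    have h2 := ih W (partialDeriv j θ) A (B * r) hW hθ' hA (by positivity)
      (fun i hi x => hWb i (by rw [hlen]; omega) x)
      (fun L' hL' x => by
        have := hθb (L' ++ [j]) (by simp; omega) x
        rw [iterPartial_concat] at this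
        calc _ ≤ _ := this
          _ = _ := by simp; ring) x
    have h3 : |(L.map e).prod * iteratedDeriv L.length W (linForm e x) * partialDeriv j θ x| ≤
        K ^ L.length * (A * r ^ L.length) * (B * r) := by
      rw [abs_mul, abs_mul]
      have a1 := abs_prod_map_le hK L
      have a2 := hWb L.length (by rw [hlen]; omega) (linForm e x)
      have a3 := hθb [j] (by simp) x
      simp only [iterPartial_cons, iterPartial_nil, List.length_singleton, pow_one] at a3
      gcongr
    rw [hstep]
    set P := iterPartial L (fun x => deriv W (linForm e x) * θ x) x
    set Q := iterPartial L (fun x => W (linForm e x) * partialDeriv j θ x) x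
    have hmain : ((L ++ [j]).map e).prod * iteratedDeriv (L ++ [j]).length W (linForm e x) * θ x
        = e j * ((L.map e).prod * iteratedDeriv L.length (deriv W) (linForm e x) * θ x) := by
      rw [hlen, iteratedDeriv_succ']
      simp
      ring
    rw [hmain]
    set m := (L.map e).prod * iteratedDeriv L.length (deriv W) (linForm e x) * θ x
    set m' := (L.map e).prod * iteratedDeriv L.length W (linForm e x) * partialDeriv j θ x
    have hD : 0 ≤ A * B * r ^ (L.length + 1) := by positivity
    have e1 : |e j * (P - m)| ≤ K * ((3 * K) ^ L.length * (A * r) * B * r ^ L.length) := by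
      rw [abs_mul]
      have := hK j
      gcongr
    have hpow : K ^ L.length ≤ (3 * K) ^ L.length := by gcongr; linarith
    have hpow2 : (3 * K) ^ L.length ≤ K * (3 * K) ^ L.length := by
      have : 0 ≤ (3 * K) ^ L.length := by positivity
      nlinarith
    calc |e j * P + Q - e j * m| = |e j * (P - m) + (Q - m') + m'| := by ring_nf
      _ ≤ |e j * (P - m)| + |Q - m'| + |m'| := (abs_add_le _ _).trans (by gcongr; exact abs_add_le _ _)
      _ ≤ K * ((3 * K) ^ L.length * (A * r) * B * r ^ L.length)
          + (3 * K) ^ L.length * A * (B * r) * r ^ L.length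
          + K ^ L.length * (A * r ^ L.length) * (B * r) := by gcongr
      _ = (K * (3 * K) ^ L.length + (3 * K) ^ L.length + K ^ L.length) *
          (A * B * r ^ (L.length + 1)) := by ring
      _ ≤ (3 * (K * (3 * K) ^ L.length)) * (A * B * r ^ (L.length + 1)) := by
          gcongr; linarith
      _ = _ := by rw [hlen]; ring

/-! ### Compactly supported approximate primitives on the line -/

/-- The kernel `(1 - r / s) 1_{(0, s]}(r)`, a compactly supported primitive of
`δ₀ - s⁻¹ 1_{(0, s]}`. -/
def rampKernel (s : ℝ) : ℝ → ℝ := (Set.Ioc 0 s).indicator fun r => 1 - r / s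

/-- Convolution with `rampKernel s`. -/
def rampAverage (s : ℝ) (w : ℝ → ℝ) : ℝ → ℝ :=
  convolution (rampKernel s) w (ContinuousLinearMap.lsmul ℝ ℝ) volume

theorem rampAverage_eq {s : ℝ} (hs : 0 < s) (w : ℝ → ℝ) (x : ℝ) :
    rampAverage s w x = ∫ r in (0 : ℝ)..s, (1 - r / s) * w (x - r) := by
  rw [intervalIntegral.integral_of_le hs.le, ← integral_indicator measurableSet_Ioc]
  simp only [rampAverage, convolution, rampKernel, ContinuousLinearMap.lsmul_apply, smul_eq_mul]
  congr 1
  funext r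
  by_cases h : r ∈ Set.Ioc 0 s <;> simp [h]

theorem integrable_rampKernel (s : ℝ) : Integrable (rampKernel s) volume := by
  rw [rampKernel, integrable_indicator_iff measurableSet_Ioc]
  exact (Continuous.integrableOn_Icc (by fun_prop)).mono_set Set.Ioc_subset_Icc_self

theorem contDiff_rampAverage (s : ℝ) {w : ℝ → ℝ} (hw : ContDiff ℝ ∞ w)
    (hc : HasCompactSupport w) : ContDiff ℝ ∞ (rampAverage s w) :=
  hc.contDiff_convolution_right _ (integrable_rampKernel s).locallyIntegrable hw

theorem hasCompactSupport_rampAverage (s : ℝ) {w : ℝ → ℝ} (hc : HasCompactSupport w) :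
    HasCompactSupport (rampAverage s w) := by
  refine HasCompactSupport.convolution _ ?_ hc
  refine HasCompactSupport.intro' (K := Set.Icc 0 s) isCompact_Icc isClosed_Icc ?_
  intro x hx
  exact Set.indicator_of_notMem (fun h => hx (Set.Ioc_subset_Icc_self h)) _

theorem deriv_rampAverage (s : ℝ) {w : ℝ → ℝ} (hw : ContDiff ℝ ∞ w)
    (hc : HasCompactSupport w) : deriv (rampAverage s w) = rampAverage s (deriv w) := by
  funext x
  exact (hc.hasDerivAt_convolution_right _ (integrable_rampKernel s).locallyIntegrable
    (hw.of_le (by simp)) x).deriv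

theorem iteratedDeriv_rampAverage (s : ℝ) {w : ℝ → ℝ} (hw : ContDiff ℝ ∞ w)
    (hc : HasCompactSupport w) (j : ℕ) :
    iteratedDeriv j (rampAverage s w) = rampAverage s (iteratedDeriv j w) := by
  induction j generalizing w with
  | zero => simp
  | succ j ih =>
    rw [iteratedDeriv_succ', iteratedDeriv_succ', deriv_rampAverage s hw hc,
      ih (contDiff_deriv_infty hw) hc.deriv]

/-- Integration by parts: differentiating the ramp average returns the function minus its average
over an interval of length `s`. -/
theorem rampAverage_deriv {s : ℝ} (hs : 0 < s) {w : ℝ → ℝ} (hw : ContDiff ℝ ∞ w) (x : ℝ) :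
    rampAverage s (deriv w) x = w x - s⁻¹ * ∫ r in (0 : ℝ)..s, w (x - r) := by
  rw [rampAverage_eq hs]
  have hd : ∀ r, HasDerivAt (fun r => -w (x - r)) (deriv w (x - r)) r := fun r => by
    have h1 : HasDerivAt (fun r : ℝ => x - r) (-1) r := by
      simpa using (hasDerivAt_id r).const_sub x
    have h2 := (((hw.differentiable (by simp) (x - r)).hasDerivAt).comp r h1).fun_neg
    simpa [Function.comp_def] using h2
  have hl : ∀ r, HasDerivAt (fun r : ℝ => 1 - r / s) (-s⁻¹) r := fun r => by
    simpa using ((hasDerivAt_id r).div_const s).const_sub 1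
  rw [intervalIntegral.integral_mul_deriv_eq_deriv_mul (fun r _ => hl r) (fun r _ => hd r)
    intervalIntegrable_const
    (Continuous.intervalIntegrable
      ((contDiff_deriv_infty hw).continuous.comp (continuous_const.sub continuous_id)) _ _)]
  rw [div_self hs.ne']
  simp [intervalIntegral.integral_const_mul]

theorem abs_rampAverage_le_integral {s : ℝ} (hs : 0 < s) {w : ℝ → ℝ} (hw : Continuous w)
    (hc : HasCompactSupport w) (x : ℝ) : |rampAverage s w x| ≤ ∫ r, |w r| := by
  have hi : Integrable (fun r => |w (x - r)|) volume :=
    ((hw.integrable_of_hasCompactSupport hc).abs).comp_sub_left x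
  calc |rampAverage s w x| ≤ ∫ r, |w (x - r)| := by
        rw [← Real.norm_eq_abs]
        refine norm_integral_le_of_norm_le hi (Filter.Eventually.of_forall fun r => ?_)
        simp only [rampKernel, ContinuousLinearMap.lsmul_apply, smul_eq_mul, Real.norm_eq_abs,
          abs_mul]
        refine mul_le_of_le_one_left (abs_nonneg _) ?_
        by_cases h : r ∈ Set.Ioc 0 s
        · rw [Set.indicator_of_mem h]
          have h1 : r / s ≤ 1 := (div_le_one hs).2 h.2
          have h2 : 0 ≤ r / s := div_nonneg h.1.le hs.le
          rw [abs_le]; constructor <;> linarith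
        · rw [Set.indicator_of_notMem h]; simp
    _ = ∫ r, |w r| := integral_sub_left_eq_self (fun r => |w r|) volume x

theorem abs_rampAverage_le_sup {s : ℝ} (hs : 0 < s) {w : ℝ → ℝ} {M : ℝ}
    (hM : ∀ x, |w x| ≤ M) (x : ℝ) : |rampAverage s w x| ≤ s * M := by
  rw [rampAverage_eq hs]
  have hM0 : 0 ≤ M := (abs_nonneg _).trans (hM 0)
  have := intervalIntegral.norm_integral_le_of_norm_le_const (a := 0) (b := s) (C := M)
    (f := fun r => (1 - r / s) * w (x - r)) (fun r hr => by
      rw [Set.uIoc_of_le hs.le] at hr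
      have h1 : r / s ≤ 1 := (div_le_one hs).2 hr.2
      have h2 : 0 ≤ r / s := div_nonneg hr.1.le hs.le
      rw [Real.norm_eq_abs, abs_mul]
      calc _ ≤ 1 * M := by
            refine mul_le_mul ?_ (hM _) (abs_nonneg _) zero_le_one
            rw [abs_le]; constructor <;> linarith
        _ = M := one_mul _)
  rw [sub_zero, abs_of_pos hs, mul_comm] at this
  exact this

theorem abs_average_le_integral {s : ℝ} (hs : 0 < s) {w : ℝ → ℝ} (hw : Continuous w)
    (hc : HasCompactSupport w) (x : ℝ) :
    |s⁻¹ * ∫ r in (0 : ℝ)..s, w (x - r)| ≤ s⁻¹ * ∫ r, |w r| := by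
  rw [abs_mul, abs_of_pos (inv_pos.2 hs)]
  have hi : Integrable (fun r => |w (x - r)|) volume :=
    ((hw.integrable_of_hasCompactSupport hc).abs).comp_sub_left x
  gcongr
  rw [intervalIntegral.integral_of_le hs.le]
  calc _ ≤ ∫ r in Set.Ioc 0 s, |w (x - r)| := by
        simpa using norm_integral_le_integral_norm (fun r => w (x - r))
    _ ≤ ∫ r, |w (x - r)| :=
        setIntegral_le_integral hi (Filter.Eventually.of_forall fun _ => abs_nonneg _)
    _ = _ := integral_sub_left_eq_self (fun r => |w r|) volume x

theorem abs_average_le_sup {s : ℝ} (hs : 0 < s) {w : ℝ → ℝ} {M : ℝ}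
    (hM : ∀ x, |w x| ≤ M) (x : ℝ) : |s⁻¹ * ∫ r in (0 : ℝ)..s, w (x - r)| ≤ M := by
  rw [abs_mul, abs_of_pos (inv_pos.2 hs)]
  have := intervalIntegral.norm_integral_le_of_norm_le_const (a := 0) (b := s) (C := M)
    (f := fun r => w (x - r)) (fun r _ => hM _)
  rw [sub_zero, abs_of_pos hs, Real.norm_eq_abs] at this
  calc _ ≤ s⁻¹ * (M * s) := by gcongr
    _ = M := by field_simp

/-- A smooth bump `w` on the line is, up to an error of size `s⁻¹ ∫ |w|`, the `k`-th derivative of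
a compactly supported function `W` whose lower derivatives are those of a `k`-th primitive of `w`
truncated at scale `s`. The function `W` arises by applying `rampAverage s` to `w` `k` times. -/
theorem exists_truncated_primitive (k : ℕ) : ∃ C : ℝ, 0 ≤ C ∧ ∀ s : ℝ, 0 < s → ∀ w : ℝ → ℝ,
    ContDiff ℝ ∞ w → HasCompactSupport w → ∃ W : ℝ → ℝ, ContDiff ℝ ∞ W ∧ HasCompactSupport W ∧
      (∀ j < k, ∀ x, |iteratedDeriv j W x| ≤ C * (∫ r, |w r|) * (s ^ k * s⁻¹) * s⁻¹ ^ j) ∧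
      ∀ x, |iteratedDeriv k W x - w x| ≤ C * (∫ r, |w r|) * s⁻¹ := by
  induction k with
  | zero =>
    refine ⟨0, le_rfl, fun s _ w hw hc => ⟨w, hw, hc, ?_, ?_⟩⟩ <;> simp
  | succ k ih =>
    obtain ⟨C, hC, ih⟩ := ih
    refine ⟨2 * C + 1, by positivity, fun s hs w hw hc => ?_⟩
    obtain ⟨W, hW, hWc, hWj, hWk⟩ := ih s hs w hw hc
    have hI : 0 ≤ ∫ r, |w r| := integral_nonneg fun _ => abs_nonneg _
    set I := ∫ r, |w r| with hIdef
    have hWk' : ContDiff ℝ ∞ (iteratedDeriv k W) := by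
      rw [iteratedDeriv_eq_iterate]; exact hW.iterate_deriv k
    -- The two parts of `iteratedDeriv k W = w + v` are estimated separately: the error `v` is
    -- small in the supremum norm, whereas `w` is controlled in `L¹` only.
    set v : ℝ → ℝ := fun x => iteratedDeriv k W x - w x with hv
    have hsplit : ∀ x, iteratedDeriv k W x = w x + v x := fun x => by simp [hv]
    refine ⟨rampAverage s W, contDiff_rampAverage s hW hWc, hasCompactSupport_rampAverage s hWc,
      ?_, ?_⟩
    · intro j hj x
      rw [iteratedDeriv_rampAverage s hW hWc]
      rcases Nat.lt_succ_iff_lt_or_eq.1 hj with hj | rfl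
      · calc _ ≤ s * (C * I * (s ^ k * s⁻¹) * s⁻¹ ^ j) :=
              abs_rampAverage_le_sup hs (fun y => hWj j hj y) x
          _ = C * I * (s ^ (k + 1) * s⁻¹) * s⁻¹ ^ j := by ring
          _ ≤ _ := by gcongr; linarith
      · have e1 : rampAverage s (iteratedDeriv j W) x = rampAverage s w x + rampAverage s v x := by
          have hc1 : Continuous (fun r => (1 - r / s) * w (x - r)) := by
            have := hw.continuous; fun_prop
          have hc2 : Continuous (fun r => (1 - r / s) * v (x - r)) := by
            have h1 := hw.continuous
            have h2 := hWk'.continuous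
            simp only [hv]; fun_prop
          rw [rampAverage_eq hs, rampAverage_eq hs, rampAverage_eq hs,
            ← intervalIntegral.integral_add (hc1.intervalIntegrable _ _)
              (hc2.intervalIntegrable _ _)]
          congr 1
          funext r
          rw [hsplit]; ring
        have hs1 : s ^ (j + 1) * s⁻¹ * s⁻¹ ^ j = 1 := by
          rw [pow_succ, mul_assoc (s ^ j), mul_inv_cancel₀ hs.ne', mul_one, ← mul_pow,
            mul_inv_cancel₀ hs.ne', one_pow]
        rw [e1, mul_assoc ((2 * C + 1) * I), hs1, mul_one]
        calc _ ≤ |rampAverage s w x| + |rampAverage s v x| := abs_add_le _ _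
          _ ≤ I + s * (C * I * s⁻¹) := by
              gcongr
              · exact abs_rampAverage_le_integral hs hw.continuous hc x
              · exact abs_rampAverage_le_sup hs hWk x
          _ = I + C * I := by field_simp
          _ ≤ _ := by nlinarith [mul_nonneg hC hI]
    · intro x
      rw [iteratedDeriv_rampAverage s hW hWc, iteratedDeriv_succ, rampAverage_deriv hs hWk', hsplit]
      have e2 : (s⁻¹ * ∫ r in (0 : ℝ)..s, iteratedDeriv k W (x - r)) =
          (s⁻¹ * ∫ r in (0 : ℝ)..s, w (x - r)) + s⁻¹ * ∫ r in (0 : ℝ)..s, v (x - r) := by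
        have hc1 : Continuous (fun r => w (x - r)) := by
          have := hw.continuous; fun_prop
        have hc2 : Continuous (fun r => v (x - r)) := by
          have h1 := hw.continuous
          have h2 := hWk'.continuous
          simp only [hv]; fun_prop
        rw [← mul_add, ← intervalIntegral.integral_add (hc1.intervalIntegrable _ _)
              (hc2.intervalIntegrable _ _)]
        congr 2
        funext r
        rw [hsplit]
      rw [e2]
      have b1 := abs_average_le_integral hs hw.continuous hc x
      have b2 := abs_average_le_sup hs hWk x
      have b3 := hWk x
      rw [abs_le] at *
      have : (2 * C + 1) * I * s⁻¹ = C * I * s⁻¹ + C * I * s⁻¹ + s⁻¹ * I := by ring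
      rw [this]
      change -(C * I * s⁻¹) ≤ v x ∧ v x ≤ _ at b3
      constructor <;> linarith [b1.1, b1.2, b2.1, b2.2, b3.1, b3.2]

/-! ### Mollification of Hölder functions -/

theorem tsupport_iterPartial_subset {d : ℕ} (u : Eucl d → ℝ) (L : List (Fin d)) :
    tsupport (iterPartial L u) ⊆ tsupport u := by
  induction L with
  | nil => exact subset_rfl
  | cons j L ih =>
    refine (closure_minimal ?_ (isClosed_tsupport _)).trans ih
    intro x hx
    refine support_fderiv_subset ℝ (f := iterPartial L u) ?_
    intro h0
    apply hx
    simp [partialDeriv, h0]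

theorem convolution_smul_eq_integral {d : ℕ} (u κ : Eucl d → ℝ) (y : Eucl d) :
    convolution u κ (ContinuousLinearMap.lsmul ℝ ℝ) volume y = ∫ t, u (y - t) * κ t := by
  simp only [convolution, ContinuousLinearMap.lsmul_apply, smul_eq_mul]
  rw [← integral_sub_left_eq_self (fun t => u (y - t) * κ t) volume y]
  simp

/-- The fixed mollification kernel of integral one, supported in the closed unit ball. -/
def unitBump (d : ℕ) : Eucl d → ℝ :=
  (⟨1 / 2, 1, by norm_num, by norm_num⟩ : ContDiffBump (0 : Eucl d)).normed volume

theorem contDiff_unitBump (d : ℕ) : ContDiff ℝ ∞ (unitBump d) := ContDiffBump.contDiff_normed _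

theorem hasCompactSupport_unitBump (d : ℕ) : HasCompactSupport (unitBump d) :=
  ContDiffBump.hasCompactSupport_normed _

theorem integral_unitBump (d : ℕ) : ∫ x, unitBump d x = 1 := ContDiffBump.integral_normed _

theorem integral_abs_unitBump (d : ℕ) : ∫ x, |unitBump d x| = 1 := by
  rw [← integral_unitBump d]
  congr 1
  funext x
  exact abs_of_nonneg (ContDiffBump.nonneg_normed _ _)

theorem tsupport_unitBump (d : ℕ) : tsupport (unitBump d) ⊆ Metric.closedBall 0 1 := by
  rw [unitBump, ContDiffBump.tsupport_normed_eq]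

theorem norm_le_one_of_iterPartial_unitBump_ne_zero {d : ℕ} (L : List (Fin d)) {t : Eucl d}
    (ht : iterPartial L (unitBump d) t ≠ 0) : ‖t‖ ≤ 1 := by
  have := tsupport_unitBump d (tsupport_iterPartial_subset _ L (subset_tsupport _ ht))
  simpa using this

theorem abs_convolution_sub_le {d : ℕ} {u κ : Eucl d → ℝ} (hu : Continuous u)
    (hκ : Continuous κ) (hc : HasCompactSupport κ) (hsupp : ∀ t, κ t ≠ 0 → ‖t‖ ≤ 1)
    {D : ℝ} (hD : ∀ y t : Eucl d, ‖t‖ ≤ 1 → |u (y - t) - u y| ≤ D) (y : Eucl d) :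
    |convolution u κ (ContinuousLinearMap.lsmul ℝ ℝ) volume y - u y * ∫ t, κ t| ≤
      D * ∫ t, |κ t| := by
  rw [convolution_smul_eq_integral, ← integral_const_mul, ← integral_sub, ← integral_const_mul]
  · rw [← Real.norm_eq_abs]
    refine norm_integral_le_of_norm_le
      (((hκ.integrable_of_hasCompactSupport hc).abs).const_mul D)
      (Filter.Eventually.of_forall fun t => ?_)
    rw [Real.norm_eq_abs, ← sub_mul, abs_mul]
    by_cases h : κ t = 0
    · simp [h]
    · exact mul_le_mul_of_nonneg_right (hD y t (hsupp t h)) (abs_nonneg _)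
  · exact Continuous.integrable_of_hasCompactSupport (by fun_prop) hc.mul_left
  · exact (hκ.integrable_of_hasCompactSupport hc).const_mul _

theorem abs_convolution_le {d : ℕ} {u κ : Eucl d → ℝ}
    (hκ : Continuous κ) (hc : HasCompactSupport κ)
    {M : ℝ} (hM : ∀ y, |u y| ≤ M) (y : Eucl d) :
    |convolution u κ (ContinuousLinearMap.lsmul ℝ ℝ) volume y| ≤ M * ∫ t, |κ t| := by
  rw [convolution_smul_eq_integral, ← integral_const_mul]
  rw [← Real.norm_eq_abs]
  refine norm_integral_le_of_norm_le
      (((hκ.integrable_of_hasCompactSupport hc).abs).const_mul M)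
      (Filter.Eventually.of_forall fun t => ?_)
  rw [Real.norm_eq_abs, abs_mul]
  exact mul_le_mul_of_nonneg_right (hM _) (abs_nonneg _)

/-- The mollification of `u` at scale `s`, written as a dilate of a mollification at scale one. -/
def mollify {d : ℕ} (s : ℝ) (u : Eucl d → ℝ) : Eucl d → ℝ := fun x =>
  convolution (fun z => u (s • z)) (unitBump d) (ContinuousLinearMap.lsmul ℝ ℝ) volume (s⁻¹ • x)

section Mollify

variable {d : ℕ} {u : Eucl d → ℝ}

theorem locallyIntegrable_comp_smul (hu : Continuous u) (s : ℝ) :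
    LocallyIntegrable (fun z : Eucl d => u (s • z)) volume :=
  Continuous.locallyIntegrable (hu.comp (continuous_const_smul s))

theorem contDiff_mollify (hu : Continuous u) (s : ℝ) : ContDiff ℝ ∞ (mollify s u) :=
  (contDiff_convolution_kernel (locallyIntegrable_comp_smul hu s) (contDiff_unitBump d)
    (hasCompactSupport_unitBump d)).comp (contDiff_const_smul s⁻¹)

theorem iterPartial_mollify (hu : Continuous u) (s : ℝ) (L : List (Fin d)) (x : Eucl d) :
    iterPartial L (mollify s u) x = s⁻¹ ^ L.length *
      convolution (fun z => u (s • z)) (iterPartial L (unitBump d))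
        (ContinuousLinearMap.lsmul ℝ ℝ) volume (s⁻¹ • x) := by
  have h := iterPartial_comp_smul (contDiff_convolution_kernel (locallyIntegrable_comp_smul hu s)
    (contDiff_unitBump d) (hasCompactSupport_unitBump d)) s⁻¹ L
  rw [iterPartial_convolution (locallyIntegrable_comp_smul hu s) (contDiff_unitBump d)
    (hasCompactSupport_unitBump d)] at h
  exact congrFun h x

theorem mollify_eq_zero {s : ℝ} (hs : 0 < s) {x : Eucl d}
    (h : ∀ y, dist y x ≤ s → u y = 0) : mollify s u x = 0 := by
  rw [mollify, convolution_smul_eq_integral]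
  refine integral_eq_zero_of_ae (Filter.Eventually.of_forall fun t => ?_)
  by_cases ht : unitBump d t = 0
  · simp [ht]
  · have ht' := norm_le_one_of_iterPartial_unitBump_ne_zero [] ht
    have h0 : u (s • (s⁻¹ • x - t)) = 0 := by
      apply h
      rw [dist_eq_norm, smul_sub, smul_inv_smul₀ hs.ne', sub_sub_cancel_left, norm_neg, norm_smul,
        Real.norm_eq_abs, abs_of_pos hs]
      nlinarith
    simp [h0]

variable {B γ : ℝ}

theorem holder_comp_smul (hγ : 0 < γ) (hu : ∀ x y, |u x - u y| ≤ B * dist x y ^ γ)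
    {s : ℝ} (hs : 0 < s) (hB : 0 ≤ B) (y t : Eucl d) (ht : ‖t‖ ≤ 1) :
    |u (s • (y - t)) - u (s • y)| ≤ B * s ^ γ := by
  refine (hu _ _).trans ?_
  gcongr
  rw [dist_eq_norm, smul_sub, sub_sub_cancel_left, norm_neg, norm_smul,
        Real.norm_eq_abs, abs_of_pos hs]
  nlinarith

theorem abs_mollify_sub_le (hu : Continuous u) (hγ : 0 < γ) (hB : 0 ≤ B)
    (hh : ∀ x y, |u x - u y| ≤ B * dist x y ^ γ) {s : ℝ} (hs : 0 < s) (x : Eucl d) :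
    |mollify s u x - u x| ≤ B * s ^ γ := by
  have h := abs_convolution_sub_le (u := fun z => u (s • z))
    (hu.comp (continuous_const_smul s)) (contDiff_unitBump d).continuous
    (hasCompactSupport_unitBump d)
    (fun t ht => norm_le_one_of_iterPartial_unitBump_ne_zero [] ht)
    (fun y t ht => holder_comp_smul hγ hh hs hB y t ht) (s⁻¹ • x)
  rw [integral_unitBump, integral_abs_unitBump, smul_inv_smul₀ hs.ne'] at h
  simpa [mollify] using h

end Mollify

/-- A bound for the `L¹` norms of the derivatives of the mollification kernel up to order `k`. -/
theorem exists_bound_unitBump (d k : ℕ) : ∃ C : ℝ, 1 ≤ C ∧ ∀ L : List (Fin d), L.length ≤ k →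
    ∫ t, |iterPartial L (unitBump d) t| ≤ C := by
  have hfin : {L : List (Fin d) | L.length ≤ k}.Finite := List.finite_length_le _ _
  obtain ⟨C, hC⟩ := (hfin.image fun L => ∫ t, |iterPartial L (unitBump d) t|).bddAbove
  exact ⟨max 1 C, le_max_left _ _, fun L hL =>
    (hC (Set.mem_image_of_mem _ hL)).trans (le_max_right _ _)⟩

theorem abs_iterPartial_mollify_le {d k : ℕ} {C : ℝ} (hC : ∀ L : List (Fin d), L.length ≤ k →
    ∫ t, |iterPartial L (unitBump d) t| ≤ C) {u : Eucl d → ℝ} (hu : Continuous u) {M : ℝ}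
    (hM : ∀ x, |u x| ≤ M) {s : ℝ} (hs : 0 < s) (L : List (Fin d)) (hL : L.length ≤ k)
    (x : Eucl d) : |iterPartial L (mollify s u) x| ≤ C * M * s⁻¹ ^ L.length := by
  have hM0 : 0 ≤ M := (abs_nonneg _).trans (hM 0)
  have hρ := contDiff_iterPartial (contDiff_unitBump d) L
  have hρc := hasCompactSupport_iterPartial (hasCompactSupport_unitBump d) L
  rw [iterPartial_mollify hu, abs_mul, abs_of_nonneg (by positivity), mul_comm]
  gcongr
  refine (abs_convolution_le hρ.continuous hρc (u := fun z => u (s • z)) (fun y => hM _) _).trans ?_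
  rw [mul_comm]
  gcongr
  exact hC L hL

theorem abs_iterPartial_mollify_le_of_holder {d k : ℕ} {C : ℝ}
    (hC : ∀ L : List (Fin d), L.length ≤ k → ∫ t, |iterPartial L (unitBump d) t| ≤ C)
    {u : Eucl d → ℝ} (hu : Continuous u) {B γ : ℝ} (hγ : 0 < γ) (hB : 0 ≤ B)
    (hh : ∀ x y, |u x - u y| ≤ B * dist x y ^ γ) {s : ℝ} (hs : 0 < s)
    (L : List (Fin d)) (hL : L.length ≤ k) (hL0 : L ≠ [])
    (x : Eucl d) : |iterPartial L (mollify s u) x| ≤ C * (B * s ^ γ) * s⁻¹ ^ L.length := by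
  have hρ := contDiff_iterPartial (contDiff_unitBump d) L
  have hρc := hasCompactSupport_iterPartial (hasCompactSupport_unitBump d) L
  have hint : ∫ t, iterPartial L (unitBump d) t = 0 := by
    cases L with
    | nil => exact absurd rfl hL0
    | cons j L =>
      exact integral_partialDeriv_eq_zero (contDiff_iterPartial (contDiff_unitBump d) L)
        (hasCompactSupport_iterPartial (hasCompactSupport_unitBump d) L) j
  have h := abs_convolution_sub_le (u := fun z => u (s • z))
    (hu.comp (continuous_const_smul s)) hρ.continuous hρc
    (fun t ht => norm_le_one_of_iterPartial_unitBump_ne_zero L ht)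
    (fun y t ht => holder_comp_smul hγ hh hs hB y t ht) (s⁻¹ • x)
  rw [hint, mul_zero, sub_zero] at h
  rw [iterPartial_mollify hu, abs_mul, abs_of_nonneg (by positivity), mul_comm]
  gcongr
  refine h.trans ?_
  rw [mul_comm]
  gcongr
  exact hC L hL

/-- Consecutive dyadic mollifications of a Hölder function differ by a function which, to every
order, varies at scale `s` with amplitude `B s ^ γ`. -/
theorem abs_iterPartial_mollify_sub_mollify_le {d k : ℕ} {C : ℝ} (hC1 : 1 ≤ C)
    (hC : ∀ L : List (Fin d), L.length ≤ k → ∫ t, |iterPartial L (unitBump d) t| ≤ C)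
    {u : Eucl d → ℝ} (hu : Continuous u) {B γ : ℝ} (hγ : 0 < γ) (hγ1 : γ ≤ 1) (hB : 0 ≤ B)
    (hh : ∀ x y, |u x - u y| ≤ B * dist x y ^ γ) {s : ℝ} (hs : 0 < s)
    (L : List (Fin d)) (hL : L.length ≤ k) (x : Eucl d) :
    |iterPartial L (fun x => mollify s u x - mollify (2 * s) u x) x| ≤
      3 * C * (B * s ^ γ) * s⁻¹ ^ L.length := by
  have hs2 : (0 : ℝ) < 2 * s := by positivity
  have hpow : (2 * s) ^ γ ≤ 2 * s ^ γ := by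
    rw [Real.mul_rpow (by norm_num) hs.le]
    gcongr
    calc (2 : ℝ) ^ γ ≤ 2 ^ (1 : ℝ) := Real.rpow_le_rpow_of_exponent_le (by norm_num) hγ1
      _ = 2 := Real.rpow_one 2
  have hsγ : 0 ≤ s ^ γ := by positivity
  rw [iterPartial_sub (contDiff_mollify hu _) (contDiff_mollify hu _)]
  by_cases hL0 : L = []
  · subst hL0
    have h1 := abs_mollify_sub_le hu hγ hB hh hs x
    have h2 := abs_mollify_sub_le hu hγ hB hh hs2 x
    simp only [iterPartial_nil, List.length_nil, pow_zero, mul_one]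
    have h3 : B * (2 * s) ^ γ ≤ B * (2 * s ^ γ) := by gcongr
    have h4 : 3 * (B * s ^ γ) ≤ 3 * C * (B * s ^ γ) := by
      gcongr; linarith
    rw [abs_le] at *
    constructor <;> linarith [h1.1, h1.2, h2.1, h2.2]
  · have h1 := abs_iterPartial_mollify_le_of_holder hC hu hγ hB hh hs L hL hL0 x
    have h2 := abs_iterPartial_mollify_le_of_holder hC hu hγ hB hh hs2 L hL hL0 x
    have h3 : C * (B * (2 * s) ^ γ) * (2 * s)⁻¹ ^ L.length ≤
        C * (B * (2 * s ^ γ)) * s⁻¹ ^ L.length := by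
      have : (2 * s)⁻¹ ≤ s⁻¹ := by
        apply inv_anti₀ hs; linarith
      gcongr
    calc _ ≤ |iterPartial L (mollify s u) x| + |iterPartial L (mollify (2 * s) u) x| :=
          abs_sub _ _
      _ ≤ C * (B * s ^ γ) * s⁻¹ ^ L.length + C * (B * (2 * s ^ γ)) * s⁻¹ ^ L.length := by
          linarith
      _ = _ := by ring

/-! ### Families annihilating derivatives of order `k` -/

/-- The family `(f_α)_{|α| = k}` satisfies `∑ ∂^α f_α = 0` in the sense of distributions. -/
def DivFree {n k : ℕ} (f : MultiIndex n k → Eucl n → ℝ) : Prop :=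
  ∀ ψ : Eucl n → ℝ, ContDiff ℝ ∞ ψ → HasCompactSupport ψ →
    ∑ α, ∫ x, f α x * multiDeriv (fun t => (α.1 t : ℕ)) ψ x = 0

/-- The monomial `e^α`. -/
def monomialVec {n k : ℕ} (e : Fin n → ℝ) (α : MultiIndex n k) : ℝ := ∏ j, e j ^ (α.1 j : ℕ)

/-- The component `∑ e^α f_α` of a family; it is the coefficient of the pure derivative
of order `k` in direction `e`. -/
def dirComp {n k : ℕ} (e : Fin n → ℝ) (f : MultiIndex n k → Eucl n → ℝ) (x : Eucl n) : ℝ :=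
  ∑ α, monomialVec e α * f α x

/-- The pointwise `ℓ¹` length of a family. -/
def totAbs {n k : ℕ} (f : MultiIndex n k → Eucl n → ℝ) (x : Eucl n) : ℝ := ∑ α, |f α x|

section

variable {n k : ℕ} {f : MultiIndex n k → Eucl n → ℝ} {e : Fin n → ℝ} {K : ℝ}

theorem totAbs_nonneg (x : Eucl n) : 0 ≤ totAbs f x :=
  Finset.sum_nonneg fun _ _ => abs_nonneg _

theorem integrable_totAbs (hf : ∀ α, Integrable (f α) volume) : Integrable (totAbs f) volume :=
  integrable_finsetSum _ fun α _ => (hf α).abs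

theorem integrable_dirComp (hf : ∀ α, Integrable (f α) volume) :
    Integrable (dirComp e f) volume :=
  integrable_finsetSum _ fun α _ => (hf α).const_mul _

theorem abs_monomialVec_le (hK : ∀ j, |e j| ≤ K) (α : MultiIndex n k) :
    |monomialVec e α| ≤ K ^ k := by
  have h := abs_prod_map_le hK (indexList fun t => (α.1 t : ℕ))
  rwa [prod_map_indexList, length_indexList, α.2] at h

theorem abs_dirComp_le (hK : ∀ j, |e j| ≤ K) (x : Eucl n) :
    |dirComp e f x| ≤ K ^ k * totAbs f x := by
  rw [dirComp, totAbs, Finset.mul_sum]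
  refine (Finset.abs_sum_le_sum_abs _ _).trans (Finset.sum_le_sum fun α _ => ?_)
  rw [abs_mul]
  exact mul_le_mul_of_nonneg_right (abs_monomialVec_le hK α) (abs_nonneg _)

theorem integrable_mul_of_compactSupport {g v : Eucl n → ℝ} (hg : Integrable g volume)
    (hv : Continuous v) (hc : HasCompactSupport v) : Integrable (fun x => g x * v x) volume := by
  obtain ⟨M, hM⟩ := hv.bounded_above_of_compact_support hc
  exact hg.mul_bdd (c := M) hv.aestronglyMeasurable (Filter.Eventually.of_forall hM)

/-- The function `u` vanishes far away in the directions transversal to `e`: its support meets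
each slab on which `linForm e` is bounded in a bounded set. -/
def TransverselyBounded (e : Fin n → ℝ) (u : Eucl n → ℝ) : Prop :=
  ∃ R : ℝ, ∀ x, u x ≠ 0 → ‖x‖ ≤ R + |linForm e x|

theorem TransverselyBounded.hasCompactSupport {u : Eucl n → ℝ} (hu : TransverselyBounded e u)
    {W : ℝ → ℝ} (hW : HasCompactSupport W) :
    HasCompactSupport fun x => W (linForm e x) * u x := by
  obtain ⟨R, hR⟩ := hu
  obtain ⟨R', hR'⟩ := hW.isCompact.isBounded.exists_norm_le
  refine HasCompactSupport.intro (isCompact_closedBall (0 : Eucl n) (R + R')) fun x hx => ?_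
  by_contra hne
  have h1 : u x ≠ 0 := right_ne_zero_of_mul hne
  have h2 := hR' (linForm e x) (subset_tsupport _ (left_ne_zero_of_mul hne))
  apply hx
  rw [Real.norm_eq_abs] at h2
  simpa using (hR x h1).trans (by linarith)

theorem TransverselyBounded.mollify {u : Eucl n → ℝ} (hu : TransverselyBounded e u) {s : ℝ}
    (hs : 0 < s) : TransverselyBounded e (mollify s u) := by
  obtain ⟨R, hR⟩ := hu
  refine ⟨R + s + ‖linForm e‖ * s, fun x hx => ?_⟩
  have : ∃ y, dist y x ≤ s ∧ u y ≠ 0 := by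
    by_contra hcon
    push Not at hcon
    exact hx (mollify_eq_zero hs hcon)
  obtain ⟨y, hy, huy⟩ := this
  have h1 := hR y huy
  have h2 : ‖x‖ ≤ ‖y‖ + s := by
    calc ‖x‖ = ‖y - (y - x)‖ := by simp
      _ ≤ ‖y‖ + ‖y - x‖ := norm_sub_le _ _
      _ ≤ _ := by rw [← dist_eq_norm]; gcongr
  have h3 : |linForm e y| ≤ |linForm e x| + ‖linForm e‖ * s := by
    calc |linForm e y| = |linForm e x + linForm e (y - x)| := by simp
      _ ≤ |linForm e x| + |linForm e (y - x)| := abs_add_le _ _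
      _ ≤ _ := by
        gcongr
        refine ((linForm e).le_opNorm _).trans ?_
        rw [← dist_eq_norm]; gcongr
  linarith

theorem TransverselyBounded.sub {u v : Eucl n → ℝ} (hu : TransverselyBounded e u)
    (hv : TransverselyBounded e v) : TransverselyBounded e fun x => u x - v x := by
  obtain ⟨R, hR⟩ := hu
  obtain ⟨R', hR'⟩ := hv
  refine ⟨max R R', fun x hx => ?_⟩
  by_cases h : u x = 0
  · have : v x ≠ 0 := by
      intro h'; simp [h, h'] at hx
    exact (hR' x this).trans (by gcongr; exact le_max_right _ _)
  · exact (hR x h).trans (by gcongr; exact le_max_left _ _)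

end

/-- Testing `∑ ∂^α f_α = 0` against `W(λ) θ`, where `W` is a truncated `k`-th primitive of `w`:
the pairing of the component in direction `e` with `w(λ) θ` is controlled if `θ` varies at
scale `s`. -/
theorem exists_abs_integral_dirComp_le {n k : ℕ} {e : Fin n → ℝ} {K : ℝ} (hK : ∀ j, |e j| ≤ K)
    (hK1 : 1 ≤ K) : ∃ C : ℝ, 0 ≤ C ∧ ∀ f : MultiIndex n k → Eucl n → ℝ,
      (∀ α, Integrable (f α) volume) → DivFree f →
      ∀ s : ℝ, 0 < s → ∀ w : ℝ → ℝ, ContDiff ℝ ∞ w → HasCompactSupport w →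
      ∀ θ : Eucl n → ℝ, ContDiff ℝ ∞ θ → TransverselyBounded e θ → ∀ B : ℝ,
        (∀ L : List (Fin n), L.length ≤ k → ∀ x, |iterPartial L θ x| ≤ B * s⁻¹ ^ L.length) →
        |∫ x, dirComp e f x * (w (linForm e x) * θ x)| ≤
          C * (∫ x, totAbs f x) * (∫ r, |w r|) * B * s⁻¹ := by
  obtain ⟨C₀, hC₀, hprim⟩ := exists_truncated_primitive k
  refine ⟨((3 * K) ^ k + K ^ k) * C₀, by positivity, ?_⟩
  intro f hf hdiv s hs w hw hwc θ hθ hθt B hB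
  obtain ⟨W, hW, hWc, hWj, hWk⟩ := hprim s hs w hw hwc
  have hI : 0 ≤ ∫ r, |w r| := integral_nonneg fun _ => abs_nonneg _
  set I := ∫ r, |w r|
  have hB0 : 0 ≤ B := by simpa using (abs_nonneg _).trans (hB [] (by simp) 0)
  set ψ : Eucl n → ℝ := fun x => W (linForm e x) * θ x with hψdef
  have hψ : ContDiff ℝ ∞ ψ := (contDiff_comp_linForm e hW).mul hθ
  have hψc : HasCompactSupport ψ := hθt.hasCompactSupport hWc
  set v : Eucl n → ℝ := fun x => w (linForm e x) * θ x with hvdef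
  have hv : Continuous v := ((contDiff_comp_linForm e hw).mul hθ).continuous
  have hvc : HasCompactSupport v := hθt.hasCompactSupport hwc
  set D : MultiIndex n k → Eucl n → ℝ := fun α => multiDeriv (fun t => (α.1 t : ℕ)) ψ with hDdef
  have hD : ∀ α, Continuous (D α) := fun α => by
    simp only [hDdef, multiDeriv_eq_iterPartial]
    exact (contDiff_iterPartial hψ _).continuous
  have hDc : ∀ α, HasCompactSupport (D α) := fun α => by
    simp only [hDdef, multiDeriv_eq_iterPartial]
    exact hasCompactSupport_iterPartial hψc _
  set E := ((3 * K) ^ k + K ^ k) * C₀ * I * B * s⁻¹ with hE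
  have hbound : ∀ α x, |monomialVec e α * v x - D α x| ≤ E := by
    intro α x
    have hlen : (indexList fun t => (α.1 t : ℕ)).length = k := by
      rw [length_indexList, α.2]
    have h1 := iterPartial_planeWave_mul hK hK1 (indexList fun t => (α.1 t : ℕ))
      (inv_nonneg.2 hs.le) W θ (C₀ * I * (s ^ k * s⁻¹)) B hW hθ (by positivity) hB0
      (fun j hj x => hWj j (by rwa [hlen] at hj) x)
      (fun L' hL' x => hB L' (by rwa [hlen] at hL') x) x
    rw [hlen, prod_map_indexList] at h1
    have h2 : |monomialVec e α * (iteratedDeriv k W (linForm e x) - w (linForm e x)) * θ x| ≤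
        K ^ k * (C₀ * I * s⁻¹) * B := by
      rw [abs_mul, abs_mul]
      have a1 := abs_monomialVec_le hK α
      have a2 := hWk (linForm e x)
      have a3 : |θ x| ≤ B := by simpa using hB [] (by simp) x
      gcongr
    have hp : (3 * K) ^ k * (C₀ * I * (s ^ k * s⁻¹)) * B * s⁻¹ ^ k =
        (3 * K) ^ k * (C₀ * I * s⁻¹) * B := by
      have : s ^ k * s⁻¹ ^ k = 1 := by rw [← mul_pow, mul_inv_cancel₀ hs.ne', one_pow]
      linear_combination ((3 * K) ^ k * (C₀ * I * s⁻¹) * B) * this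
    rw [hp] at h1
    have hEq : E = (3 * K) ^ k * (C₀ * I * s⁻¹) * B + K ^ k * (C₀ * I * s⁻¹) * B := by
      rw [hE]; ring
    have h3 : monomialVec e α * v x - D α x =
        -(D α x - monomialVec e α * iteratedDeriv k W (linForm e x) * θ x) -
        monomialVec e α * (iteratedDeriv k W (linForm e x) - w (linForm e x)) * θ x := by
      simp only [hvdef]; ring
    have h4 : D α x = iterPartial (indexList fun t => (α.1 t : ℕ)) ψ x := by
      simp only [hDdef, multiDeriv_eq_iterPartial]
    rw [h3, hEq]
    refine (abs_sub _ _).trans (add_le_add ?_ h2)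
    rw [abs_neg, h4]
    exact h1
  have hsum : ∫ x, dirComp e f x * v x =
      ∑ α, ∫ x, f α x * (monomialVec e α * v x - D α x) := by
    have e1 : ∀ α, ∫ x, f α x * (monomialVec e α * v x - D α x) =
        (∫ x, monomialVec e α * f α x * v x) - ∫ x, f α x * D α x := fun α => by
      rw [← integral_sub]
      · congr 1; funext x; ring
      · exact integrable_mul_of_compactSupport ((hf α).const_mul _) hv hvc
      · exact integrable_mul_of_compactSupport (hf α) (hD α) (hDc α)
    rw [Finset.sum_congr rfl fun α _ => e1 α, Finset.sum_sub_distrib, hdiv ψ hψ hψc, sub_zero,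
      ← integral_finsetSum _ fun α _ =>
        integrable_mul_of_compactSupport ((hf α).const_mul _) hv hvc]
    congr 1
    funext x
    rw [dirComp, Finset.sum_mul]
  rw [hsum]
  calc _ ≤ ∑ α, |∫ x, f α x * (monomialVec e α * v x - D α x)| := Finset.abs_sum_le_sum_abs _ _
    _ ≤ ∑ α, ∫ x, |f α x| * E := by
        refine Finset.sum_le_sum fun α _ => ?_
        rw [← Real.norm_eq_abs]
        refine norm_integral_le_of_norm_le ((hf α).abs.mul_const E)
          (Filter.Eventually.of_forall fun x => ?_)
        rw [Real.norm_eq_abs, abs_mul]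
        exact mul_le_mul_of_nonneg_left (hbound α x) (abs_nonneg _)
    _ = (∫ x, totAbs f x) * E := by
        rw [← integral_finsetSum _ fun α _ => (hf α).abs.mul_const E, ← integral_mul_const]
        congr 1
        funext x
        rw [totAbs, Finset.sum_mul]
    _ = _ := by rw [hE]; ring

/-- The estimate on a slab `λ ∈ supp w`: a Hölder function `u` is split into a part at scales
below `ε`, estimated by its size, and dyadic parts at larger scales, each of which is used
to build a test function. -/
theorem exists_abs_integral_slab_le {n k : ℕ} {e : Fin n → ℝ} {K : ℝ} (hK : ∀ j, |e j| ≤ K)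
    (hK1 : 1 ≤ K) {γ : ℝ} (hγ : 0 < γ) (hγ1 : γ < 1) :
    ∃ C : ℝ, 0 ≤ C ∧ ∀ f : MultiIndex n k → Eucl n → ℝ,
      (∀ α, Integrable (f α) volume) → DivFree f →
      ∀ w : ℝ → ℝ, ContDiff ℝ ∞ w → HasCompactSupport w →
      ∀ u : Eucl n → ℝ, Continuous u → TransverselyBounded e u → ∀ B M : ℝ, 0 ≤ B →
        (∀ x y, |u x - u y| ≤ B * dist x y ^ γ) → (∀ x, |u x| ≤ M) → ∀ ε : ℝ, 0 < ε →
        |∫ x, dirComp e f x * (w (linForm e x) * u x)| ≤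
          C * B * (ε ^ γ * (∫ x, totAbs f x * |w (linForm e x)|) +
            (∫ r, |w r|) * ε ^ (γ - 1) * ∫ x, totAbs f x) := by
  obtain ⟨C₁, hC₁, htest⟩ := exists_abs_integral_dirComp_le (k := k) hK hK1
  obtain ⟨C₂, hC₂, hbump⟩ := exists_bound_unitBump n k
  set q : ℝ := 2 ^ (γ - 1) with hq
  have hq0 : 0 < q := by positivity
  have hq1 : q < 1 := Real.rpow_lt_one_of_one_lt_of_neg (by norm_num) (by linarith)
  have h1q : 0 < 1 - q := by linarith
  refine ⟨K ^ k + C₁ * (3 * C₂) * (1 - q)⁻¹, by positivity, ?_⟩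
  intro f hf hdiv w hw hwc u hu hut B M hB hh hM ε hε
  set F := ∫ x, totAbs f x with hFdef
  have hF : 0 ≤ F := integral_nonneg fun x => totAbs_nonneg x
  set I := ∫ r, |w r| with hIdef
  have hI : 0 ≤ I := integral_nonneg fun _ => abs_nonneg _
  have hM0 : 0 ≤ M := (abs_nonneg _).trans (hM 0)
  have hs : ∀ i : ℕ, (0 : ℝ) < 2 ^ i * ε := fun i => by positivity
  set a : ℕ → ℝ := fun i =>
    ∫ x, dirComp e f x * (w (linForm e x) * mollify (2 ^ i * ε) u x) with ha
  have hwe : Continuous fun x : Eucl n => w (linForm e x) := (contDiff_comp_linForm e hw).continuous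
  have hint : ∀ i, Integrable
      (fun x => dirComp e f x * (w (linForm e x) * mollify (2 ^ i * ε) u x)) volume := fun i =>
    integrable_mul_of_compactSupport (integrable_dirComp hf)
      (hwe.mul (contDiff_mollify hu _).continuous) ((hut.mollify (hs i)).hasCompactSupport hwc)
  have hintu : Integrable (fun x => dirComp e f x * (w (linForm e x) * u x)) volume :=
    integrable_mul_of_compactSupport (integrable_dirComp hf) (hwe.mul hu)
      (hut.hasCompactSupport hwc)
  -- The mollification at scale `ε` differs from `u` by at most `B ε ^ γ`.
  have hsmall : |(∫ x, dirComp e f x * (w (linForm e x) * u x)) - a 0| ≤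
      K ^ k * B * (ε ^ γ * ∫ x, totAbs f x * |w (linForm e x)|) := by
    rw [ha, ← integral_sub hintu (hint 0)]
    have hb : Integrable (fun x => totAbs f x * |w (linForm e x)|) volume := by
      obtain ⟨Mw, hMw⟩ := hw.continuous.bounded_above_of_compact_support hwc
      exact (integrable_totAbs hf).mul_bdd (c := Mw) hwe.abs.aestronglyMeasurable
        (Filter.Eventually.of_forall fun x => by simpa using hMw _)
    have : K ^ k * B * (ε ^ γ * ∫ x, totAbs f x * |w (linForm e x)|) =
        ∫ x, K ^ k * B * ε ^ γ * (totAbs f x * |w (linForm e x)|) := by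
      rw [integral_const_mul]; ring
    rw [this, ← Real.norm_eq_abs]
    refine norm_integral_le_of_norm_le (hb.const_mul _) (Filter.Eventually.of_forall fun x => ?_)
    have h1 := abs_mollify_sub_le hu hγ hB hh hε x
    have h2 : dirComp e f x * (w (linForm e x) * u x) -
        dirComp e f x * (w (linForm e x) * mollify (2 ^ 0 * ε) u x) =
        -(dirComp e f x * (w (linForm e x) * (mollify ε u x - u x))) := by
      rw [pow_zero, one_mul]; ring
    rw [h2, Real.norm_eq_abs, abs_neg, abs_mul, abs_mul]
    calc _ ≤ K ^ k * totAbs f x * (|w (linForm e x)| * (B * ε ^ γ)) := by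
          gcongr
          · exact mul_nonneg (by positivity) (totAbs_nonneg x)
          · exact abs_dirComp_le hK x
      _ = _ := by ring
  -- As `γ < 1`, the dyadic scales above `ε` contribute a geometric series of ratio `2 ^ (γ - 1)`.
  have hstep : ∀ i, |a i - a (i + 1)| ≤ C₁ * F * I * (3 * C₂ * B) * ε ^ (γ - 1) * q ^ i := by
    intro i
    have hs2 : (2 : ℝ) ^ (i + 1) * ε = 2 * (2 ^ i * ε) := by ring
    have e1 : a i - a (i + 1) = ∫ x, dirComp e f x * (w (linForm e x) *
        (mollify (2 ^ i * ε) u x - mollify (2 * (2 ^ i * ε)) u x)) := by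
      rw [ha]
      simp only
      rw [← integral_sub (hint i) (hint (i + 1)), hs2]
      congr 1; funext x; ring
    have ht2 := hut.mollify (hs (i + 1))
    rw [hs2] at ht2
    have h := htest f hf hdiv (2 ^ i * ε) (hs i) w hw hwc
      (fun x => mollify (2 ^ i * ε) u x - mollify (2 * (2 ^ i * ε)) u x)
      ((contDiff_mollify hu _).sub (contDiff_mollify hu _))
      ((hut.mollify (hs i)).sub ht2) (3 * C₂ * (B * (2 ^ i * ε) ^ γ))
      (fun L hL x => abs_iterPartial_mollify_sub_mollify_le hC₂ hbump hu hγ hγ1.le hB hh (hs i)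
        L hL x)
    rw [e1]
    refine h.trans (le_of_eq ?_)
    have hpw : (2 ^ i * ε) ^ γ * (2 ^ i * ε)⁻¹ = ε ^ (γ - 1) * q ^ i := by
      rw [← div_eq_mul_inv, ← Real.rpow_sub_one (hs i).ne', Real.mul_rpow (by positivity) hε.le,
        hq, ← Real.rpow_natCast, ← Real.rpow_natCast, ← Real.rpow_mul (by norm_num),
        ← Real.rpow_mul (by norm_num), mul_comm (i : ℝ)]
      ring
    linear_combination (C₁ * F * I * (3 * C₂ * B)) * hpw
  -- The remainder at scale `2 ^ i ε` is only known to be bounded by `M`; it vanishes as `i → ∞`.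
  have hlast : ∀ i, |a i| ≤ C₁ * F * I * (C₂ * M) * ε⁻¹ * (1 / 2) ^ i := by
    intro i
    have h := htest f hf hdiv (2 ^ i * ε) (hs i) w hw hwc (mollify (2 ^ i * ε) u)
      (contDiff_mollify hu _) (hut.mollify (hs i)) (C₂ * M)
      (fun L hL x => abs_iterPartial_mollify_le hbump hu hM (hs i) L hL x)
    refine h.trans (le_of_eq ?_)
    rw [mul_inv, one_div, inv_pow]
    ring
  set Q := C₁ * F * I * (3 * C₂ * B) * ε ^ (γ - 1) with hQ
  have hQ0 : 0 ≤ Q := by positivity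
  have hall : ∀ m, |a 0| ≤ Q * (1 - q)⁻¹ + C₁ * F * I * (C₂ * M) * ε⁻¹ * (1 / 2) ^ m := by
    intro m
    have h1 : a 0 = (∑ i ∈ Finset.range m, (a i - a (i + 1))) + a m := by
      rw [Finset.sum_range_sub']; ring
    rw [h1]
    refine (abs_add_le _ _).trans (add_le_add ?_ (hlast m))
    calc _ ≤ ∑ i ∈ Finset.range m, |a i - a (i + 1)| := Finset.abs_sum_le_sum_abs _ _
      _ ≤ ∑ i ∈ Finset.range m, Q * q ^ i := Finset.sum_le_sum fun i _ => hstep i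
      _ = Q * ∑ i ∈ Finset.range m, q ^ i := by rw [Finset.mul_sum]
      _ ≤ Q * (1 - q)⁻¹ := by
          gcongr
          exact (Summable.sum_le_tsum _ (fun i _ => by positivity)
            (summable_geometric_of_lt_one hq0.le hq1)).trans_eq (tsum_geometric_of_lt_one hq0.le hq1)
  have ha0 : |a 0| ≤ Q * (1 - q)⁻¹ := by
    have hlim : Filter.Tendsto (fun m : ℕ => Q * (1 - q)⁻¹ +
        C₁ * F * I * (C₂ * M) * ε⁻¹ * (1 / 2) ^ m) Filter.atTop
        (nhds (Q * (1 - q)⁻¹ + C₁ * F * I * (C₂ * M) * ε⁻¹ * 0)) :=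
      ((tendsto_pow_atTop_nhds_zero_of_lt_one (by norm_num) (by norm_num)).const_mul _).const_add _
    have := ge_of_tendsto' hlim hall
    simpa using this
  set J := ∫ x, totAbs f x * |w (linForm e x)|
  have hJ : 0 ≤ J := integral_nonneg fun x => mul_nonneg (totAbs_nonneg x) (abs_nonneg _)
  set P := ∫ x, dirComp e f x * (w (linForm e x) * u x)
  have hP : |P| ≤ |P - a 0| + |a 0| := by
    calc |P| = |(P - a 0) + a 0| := by ring_nf
      _ ≤ _ := abs_add_le _ _
  have hεγ : 0 ≤ ε ^ γ := by positivity
  have hεγ' : 0 ≤ ε ^ (γ - 1) := by positivity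
  calc |P| ≤ K ^ k * B * (ε ^ γ * J) + Q * (1 - q)⁻¹ := by linarith
    _ = K ^ k * (B * (ε ^ γ * J)) +
        C₁ * (3 * C₂) * (1 - q)⁻¹ * (B * (I * ε ^ (γ - 1) * F)) := by rw [hQ]; ring
    _ ≤ K ^ k * (B * (ε ^ γ * J)) +
        C₁ * (3 * C₂) * (1 - q)⁻¹ * (B * (I * ε ^ (γ - 1) * F)) +
        (K ^ k * (B * (I * ε ^ (γ - 1) * F)) + C₁ * (3 * C₂) * (1 - q)⁻¹ * (B * (ε ^ γ * J))) := by
        apply le_add_of_nonneg_right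
        have : (0 : ℝ) < (1 - q)⁻¹ := inv_pos.2 h1q
        have hK0 : 0 ≤ K := by linarith
        have hC₂0 : 0 ≤ C₂ := by linarith
        positivity
    _ = _ := by ring

/-! ### Morrey's inequality -/

section Morrey

variable {E : Type*} [NormedAddCommGroup E] [NormedSpace ℝ E]

theorem abs_sub_le_integral_fderiv {u : E → ℝ} (hu : ContDiff ℝ 1 u) (a z : E) :
    |u z - u a| ≤ ∫ r in (0 : ℝ)..1, ‖z - a‖ * ‖fderiv ℝ u (a + r • (z - a))‖ := by
  have hc : Continuous fun r : ℝ => fderiv ℝ u (a + r • (z - a)) :=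
    (hu.continuous_fderiv (by simp)).comp (by fun_prop)
  have hd : ∀ r : ℝ, HasDerivAt (fun r : ℝ => u (a + r • (z - a)))
      (fderiv ℝ u (a + r • (z - a)) (z - a)) r := fun r => by
    have h1 : HasDerivAt (fun r : ℝ => a + r • (z - a)) (z - a) r := by
      simpa using ((hasDerivAt_id r).smul_const (z - a)).const_add a
    exact ((hu.differentiable (by simp) _).hasFDerivAt).comp_hasDerivAt r h1
  have h := intervalIntegral.integral_eq_sub_of_hasDerivAt (a := 0) (b := 1)
    (fun r _ => hd r) ((hc.clm_apply continuous_const).intervalIntegrable _ _)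
  simp only [one_smul, zero_smul, add_zero, add_sub_cancel] at h
  rw [← h, ← Real.norm_eq_abs]
  refine intervalIntegral.norm_integral_le_of_norm_le zero_le_one
    (Filter.Eventually.of_forall fun r _ => ?_) ((continuous_const.mul hc.norm).intervalIntegrable _ _)
  rw [mul_comm]
  exact ContinuousLinearMap.le_opNorm _ _

variable [FiniteDimensional ℝ E] [MeasurableSpace E] [BorelSpace E]
  (μ : Measure E) [μ.IsAddHaarMeasure]

/-- Hölder's inequality for the mean of `v` over the image of a set under a homothety. -/
theorem setIntegral_homothety_le {v : E → ℝ} (hv : Continuous v) (hv0 : ∀ x, 0 ≤ v x)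
    (hvc : HasCompactSupport v) {p : ℝ} (hp1 : 1 < p) (a : E) {S : Set E} (hSf : μ S ≠ ⊤)
    {r : ℝ} (hr : 0 < r) :
    ∫ z in S, v (a + r • (z - a)) ∂μ ≤
      r ^ (-(Module.finrank ℝ E / p)) * (∫ x, v x ^ p ∂μ) ^ (1 / p) *
        (μ.real S) ^ (1 - 1 / p) := by
  have hp0 : 0 < p := by linarith
  have : IsFiniteMeasure (μ.restrict S) := ⟨by simpa using hSf.lt_top⟩
  obtain ⟨M, hM⟩ := hv.bounded_above_of_compact_support hvc
  have hcont : Continuous fun z => v (a + r • (z - a)) := by fun_prop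
  have hpq : p.HolderConjugate (1 - 1 / p)⁻¹ := by
    have := Real.HolderConjugate.conjExponent hp1
    rwa [show Real.conjExponent p = (1 - 1 / p)⁻¹ by
      rw [Real.conjExponent]; field_simp] at this
  have h1 := integral_mul_le_Lp_mul_Lq_of_nonneg (μ := μ.restrict S) hpq
    (f := fun z => v (a + r • (z - a))) (g := fun _ => 1)
    (Filter.Eventually.of_forall fun z => hv0 _) (Filter.Eventually.of_forall fun z => zero_le_one)
    (MemLp.of_bound hcont.aestronglyMeasurable M (Filter.Eventually.of_forall fun z => hM _))
    (memLp_const _)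
  simp only [mul_one, Real.one_rpow, integral_const, smul_eq_mul, one_div, inv_inv,
    measureReal_restrict_apply_univ] at h1
  refine h1.trans ?_
  rw [one_div]
  gcongr
  have hvp : Continuous fun x => v x ^ p := hv.rpow_const fun x => Or.inr hp0.le
  have hvpc : HasCompactSupport fun x => v x ^ p :=
    hvc.comp_left (g := fun t : ℝ => t ^ p) (Real.zero_rpow hp0.ne')
  have hi : Integrable (fun x => v x ^ p) μ := hvp.integrable_of_hasCompactSupport hvpc
  have hscale : ∫ z, v (a + r • (z - a)) ^ p ∂μ =
      r ^ (-(Module.finrank ℝ E : ℝ)) * ∫ x, v x ^ p ∂μ := by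
    rw [integral_sub_right_eq_self (fun z => v (a + r • z) ^ p) a,
      Measure.integral_comp_smul μ (fun z => v (a + z) ^ p) r,
      integral_add_left_eq_self (fun z => v z ^ p) a, abs_of_pos (by positivity),
      Real.rpow_neg hr.le, Real.rpow_natCast, smul_eq_mul]
  have hi2 : Integrable (fun z => v (a + r • (z - a)) ^ p) μ := by
    have h2 : Integrable (fun z => v (a + z) ^ p) μ := hi.comp_add_left a
    have h3 := (integrable_comp_smul_iff μ (fun z => v (a + z) ^ p) hr.ne').2 h2
    exact h3.comp_sub_right a
  have h2 : ∫ z in S, v (a + r • (z - a)) ^ p ∂μ ≤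
      r ^ (-(Module.finrank ℝ E : ℝ)) * ∫ x, v x ^ p ∂μ := by
    rw [← hscale]
    exact setIntegral_le_integral hi2
      (Filter.Eventually.of_forall fun z => Real.rpow_nonneg (hv0 _) _)
  calc _ ≤ (r ^ (-(Module.finrank ℝ E : ℝ)) * ∫ x, v x ^ p ∂μ) ^ p⁻¹ := by
        gcongr
        exact setIntegral_nonneg_of_ae (Filter.Eventually.of_forall fun z => Real.rpow_nonneg (hv0 _) _)
    _ = _ := by
        rw [Real.mul_rpow (by positivity) (integral_nonneg fun x => Real.rpow_nonneg (hv0 x) _),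
          ← Real.rpow_mul hr.le]
        congr 2
        field_simp

/-- The mean oscillation of `u` around one of the points of a bounded set. -/
theorem setIntegral_abs_sub_le {u : E → ℝ} (hu : ContDiff ℝ 1 u) (huc : HasCompactSupport u)
    {p : ℝ} (hp1 : 1 < p) (hp : Module.finrank ℝ E < p) (a : E) {S : Set E}
    (hSm : MeasurableSet S) (hSf : μ S ≠ ⊤) {D : ℝ} (hD0 : 0 ≤ D)
    (hD : ∀ z ∈ S, ‖z - a‖ ≤ D) :
    ∫ z in S, |u z - u a| ∂μ ≤ D * ((1 - Module.finrank ℝ E / p)⁻¹ *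
      (∫ x, ‖fderiv ℝ u x‖ ^ p ∂μ) ^ (1 / p) * (μ.real S) ^ (1 - 1 / p)) := by
  have hp0 : 0 < p := by linarith
  have : IsFiniteMeasure (μ.restrict S) := ⟨by simpa using hSf.lt_top⟩
  set v : E → ℝ := fun x => ‖fderiv ℝ u x‖ with hvdef
  have hv : Continuous v := (hu.continuous_fderiv (by simp)).norm
  have hvc : HasCompactSupport v := (huc.fderiv ℝ).norm
  have hv0 : ∀ x, 0 ≤ v x := fun x => norm_nonneg _
  obtain ⟨M, hM⟩ := hv.bounded_above_of_compact_support hvc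
  set G := (∫ x, v x ^ p ∂μ) ^ (1 / p) with hG
  have hG0 : 0 ≤ G := Real.rpow_nonneg (integral_nonneg fun x => Real.rpow_nonneg (hv0 x) _) _
  set A := (μ.real S) ^ (1 - 1 / p) with hA
  have hjoint : Continuous fun q : E × ℝ => D * v (a + q.2 • (q.1 - a)) := by fun_prop
  have hprod : Integrable (Function.uncurry fun (z : E) (r : ℝ) => D * v (a + r • (z - a)))
      ((μ.restrict S).prod (volume.restrict (Set.Ioc (0 : ℝ) 1))) := by
    refine Integrable.of_bound hjoint.aestronglyMeasurable (D * M)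
      (Filter.Eventually.of_forall fun q => ?_)
    simp only [Function.uncurry]
    rw [norm_mul, Real.norm_eq_abs D, abs_of_nonneg hD0]
    gcongr
    exact hM _
  have hexp : -1 < -((Module.finrank ℝ E : ℝ) / p) := by
    have : (Module.finrank ℝ E : ℝ) / p < 1 := by rw [div_lt_one hp0]; exact hp
    linarith
  have hrint : IntervalIntegrable (fun r : ℝ => r ^ (-((Module.finrank ℝ E : ℝ) / p)))
      volume 0 1 := intervalIntegral.intervalIntegrable_rpow' hexp
  calc ∫ z in S, |u z - u a| ∂μ
      ≤ ∫ z in S, (∫ r in Set.Ioc (0 : ℝ) 1, D * v (a + r • (z - a))) ∂μ := by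
        refine setIntegral_mono_on ?_ hprod.integral_prod_left hSm fun z hz => ?_
        · have huM := hu.continuous.bounded_above_of_compact_support huc
          obtain ⟨Mu, hMu⟩ := huM
          exact Integrable.of_bound
            ((hu.continuous.sub continuous_const).abs.aestronglyMeasurable) (Mu + Mu)
            (Filter.Eventually.of_forall fun z => by
              rw [Real.norm_eq_abs, abs_abs]
              exact (abs_sub _ _).trans (add_le_add (hMu z) (hMu a)))
        · refine (abs_sub_le_integral_fderiv hu a z).trans ?_
          rw [intervalIntegral.integral_of_le zero_le_one]
          refine setIntegral_mono_on ?_ ?_ measurableSet_Ioc fun r _ => ?_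
          · exact (Continuous.integrableOn_Icc (by fun_prop)).mono_set Set.Ioc_subset_Icc_self
          · exact (Continuous.integrableOn_Icc (by fun_prop)).mono_set Set.Ioc_subset_Icc_self
          · exact mul_le_mul_of_nonneg_right (hD z hz) (norm_nonneg _)
    _ = ∫ r in Set.Ioc (0 : ℝ) 1, ∫ z in S, D * v (a + r • (z - a)) ∂μ :=
        integral_integral_swap hprod
    _ ≤ ∫ r in Set.Ioc (0 : ℝ) 1, D * G * A * r ^ (-((Module.finrank ℝ E : ℝ) / p)) := by
        refine setIntegral_mono_on hprod.integral_prod_right ?_ measurableSet_Ioc fun r hr => ?_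
        · exact (((intervalIntegrable_iff_integrableOn_Ioc_of_le zero_le_one).1 hrint).const_mul _)
        · rw [integral_const_mul]
          have := setIntegral_homothety_le μ hv hv0 hvc hp1 a hSf hr.1
          calc _ ≤ D * _ := mul_le_mul_of_nonneg_left this hD0
            _ = _ := by rw [hG, hA]; ring
    _ = _ := by
        rw [integral_const_mul, ← intervalIntegral.integral_of_le zero_le_one,
          integral_rpow (Or.inl hexp), Real.one_rpow, Real.zero_rpow (by linarith)]
        rw [show -((Module.finrank ℝ E : ℝ) / p) + 1 = 1 - Module.finrank ℝ E / p by ring]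
        ring

/-- **Morrey's inequality**: above the critical exponent, the `L^p` norm of the gradient controls
a Hölder seminorm. -/
theorem exists_morrey {p : ℝ} (hp1 : 1 < p) (hp : Module.finrank ℝ E < p) :
    ∃ C : ℝ, 0 ≤ C ∧ ∀ u : E → ℝ, ContDiff ℝ 1 u → HasCompactSupport u → ∀ x y,
      |u x - u y| ≤ C * (∫ z, ‖fderiv ℝ u z‖ ^ p ∂μ) ^ (1 / p) *
        dist x y ^ (1 - Module.finrank ℝ E / p) := by
  have hp0 : 0 < p := by linarith
  have hκ : 0 < 1 - (Module.finrank ℝ E : ℝ) / p := by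
    have : (Module.finrank ℝ E : ℝ) / p < 1 := by rw [div_lt_one hp0]; exact hp
    linarith
  set κ := 1 - (Module.finrank ℝ E : ℝ) / p with hκdef
  set c := μ.real (Metric.closedBall (0 : E) 1) with hc
  have hc0 : 0 < c := by
    rw [hc, measureReal_def]
    exact ENNReal.toReal_pos (Metric.measure_closedBall_pos μ 0 zero_lt_one).ne'
      measure_closedBall_lt_top.ne
  refine ⟨4 * κ⁻¹ * c ^ (-(1 / p)), by positivity, ?_⟩
  intro u hu huc x y
  set G := (∫ z, ‖fderiv ℝ u z‖ ^ p ∂μ) ^ (1 / p) with hG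
  have hG0 : 0 ≤ G := by positivity
  rcases eq_or_ne x y with rfl | hxy
  · simp [Real.zero_rpow hκ.ne']
  have hR : 0 < dist x y := dist_pos.2 hxy
  set R := dist x y with hRdef
  set S := Metric.closedBall x R with hS
  have hSf : μ S ≠ ⊤ := measure_closedBall_lt_top.ne
  have hSm : MeasurableSet S := measurableSet_closedBall
  have hμS : μ.real S = R ^ Module.finrank ℝ E * c := by
    rw [hS, hc, measureReal_def, measureReal_def, Measure.addHaar_closedBall' μ x hR.le]
    rw [ENNReal.toReal_mul, ENNReal.toReal_ofReal (by positivity)]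
  have hA : 0 < μ.real S := by rw [hμS]; positivity
  have h1 := setIntegral_abs_sub_le μ hu huc hp1 hp x hSm hSf (D := 2 * R) (by positivity) (fun z hz => by
    rw [← dist_eq_norm]
    have : dist z x ≤ R := hz
    linarith)
  have h2 := setIntegral_abs_sub_le μ hu huc hp1 hp y hSm hSf (D := 2 * R) (by positivity) (fun z hz => by
    rw [← dist_eq_norm]
    have : dist z x ≤ R := hz
    have := dist_triangle z x y
    linarith)
  have hint : ∀ a, IntegrableOn (fun z => |u z - u a|) S μ := fun a =>
    (Continuous.continuousOn (by have := hu.continuous; fun_prop)).integrableOn_compact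
      (isCompact_closedBall x R)
  have h3 : μ.real S * |u x - u y| ≤ (∫ z in S, |u z - u x| ∂μ) + ∫ z in S, |u z - u y| ∂μ := by
    rw [← integral_add (hint x) (hint y)]
    have : μ.real S * |u x - u y| = ∫ z in S, |u x - u y| ∂μ := by simp
    rw [this]
    refine setIntegral_mono_on (by simpa using Or.inr hSf.lt_top)
      ((hint x).add (hint y)) hSm fun z _ => ?_
    rw [abs_sub_comm (u z) (u x)]
    exact abs_sub_le _ _ _
  have h4 : μ.real S * |u x - u y| ≤
      μ.real S * (4 * R * κ⁻¹ * G * (μ.real S) ^ (-(1 / p))) := by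
    have e : (μ.real S) ^ (1 - 1 / p) = μ.real S * (μ.real S) ^ (-(1 / p)) := by
      rw [sub_eq_add_neg, Real.rpow_add hA, Real.rpow_one]
    rw [e] at h1 h2
    calc _ ≤ _ := h3
      _ ≤ _ := add_le_add h1 h2
      _ = _ := by ring
  refine (le_of_mul_le_mul_left h4 hA).trans (le_of_eq ?_)
  rw [hμS, Real.mul_rpow (by positivity) hc0.le, ← Real.rpow_natCast, ← Real.rpow_mul hR.le]
  have e : R ^ κ = R * R ^ ((Module.finrank ℝ E : ℝ) * -(1 / p)) := by
    rw [hκdef, show 1 - (Module.finrank ℝ E : ℝ) / p = 1 + (Module.finrank ℝ E : ℝ) * -(1 / p) by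
      ring, Real.rpow_add hR, Real.rpow_one]
  rw [e]
  ring

end Morrey

/-! ### Slicing by parallel hyperplanes -/

section Slices

variable {d : ℕ} (e : Fin (d + 1) → ℝ)

/-- The linear parametrization `y ↦ (-∑ e_{j+1} y_j, y)` of the hyperplane `linForm e = 0`, where
`e 0 = 1`. -/
def sliceLin : (Fin d → ℝ) →L[ℝ] Eucl (d + 1) :=
  LinearMap.toContinuousLinearMap
    { toFun := fun y => WithLp.toLp 2 (Fin.cons (-∑ j, e j.succ * y j) y : Fin (d + 1) → ℝ)
      map_add' := fun y z => by
        ext i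
        refine Fin.cases ?_ (fun j => ?_) i
        · simp [mul_add, Finset.sum_add_distrib]; ring
        · simp
      map_smul' := fun c y => by
        ext i
        refine Fin.cases ?_ (fun j => ?_) i
        · simp only [Pi.smul_apply, smul_eq_mul, Fin.cons_zero, RingHom.id_apply, PiLp.smul_apply]
          rw [mul_neg, Finset.mul_sum]
          congr 1
          exact Finset.sum_congr rfl fun j _ => by ring
        · simp }

theorem sliceLin_zero (y : Fin d → ℝ) : sliceLin e y 0 = -∑ j, e j.succ * y j := rfl

theorem sliceLin_succ (y : Fin d → ℝ) (j : Fin d) : sliceLin e y j.succ = y j := rfl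

/-- The parametrization of the hyperplane `linForm e = t`, where `e 0 = 1`. -/
def slicePoint (t : ℝ) (y : Fin d → ℝ) : Eucl (d + 1) :=
  sliceLin e y + t • EuclideanSpace.single 0 1

/-- The extension of the restriction of `φ` to the hyperplane `linForm e = t` to a function
that is constant in the direction of the first coordinate. -/
def sliceExt (t : ℝ) (φ : Eucl (d + 1) → ℝ) (x : Eucl (d + 1)) : ℝ :=
  φ (slicePoint e t fun j => x j.succ)

theorem continuous_slicePoint : Continuous fun q : ℝ × (Fin d → ℝ) => slicePoint e q.1 q.2 := by
  unfold slicePoint; fun_prop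

variable {e}

theorem slicePoint_linForm (he : e 0 = 1) (x : Eucl (d + 1)) :
    slicePoint e (linForm e x) (fun j => x j.succ) = x := by
  ext i
  refine Fin.cases ?_ (fun j => ?_) i
  · simp [slicePoint, sliceLin_zero, linForm_apply, Fin.sum_univ_succ, he]
  · simp [slicePoint, sliceLin_succ]

theorem norm_le_norm_slicePoint (t : ℝ) (y : Fin d → ℝ) : ‖y‖ ≤ ‖slicePoint e t y‖ := by
  rw [pi_norm_le_iff_of_nonneg (norm_nonneg _)]
  intro j
  have := PiLp.norm_apply_le (slicePoint e t y) j.succ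
  simpa [slicePoint, sliceLin_succ] using this

theorem slicePoint_sub (t s : ℝ) (y : Fin d → ℝ) :
    slicePoint e t y - slicePoint e s y = (t - s) • EuclideanSpace.single 0 1 := by
  simp [slicePoint, sub_smul]

theorem norm_slicePoint_sub (t s : ℝ) (y : Fin d → ℝ) :
    ‖slicePoint e t y - slicePoint e s y‖ = |t - s| := by
  rw [slicePoint_sub, norm_smul]; simp

theorem dist_sliceExt (he : e 0 = 1) (t : ℝ) (x : Eucl (d + 1)) :
    dist x (slicePoint e t fun j => x j.succ) = |linForm e x - t| := by
  conv_lhs => rw [← slicePoint_linForm he x]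
  rw [dist_eq_norm]
  have h : (fun j : Fin d => slicePoint e (linForm e x) (fun j => x j.succ) j.succ) =
      fun j => x j.succ := by rw [slicePoint_linForm he x]
  rw [h, norm_slicePoint_sub]

variable {φ : Eucl (d + 1) → ℝ}

theorem transverselyBounded_sliceExt (he : e 0 = 1) (hφ : HasCompactSupport φ) (t : ℝ) :
    TransverselyBounded e (sliceExt e t φ) := by
  obtain ⟨R, hR⟩ := hφ.isCompact.isBounded.exists_norm_le
  refine ⟨R + |t|, fun x hx => ?_⟩
  have h1 := hR _ (subset_tsupport _ hx)
  have h2 := dist_sliceExt he t x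
  rw [dist_eq_norm] at h2
  have h3 := norm_sub_norm_le x (slicePoint e t fun j => x j.succ)
  have h4 := abs_sub (linForm e x) t
  linarith

theorem continuous_sliceExt (hφ : Continuous φ) (t : ℝ) : Continuous (sliceExt e t φ) :=
  hφ.comp ((continuous_slicePoint e).comp (continuous_const.prodMk (by fun_prop)))

theorem contDiff_comp_slicePoint (hφ : ContDiff ℝ ∞ φ) (t : ℝ) :
    ContDiff ℝ ∞ fun y => φ (slicePoint e t y) :=
  hφ.comp ((sliceLin e).contDiff.add contDiff_const)

theorem hasCompactSupport_comp_slicePoint (hφ : HasCompactSupport φ) (t : ℝ) :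
    HasCompactSupport fun y => φ (slicePoint e t y) := by
  obtain ⟨R, hR⟩ := hφ.isCompact.isBounded.exists_norm_le
  refine HasCompactSupport.intro (isCompact_closedBall (0 : Fin d → ℝ) R) fun y hy => ?_
  by_contra hne
  have h1 := hR _ (subset_tsupport _ hne)
  exact hy (by simpa using (norm_le_norm_slicePoint t y).trans h1)

theorem norm_fderiv_comp_slicePoint_le (hφ : ContDiff ℝ ∞ φ) (t : ℝ) (y : Fin d → ℝ) :
    ‖fderiv ℝ (fun y => φ (slicePoint e t y)) y‖ ≤
      ‖sliceLin e‖ * ‖fderiv ℝ φ (slicePoint e t y)‖ := by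
  have h1 : HasFDerivAt (slicePoint e t) (sliceLin e) y :=
    (sliceLin e).hasFDerivAt.add_const _
  have h2 := ((hφ.differentiable (by simp) (slicePoint e t y)).hasFDerivAt).comp y h1
  have h3 : fderiv ℝ (fun y => φ (slicePoint e t y)) y = _ := h2.fderiv
  rw [h3, mul_comm]
  exact ContinuousLinearMap.opNorm_comp_le _ _

/-- The integral of `‖∇φ‖ ^ p` over the hyperplane `linForm e = t`. -/
def sliceEnergy (e : Fin (d + 1) → ℝ) (p : ℝ) (φ : Eucl (d + 1) → ℝ) (t : ℝ) : ℝ :=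
  ∫ y, ‖fderiv ℝ φ (slicePoint e t y)‖ ^ p

theorem sliceEnergy_nonneg (p : ℝ) (t : ℝ) : 0 ≤ sliceEnergy e p φ t :=
  integral_nonneg fun _ => by positivity

/-- The exponent `d + 1`, critical for the gradient in dimension `d + 1`, is supercritical on
`d`-dimensional hyperplanes, so that restrictions to them are Hölder continuous of
exponent `1 / (d + 1)`. -/
theorem exists_sliceExt_holder (d : ℕ) (hd : 1 ≤ d) (e : Fin (d + 1) → ℝ) :
    ∃ C : ℝ, 0 ≤ C ∧ ∀ φ : Eucl (d + 1) → ℝ, ContDiff ℝ ∞ φ → HasCompactSupport φ →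
      ∀ t x y, |sliceExt e t φ x - sliceExt e t φ y| ≤
        C * sliceEnergy e (d + 1) φ t ^ (1 / ((d : ℝ) + 1)) * dist x y ^ (1 / ((d : ℝ) + 1)) := by
  have hd1 : (1 : ℝ) ≤ d := by exact_mod_cast hd
  have hp0 : (0 : ℝ) < d + 1 := by positivity
  obtain ⟨C, hC, hmor⟩ := exists_morrey (volume : Measure (Fin d → ℝ)) (p := (d : ℝ) + 1)
    (by linarith) (by simp)
  refine ⟨C * ‖sliceLin e‖, by positivity, fun φ hφ hc t x y => ?_⟩
  have h := hmor (fun y => φ (slicePoint e t y)) ((contDiff_comp_slicePoint hφ t).of_le (by simp))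
    (hasCompactSupport_comp_slicePoint hc t) (fun j => x j.succ) (fun j => y j.succ)
  have hexp : 1 - (Module.finrank ℝ (Fin d → ℝ) : ℝ) / ((d : ℝ) + 1) = 1 / ((d : ℝ) + 1) := by
    simp; field_simp; ring
  rw [hexp] at h
  refine h.trans ?_
  have hcont : Continuous fun y => ‖fderiv ℝ φ (slicePoint e t y)‖ ^ ((d : ℝ) + 1) :=
    ((hφ.continuous_fderiv (by simp)).comp
      ((continuous_slicePoint e).comp (continuous_const.prodMk continuous_id))).norm.rpow_const
      fun _ => Or.inr hp0.le
  have hcs : HasCompactSupport fun y => ‖fderiv ℝ φ (slicePoint e t y)‖ ^ ((d : ℝ) + 1) :=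
    (hasCompactSupport_comp_slicePoint
      ((hc.fderiv ℝ).norm.comp_left (g := fun r : ℝ => r ^ ((d : ℝ) + 1))
        (Real.zero_rpow hp0.ne')) t)
  have h1 : (∫ z, ‖fderiv ℝ (fun y => φ (slicePoint e t y)) z‖ ^ ((d : ℝ) + 1)) ≤
      ‖sliceLin e‖ ^ ((d : ℝ) + 1) * sliceEnergy e (d + 1) φ t := by
    rw [sliceEnergy, ← integral_const_mul]
    refine integral_mono_of_nonneg (Filter.Eventually.of_forall fun z => by positivity)
      ((hcont.integrable_of_hasCompactSupport hcs).const_mul _)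
      (Filter.Eventually.of_forall fun z => ?_)
    simp only
    rw [← Real.mul_rpow (norm_nonneg _) (norm_nonneg _)]
    exact Real.rpow_le_rpow (norm_nonneg _) (norm_fderiv_comp_slicePoint_le hφ t z) hp0.le
  have h2 : (∫ z, ‖fderiv ℝ (fun y => φ (slicePoint e t y)) z‖ ^ ((d : ℝ) + 1)) ^
      (1 / ((d : ℝ) + 1)) ≤ ‖sliceLin e‖ * sliceEnergy e (d + 1) φ t ^ (1 / ((d : ℝ) + 1)) := by
    calc _ ≤ (‖sliceLin e‖ ^ ((d : ℝ) + 1) * sliceEnergy e (d + 1) φ t) ^ (1 / ((d : ℝ) + 1)) :=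
          Real.rpow_le_rpow (integral_nonneg fun z => by positivity) h1 (by positivity)
      _ = _ := by
          rw [Real.mul_rpow (by positivity) (sliceEnergy_nonneg _ _), ← Real.rpow_mul (norm_nonneg _),
            mul_one_div_cancel hp0.ne', Real.rpow_one]
  have h3 : dist (fun j : Fin d => x j.succ) (fun j => y j.succ) ≤ dist x y := by
    rw [dist_pi_le_iff dist_nonneg]
    intro j
    have := PiLp.norm_apply_le (x - y) j.succ
    rw [dist_eq_norm, dist_eq_norm]
    simpa using this
  have hS := sliceEnergy_nonneg (e := e) (φ := φ) (d + 1) t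
  calc _ ≤ C * (‖sliceLin e‖ * sliceEnergy e (d + 1) φ t ^ (1 / ((d : ℝ) + 1))) *
        dist x y ^ (1 / ((d : ℝ) + 1)) := by gcongr
    _ = _ := by ring

variable (e) in
/-- The parametrization of space by parallel hyperplanes is a shear followed by the insertion of a
coordinate. -/
theorem measurePreserving_slicePoint :
    MeasurePreserving (fun q : ℝ × (Fin d → ℝ) => slicePoint e q.1 q.2) volume volume := by
  have hswap : MeasurePreserving (Prod.swap : ℝ × (Fin d → ℝ) → (Fin d → ℝ) × ℝ)
      (volume.prod volume) (volume.prod volume) := Measure.measurePreserving_swap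
  have hswap' : MeasurePreserving (Prod.swap : (Fin d → ℝ) × ℝ → ℝ × (Fin d → ℝ))
      (volume.prod volume) (volume.prod volume) := Measure.measurePreserving_swap
  have hskew : MeasurePreserving
      (fun q : (Fin d → ℝ) × ℝ => (q.1, q.2 + (-∑ j, e j.succ * q.1 j)))
      (volume.prod volume) (volume.prod volume) := by
    refine MeasurePreserving.skew_product (f := id) (MeasurePreserving.id _)
      (g := fun (y : Fin d → ℝ) (t : ℝ) => t + (-∑ j, e j.succ * y j)) ?_ (Filter.Eventually.of_forall fun y => ?_)
    · exact Continuous.measurable (by unfold Function.uncurry; fun_prop)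
    · exact (measurePreserving_add_right volume _).map_eq
  have hcons := (volume_preserving_piFinSuccAbove (fun _ : Fin (d + 1) => ℝ) 0).symm
  have hL := PiLp.volume_preserving_toLp (Fin (d + 1))
  have hall := hL.comp (hcons.comp ((hswap'.comp hskew).comp hswap))
  refine (congrArg (fun Φ => MeasurePreserving Φ volume volume) ?_).mp hall
  funext q
  ext i
  refine Fin.cases ?_ (fun j => ?_) i
  · simp [slicePoint, sliceLin_zero, MeasurableEquiv.piFinSuccAbove]
    ring
  · simp [slicePoint, sliceLin_succ, MeasurableEquiv.piFinSuccAbove]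

theorem integrable_sliceEnergy {p : ℝ} (hp : 0 < p) (hφ : ContDiff ℝ ∞ φ)
    (hc : HasCompactSupport φ) : Integrable (sliceEnergy e p φ) volume ∧
      ∫ t, sliceEnergy e p φ t = ∫ x, ‖fderiv ℝ φ x‖ ^ p := by
  have hcont : Continuous fun x => ‖fderiv ℝ φ x‖ ^ p :=
    (hφ.continuous_fderiv (by simp)).norm.rpow_const fun _ => Or.inr hp.le
  have hcs : HasCompactSupport fun x => ‖fderiv ℝ φ x‖ ^ p :=
    (hc.fderiv ℝ).norm.comp_left (g := fun r : ℝ => r ^ p) (Real.zero_rpow hp.ne')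
  have hi : Integrable (fun x => ‖fderiv ℝ φ x‖ ^ p) volume :=
    hcont.integrable_of_hasCompactSupport hcs
  have hmp := measurePreserving_slicePoint e
  have hi2 : Integrable (fun q : ℝ × (Fin d → ℝ) => ‖fderiv ℝ φ (slicePoint e q.1 q.2)‖ ^ p)
      (volume.prod volume) := (hmp.integrable_comp hcont.aestronglyMeasurable).2 hi
  refine ⟨hi2.integral_prod_left, ?_⟩
  unfold sliceEnergy
  rw [← integral_prod _ hi2]
  conv_rhs => rw [← hmp.map_eq]
  rw [integral_map hmp.measurable.aemeasurable hcont.aestronglyMeasurable]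
  rfl

end Slices

/-! ### A smooth partition of unity on the line -/

/-- A smooth bump supported in `[0, 2]` whose integer translates sum to one. -/
def hat (r : ℝ) : ℝ := Real.smoothTransition r - Real.smoothTransition (r - 1)

theorem hat_nonneg (r : ℝ) : 0 ≤ hat r :=
  sub_nonneg.2 (Real.smoothTransition.monotone (by linarith))

theorem hat_le_one (r : ℝ) : hat r ≤ 1 := by
  have h1 := Real.smoothTransition.le_one r
  have h2 := Real.smoothTransition.nonneg (r - 1)
  unfold hat; linarith

theorem mem_Icc_of_hat_ne_zero {r : ℝ} (h : hat r ≠ 0) : r ∈ Set.Icc (0 : ℝ) 2 := by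
  by_contra hr
  apply h
  rw [Set.mem_Icc, not_and_or, not_le, not_le] at hr
  unfold hat
  rcases hr with hr | hr
  · rw [Real.smoothTransition.zero_of_nonpos hr.le,
      Real.smoothTransition.zero_of_nonpos (by linarith), sub_zero]
  · rw [Real.smoothTransition.one_of_one_le (by linarith),
      Real.smoothTransition.one_of_one_le (by linarith), sub_self]

theorem contDiff_hat : ContDiff ℝ ∞ hat :=
  Real.smoothTransition.contDiff.sub
    (Real.smoothTransition.contDiff.comp (contDiff_id.sub contDiff_const))

theorem sum_hat (m : ℕ) (r : ℝ) : ∑ i ∈ Finset.range m, hat (r - i) =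
    Real.smoothTransition r - Real.smoothTransition (r - m) := by
  have := Finset.sum_range_sub' (fun i : ℕ => Real.smoothTransition (r - i)) m
  simp only [Nat.cast_zero, sub_zero] at this
  rw [← this]
  refine Finset.sum_congr rfl fun i _ => ?_
  unfold hat
  push_cast
  ring_nf

theorem sum_hat_le_one (m : ℕ) (r : ℝ) : ∑ i ∈ Finset.range m, hat (r - i) ≤ 1 := by
  rw [sum_hat]
  have h1 := Real.smoothTransition.le_one r
  have h2 := Real.smoothTransition.nonneg (r - m)
  linarith

theorem sum_hat_eq_one {m : ℕ} {r : ℝ} (h1 : 1 ≤ r) (h2 : r ≤ m) :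
    ∑ i ∈ Finset.range m, hat (r - i) = 1 := by
  rw [sum_hat, Real.smoothTransition.one_of_one_le h1,
    Real.smoothTransition.zero_of_nonpos (by linarith), sub_zero]

/-- The bump `hat` rescaled to the interval `[σ, σ + 2τ]`. -/
def hatAt (τ σ r : ℝ) : ℝ := hat ((r - σ) / τ)

theorem mem_Icc_of_hatAt_ne_zero {τ σ r : ℝ} (hτ : 0 < τ) (h : hatAt τ σ r ≠ 0) :
    r ∈ Set.Icc σ (σ + 2 * τ) := by
  obtain ⟨h1, h2⟩ := mem_Icc_of_hat_ne_zero h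
  rw [le_div_iff₀ hτ] at h1
  rw [div_le_iff₀ hτ] at h2
  constructor <;> linarith

theorem hatAt_nonneg (τ σ r : ℝ) : 0 ≤ hatAt τ σ r := hat_nonneg _

theorem contDiff_hatAt (τ σ : ℝ) : ContDiff ℝ ∞ (hatAt τ σ) :=
  contDiff_hat.comp ((contDiff_id.sub contDiff_const).div_const τ)

theorem hasCompactSupport_hatAt {τ : ℝ} (hτ : 0 < τ) (σ : ℝ) : HasCompactSupport (hatAt τ σ) :=
  HasCompactSupport.intro (isCompact_Icc (a := σ) (b := σ + 2 * τ)) fun r hr => by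
    by_contra h
    exact hr (mem_Icc_of_hatAt_ne_zero hτ h)

theorem integral_abs_hatAt_le {τ : ℝ} (hτ : 0 < τ) (σ : ℝ) : ∫ r, |hatAt τ σ r| ≤ 2 * τ := by
  have hi : Integrable ((Set.Icc σ (σ + 2 * τ)).indicator fun _ => (1 : ℝ)) volume :=
    (integrable_indicator_iff measurableSet_Icc).2 (by simp [ENNReal.mul_lt_top])
  calc ∫ r, |hatAt τ σ r| ≤ ∫ r, (Set.Icc σ (σ + 2 * τ)).indicator (fun _ => (1 : ℝ)) r := by
        refine integral_mono_of_nonneg (Filter.Eventually.of_forall fun _ => abs_nonneg _) hi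
          (Filter.Eventually.of_forall fun r => ?_)
        by_cases h : hatAt τ σ r = 0
        · simp only [h, abs_zero]
          exact Set.indicator_nonneg (fun _ _ => zero_le_one) r
        · simp only
          rw [Set.indicator_of_mem (mem_Icc_of_hatAt_ne_zero hτ h),
            abs_of_nonneg (hatAt_nonneg τ σ r)]
          exact hat_le_one _
    _ = 2 * τ := by
        rw [integral_indicator measurableSet_Icc]
        simp [hτ.le]

/-- Optimization over the scale: both terms balance for `ε = T / m`, and the case `m = 0` is the
limit `ε → ∞`. -/
theorem le_of_forall_scale {X D m T γ : ℝ} (hγ : 0 < γ) (hγ1 : γ < 1) (hm : 0 ≤ m)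
    (hT : 0 ≤ T) (h0 : T = 0 → m = 0)
    (h : ∀ ε : ℝ, 0 < ε → X ≤ D * (ε ^ γ * m + 2 * (ε ^ (γ - 1) * T))) :
    X ≤ 3 * D * (m ^ (1 - γ) * T ^ γ) := by
  rcases hT.eq_or_lt with hT0 | hT0
  · have := h 1 one_pos
    rw [h0 hT0.symm, ← hT0] at this
    simp only [mul_zero, add_zero] at this
    rw [h0 hT0.symm, ← hT0, Real.zero_rpow hγ.ne']
    simpa using this
  rcases hm.eq_or_lt with hm0 | hm0
  · rw [← hm0, Real.zero_rpow (by linarith)]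
    have hlim : Filter.Tendsto (fun ε : ℝ => D * (2 * (ε ^ (-(1 - γ)) * T))) Filter.atTop
        (nhds (D * (2 * (0 * T)))) :=
      (((tendsto_rpow_neg_atTop (by linarith)).mul_const T).const_mul 2).const_mul D
    have := ge_of_tendsto hlim ((Filter.eventually_gt_atTop 0).mono fun ε hε => by
      have := h ε hε
      rw [← hm0] at this
      rw [neg_sub]
      simpa using this)
    simpa using this
  · have h1 := h (T / m) (by positivity)
    have e1 : (T / m) ^ γ * m = m ^ (1 - γ) * T ^ γ := by
      rw [Real.div_rpow hT hm, Real.rpow_sub hm0, Real.rpow_one]; ring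
    have e2 : (T / m) ^ (γ - 1) * T = m ^ (1 - γ) * T ^ γ := by
      rw [Real.rpow_sub_one (by positivity), Real.div_rpow hT hm, Real.rpow_sub hm0, Real.rpow_one]
      field_simp
    rw [e1, e2] at h1
    linarith

/-! ### The estimate for one directional component -/

theorem exists_sliceEnergy_le_mean {d : ℕ} {e : Fin (d + 1) → ℝ} {p : ℝ} (hp : 0 < p)
    {φ : Eucl (d + 1) → ℝ} (hφ : ContDiff ℝ ∞ φ) (hc : HasCompactSupport φ) {τ : ℝ} (hτ : 0 < τ)
    (σ : ℝ) : ∃ t ∈ Set.Ioc σ (σ + τ),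
      τ * sliceEnergy e p φ t ≤ ∫ t in σ..σ + τ, sliceEnergy e p φ t := by
  have hv : (volume : Measure ℝ).real (Set.Ioc σ (σ + τ)) = τ := by simp [hτ.le]
  obtain ⟨t, ht, hle⟩ := exists_le_setAverage (μ := volume) (s := Set.Ioc σ (σ + τ))
    (f := sliceEnergy e p φ) (by simp [hτ]) (by simp)
    (integrable_sliceEnergy hp hφ hc).1.integrableOn
  refine ⟨t, ht, ?_⟩
  rw [intervalIntegral.integral_of_le (by linarith)]
  rw [setAverage_eq, hv, smul_eq_mul] at hle
  calc τ * sliceEnergy e p φ t ≤ τ * (τ⁻¹ * _) := by gcongr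
    _ = _ := by rw [← mul_assoc, mul_inv_cancel₀ hτ.ne', one_mul]

/-- Hölder's inequality for finite sums, with weights raised to conjugate powers. -/
theorem sum_rpow_mul_rpow_le {ι : Type*} (s : Finset ι) {a b : ι → ℝ} (ha : ∀ i, 0 ≤ a i)
    (hb : ∀ i, 0 ≤ b i) {γ : ℝ} (hγ : 0 < γ) (hγ1 : γ < 1) :
    ∑ i ∈ s, a i ^ (1 - γ) * b i ^ γ ≤ (∑ i ∈ s, a i) ^ (1 - γ) * (∑ i ∈ s, b i) ^ γ := by
  have h1γ : 0 < 1 - γ := by linarith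
  have hpq : ((1 - γ)⁻¹).HolderConjugate γ⁻¹ := by
    rw [Real.holderConjugate_iff]
    refine ⟨(one_lt_inv₀ h1γ).2 (by linarith), by simp⟩
  have h := Real.inner_le_Lp_mul_Lq s (fun i => a i ^ (1 - γ)) (fun i => b i ^ γ) hpq
  have e1 : ∀ i, |a i ^ (1 - γ)| ^ (1 - γ)⁻¹ = a i := fun i => by
    rw [abs_of_nonneg (Real.rpow_nonneg (ha i) _), Real.rpow_rpow_inv (ha i) h1γ.ne']
  have e2 : ∀ i, |b i ^ γ| ^ γ⁻¹ = b i := fun i => by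
    rw [abs_of_nonneg (Real.rpow_nonneg (hb i) _), Real.rpow_rpow_inv (hb i) hγ.ne']
  simpa [e1, e2] using h

/-- The estimate for the coefficient `∑ e^α f_α` of the pure `k`-th derivative in direction `e`.
The space is cut into slabs of width `2τ`, and on each slab `φ` is replaced by its values on one
hyperplane, chosen such that the energy of `φ` on it is at most the mean one. -/
theorem exists_abs_integral_dirComp_mul_le (d k : ℕ) (hd : 1 ≤ d) (e : Fin (d + 1) → ℝ)
    (he : e 0 = 1) : ∃ C : ℝ, 0 ≤ C ∧ ∀ f : MultiIndex (d + 1) k → Eucl (d + 1) → ℝ,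
      (∀ α, Integrable (f α) volume) → DivFree f →
      ∀ φ : Eucl (d + 1) → ℝ, ContDiff ℝ ∞ φ → HasCompactSupport φ →
        |∫ x, dirComp e f x * φ x| ≤ C * (∫ x, totAbs f x) *
          (∫ x, ‖fderiv ℝ φ x‖ ^ ((d : ℝ) + 1)) ^ (1 / ((d : ℝ) + 1)) := by
  obtain ⟨K₀, hK₀⟩ : ∃ K : ℝ, ∀ j, |e j| ≤ K := by
    obtain ⟨K, hK⟩ := (Set.finite_range fun j => |e j|).bddAbove
    exact ⟨K, fun j => hK ⟨j, rfl⟩⟩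
  set K := max 1 K₀ with hKdef
  have hK : ∀ j, |e j| ≤ K := fun j => (hK₀ j).trans (le_max_right _ _)
  have hK1 : 1 ≤ K := le_max_left _ _
  have hK0 : 0 ≤ K := by linarith
  set p : ℝ := (d : ℝ) + 1 with hp
  have hd1 : (1 : ℝ) ≤ d := by exact_mod_cast hd
  have hp0 : 0 < p := by positivity
  set γ : ℝ := 1 / p with hγdef
  have hγ : 0 < γ := by positivity
  have hγ1 : γ < 1 := by rw [hγdef, div_lt_one hp0]; linarith
  obtain ⟨C₁, hC₁, hslab⟩ := exists_abs_integral_slab_le (k := k) hK hK1 hγ hγ1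
  obtain ⟨C₂, hC₂, hmor⟩ := exists_sliceExt_holder d hd e
  refine ⟨3 * C₁ * C₂, by positivity, fun f hf hdiv φ hφ hφc => ?_⟩
  set F := ∫ x, totAbs f x with hF
  have hF0 : 0 ≤ F := integral_nonneg fun x => totAbs_nonneg x
  obtain ⟨hSint, hSeq⟩ := integrable_sliceEnergy (e := e) hp0 hφ hφc
  set H := ∫ x, ‖fderiv ℝ φ x‖ ^ p with hH
  have hH0 : 0 ≤ H := integral_nonneg fun x => by positivity
  obtain ⟨Λ, hΛ⟩ := ContDiff.lipschitzWith_of_hasCompactSupport hφc hφ (by simp)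
  obtain ⟨M, hM⟩ := hφ.continuous.bounded_above_of_compact_support hφc
  set g := dirComp e f with hg
  have hgint : Integrable g volume := integrable_dirComp hf
  -- The form `linForm e` is bounded by `R` on the support of `φ`, so finitely many slabs suffice.
  obtain ⟨R, hR⟩ : ∃ R : ℝ, ∀ x, φ x ≠ 0 → |linForm e x| ≤ R := by
    obtain ⟨R, hR⟩ := (hφc.isCompact.image (linForm e).continuous).isBounded.exists_norm_le
    exact ⟨R, fun x hx => hR _ (Set.mem_image_of_mem _ (subset_tsupport _ hx))⟩
  suffices hτ : ∀ τ : ℝ, 0 < τ → |∫ x, g x * φ x| ≤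
      3 * C₁ * C₂ * F * H ^ γ + τ * (K ^ k * F * (2 * Λ)) by
    have hlim : Filter.Tendsto (fun τ : ℝ => 3 * C₁ * C₂ * F * H ^ γ + τ * (K ^ k * F * (2 * Λ)))
        (nhdsWithin 0 (Set.Ioi 0)) (nhds (3 * C₁ * C₂ * F * H ^ γ + 0 * (K ^ k * F * (2 * Λ)))) :=
      ((Continuous.tendsto (by fun_prop) 0)).mono_left nhdsWithin_le_nhds
    rw [zero_mul, add_zero] at hlim
    exact ge_of_tendsto hlim (Filter.eventually_of_mem self_mem_nhdsWithin hτ)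
  intro τ hτ
  obtain ⟨m₀, hm₀⟩ := exists_nat_ge (R / τ + 1)
  set m := 2 * m₀
  set σ : ℕ → ℝ := fun i => τ * (i - m₀) with hσ
  have hσ1 : ∀ i, σ (i + 1) = σ i + τ := fun i => by simp only [hσ]; push_cast; ring
  set w : ℕ → ℝ → ℝ := fun i => hatAt τ (σ i) with hw
  have hw_eq : ∀ i r, w i r = hat (r / τ + m₀ - i) := fun i r => by
    simp only [hw, hσ, hatAt]
    congr 1
    field_simp
    ring
  have hw0 : ∀ i r, 0 ≤ w i r := fun i r => hatAt_nonneg _ _ _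
  have hwsum_le : ∀ r, ∑ i ∈ Finset.range m, w i r ≤ 1 := fun r => by
    simp only [hw_eq]; exact sum_hat_le_one m _
  have hwsum : ∀ x, φ x ≠ 0 → ∑ i ∈ Finset.range m, w i (linForm e x) = 1 := fun x hx => by
    simp only [hw_eq]
    have h1 := abs_le.1 (hR x hx)
    have h2 : linForm e x / τ ≤ R / τ := by gcongr; exact h1.2
    have h3 : -(R / τ) ≤ linForm e x / τ := by rw [← neg_div]; gcongr; exact h1.1
    refine sum_hat_eq_one (by linarith) ?_
    simp only [m]; push_cast; linarith
  have hwc : ∀ i, Continuous fun x : Eucl (d + 1) => w i (linForm e x) := fun i =>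
    (contDiff_hatAt τ (σ i)).continuous.comp (linForm e).continuous
  choose t ht htS using fun i => exists_sliceEnergy_le_mean (e := e) hp0 hφ hφc hτ (σ i)
  set u : ℕ → Eucl (d + 1) → ℝ := fun i => sliceExt e (t i) φ with hu
  have huc : ∀ i, Continuous (u i) := fun i => continuous_sliceExt hφ.continuous _
  have hut : ∀ i, TransverselyBounded e (u i) := fun i => transverselyBounded_sliceExt he hφc _
  set J : ℕ → ℝ := fun i => ∫ x, totAbs f x * w i (linForm e x) with hJ
  have hJint : ∀ i, Integrable (fun x => totAbs f x * w i (linForm e x)) volume := fun i =>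
    (integrable_totAbs hf).mul_bdd (c := 1) (hwc i).aestronglyMeasurable
      (Filter.Eventually.of_forall fun x => by
        rw [Real.norm_eq_abs, abs_of_nonneg (hw0 i _)]; exact hat_le_one _)
  have hJ0 : ∀ i, 0 ≤ J i := fun i =>
    integral_nonneg fun x => mul_nonneg (totAbs_nonneg x) (hw0 i _)
  have hJsum : ∑ i ∈ Finset.range m, J i ≤ F := by
    rw [hJ, ← integral_finsetSum _ fun i _ => hJint i]
    refine integral_mono (integrable_finsetSum _ fun i _ => hJint i) (integrable_totAbs hf)
      fun x => ?_
    simp only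
    rw [← Finset.mul_sum]
    exact mul_le_of_le_one_right (totAbs_nonneg x) (hwsum_le _)
  have hJF : ∀ i, J i ≤ F := fun i =>
    integral_mono (hJint i) (integrable_totAbs hf) fun x =>
      mul_le_of_le_one_right (totAbs_nonneg x) (hat_le_one _)
  have hS0 : ∀ i, 0 ≤ sliceEnergy e p φ (t i) := fun i => sliceEnergy_nonneg _ _
  -- On each slab the scale `ε` of the slab estimate is optimized.
  have hpiece : ∀ i, |∫ x, g x * (w i (linForm e x) * u i x)| ≤
      3 * C₁ * C₂ * F ^ γ * (J i ^ (1 - γ) * (τ * sliceEnergy e p φ (t i)) ^ γ) := by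
    intro i
    have h1 : ∀ ε : ℝ, 0 < ε → |∫ x, g x * (w i (linForm e x) * u i x)| ≤
        (C₁ * (C₂ * sliceEnergy e p φ (t i) ^ γ)) *
          (ε ^ γ * J i + 2 * (ε ^ (γ - 1) * (τ * F))) := by
      intro ε hε
      have h := hslab f hf hdiv (w i) (contDiff_hatAt _ _) (hasCompactSupport_hatAt hτ _) (u i)
        (huc i) (hut i) (C₂ * sliceEnergy e p φ (t i) ^ γ) M
        (mul_nonneg hC₂ (Real.rpow_nonneg (hS0 i) _))
        (fun x y => hmor φ hφ hφc (t i) x y) (fun x => hM _) ε hε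
      refine h.trans ?_
      have hS : 0 ≤ sliceEnergy e p φ (t i) ^ γ := Real.rpow_nonneg (hS0 i) _
      have habs : ∀ x : Eucl (d + 1), |w i (linForm e x)| = w i (linForm e x) := fun x =>
        abs_of_nonneg (hw0 i _)
      simp only [habs]
      have h2 := integral_abs_hatAt_le hτ (σ i)
      have hεγ : 0 ≤ ε ^ (γ - 1) := by positivity
      refine mul_le_mul_of_nonneg_left (add_le_add le_rfl ?_) (by positivity)
      calc (∫ r, |w i r|) * ε ^ (γ - 1) * F ≤ (2 * τ) * ε ^ (γ - 1) * F := by gcongr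
        _ = _ := by ring
    have hS : 0 ≤ sliceEnergy e p φ (t i) ^ γ := Real.rpow_nonneg (hS0 i) _
    have h2 := le_of_forall_scale hγ hγ1 (hJ0 i) (by positivity : 0 ≤ τ * F)
      (fun h0 => by
        rcases mul_eq_zero.1 h0 with h | h
        · exact absurd h hτ.ne'
        · exact le_antisymm (h ▸ hJF i) (hJ0 i)) h1
    refine h2.trans (le_of_eq ?_)
    rw [Real.mul_rpow hτ.le hF0, Real.mul_rpow hτ.le (hS0 i)]
    ring
  have hmain : ∑ i ∈ Finset.range m, |∫ x, g x * (w i (linForm e x) * u i x)| ≤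
      3 * C₁ * C₂ * F * H ^ γ := by
    have hsumS : ∑ i ∈ Finset.range m, τ * sliceEnergy e p φ (t i) ≤ H := by
      calc _ ≤ ∑ i ∈ Finset.range m, ∫ r in σ i..σ (i + 1), sliceEnergy e p φ r :=
            Finset.sum_le_sum fun i _ => by rw [hσ1]; exact htS i
        _ = ∫ r in σ 0..σ m, sliceEnergy e p φ r :=
            intervalIntegral.sum_integral_adjacent_intervals fun i _ =>
              hSint.intervalIntegrable
        _ ≤ ∫ r, sliceEnergy e p φ r := by
            rw [intervalIntegral.integral_of_le]
            · exact setIntegral_le_integral hSint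
                (Filter.Eventually.of_forall fun r => sliceEnergy_nonneg _ _)
            · simp only [hσ]
              gcongr
              simp
        _ = H := hSeq
    calc _ ≤ ∑ i ∈ Finset.range m,
          3 * C₁ * C₂ * F ^ γ * (J i ^ (1 - γ) * (τ * sliceEnergy e p φ (t i)) ^ γ) :=
          Finset.sum_le_sum fun i _ => hpiece i
      _ = 3 * C₁ * C₂ * F ^ γ * ∑ i ∈ Finset.range m,
          (J i ^ (1 - γ) * (τ * sliceEnergy e p φ (t i)) ^ γ) := by rw [Finset.mul_sum]
      _ ≤ 3 * C₁ * C₂ * F ^ γ * ((∑ i ∈ Finset.range m, J i) ^ (1 - γ) *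
          (∑ i ∈ Finset.range m, τ * sliceEnergy e p φ (t i)) ^ γ) := by
          gcongr
          exact sum_rpow_mul_rpow_le _ hJ0 (fun i => mul_nonneg hτ.le (hS0 i)) hγ hγ1
      _ ≤ 3 * C₁ * C₂ * F ^ γ * (F ^ (1 - γ) * H ^ γ) := by
          have h1 : 0 ≤ ∑ i ∈ Finset.range m, J i := Finset.sum_nonneg fun i _ => hJ0 i
          have h2 : 0 ≤ ∑ i ∈ Finset.range m, τ * sliceEnergy e p φ (t i) :=
            Finset.sum_nonneg fun i _ => mul_nonneg hτ.le (hS0 i)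
          have h3 : 0 ≤ 1 - γ := by linarith
          gcongr
      _ = _ := by
          have : F ^ γ * F ^ (1 - γ) = F := by
            rw [← Real.rpow_add' hF0 (by simp)]; simp
          linear_combination (3 * C₁ * C₂ * H ^ γ) * this
  -- Replacing `φ` by its values on one hyperplane costs `O(τ)`, which disappears as `τ → 0`.
  have hfreeze : ∀ i x, |w i (linForm e x) * (φ x - u i x)| ≤
      w i (linForm e x) * (τ * (2 * Λ)) := by
    intro i x
    rw [abs_mul, abs_of_nonneg (hw0 i _)]
    by_cases h0 : w i (linForm e x) = 0
    · simp [h0]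
    refine mul_le_mul_of_nonneg_left ?_ (hw0 i _)
    have h1 := mem_Icc_of_hatAt_ne_zero hτ h0
    have h2 := ht i
    have h3 : |linForm e x - t i| ≤ 2 * τ := by
      rw [abs_le]; constructor <;> linarith [h1.1, h1.2, h2.1, h2.2]
    have h4 := hΛ.dist_le_mul x (slicePoint e (t i) fun j => x j.succ)
    rw [dist_sliceExt he, Real.dist_eq] at h4
    calc _ ≤ Λ * |linForm e x - t i| := h4
      _ ≤ Λ * (2 * τ) := by gcongr
      _ = _ := by ring
  have hgu : ∀ i, Integrable (fun x => g x * (w i (linForm e x) * u i x)) volume := fun i =>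
    integrable_mul_of_compactSupport hgint ((hwc i).mul (huc i))
      ((hut i).hasCompactSupport (hasCompactSupport_hatAt hτ _))
  have hgφ : ∀ i, Integrable (fun x => g x * (w i (linForm e x) * φ x)) volume := fun i =>
    integrable_mul_of_compactSupport hgint ((hwc i).mul hφ.continuous) hφc.mul_left
  have hdec : ∫ x, g x * φ x = (∑ i ∈ Finset.range m, ∫ x, g x * (w i (linForm e x) * u i x)) +
      ∑ i ∈ Finset.range m, ∫ x, g x * (w i (linForm e x) * (φ x - u i x)) := by
    rw [← Finset.sum_add_distrib]
    have h1 : ∀ i, (∫ x, g x * (w i (linForm e x) * u i x)) +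
        (∫ x, g x * (w i (linForm e x) * (φ x - u i x))) =
        ∫ x, g x * (w i (linForm e x) * φ x) := fun i => by
      rw [← integral_add (hgu i)]
      · congr 1; funext x; ring
      · refine ((hgφ i).sub (hgu i)).congr (Filter.Eventually.of_forall fun x => ?_)
        simp only [Pi.sub_apply]; ring
    rw [Finset.sum_congr rfl fun i _ => h1 i, ← integral_finsetSum _ fun i _ => hgφ i]
    congr 1
    funext x
    rw [← Finset.mul_sum, ← Finset.sum_mul]
    by_cases hx : φ x = 0
    · simp [hx]
    · rw [hwsum x hx, one_mul]
  have herr : ∑ i ∈ Finset.range m, |∫ x, g x * (w i (linForm e x) * (φ x - u i x))| ≤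
      τ * (K ^ k * F * (2 * Λ)) := by
    calc _ ≤ ∑ i ∈ Finset.range m, ∫ x, K ^ k * (τ * (2 * Λ)) *
            (totAbs f x * w i (linForm e x)) := by
          refine Finset.sum_le_sum fun i _ => ?_
          rw [← Real.norm_eq_abs]
          refine norm_integral_le_of_norm_le ((hJint i).const_mul _)
            (Filter.Eventually.of_forall fun x => ?_)
          rw [Real.norm_eq_abs, abs_mul]
          calc _ ≤ (K ^ k * totAbs f x) * (w i (linForm e x) * (τ * (2 * Λ))) :=
                mul_le_mul (abs_dirComp_le hK x) (hfreeze i x) (abs_nonneg _)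
                  (mul_nonneg (by positivity) (totAbs_nonneg x))
            _ = _ := by ring
      _ = K ^ k * (τ * (2 * Λ)) * ∑ i ∈ Finset.range m, J i := by
          rw [Finset.mul_sum]
          exact Finset.sum_congr rfl fun i _ => integral_const_mul _ _
      _ ≤ K ^ k * (τ * (2 * Λ)) * F := by gcongr
      _ = _ := by ring
  rw [hdec]
  refine (abs_add_le _ _).trans (add_le_add ?_ ?_)
  · exact (Finset.abs_sum_le_sum_abs _ _).trans hmain
  · exact (Finset.abs_sum_le_sum_abs _ _).trans herr

/-! ### From directional components to all components -/

/-- The vectors of monomials `(e^α)_{|α| = k}` with `e 0 = 1` span: a homogeneous polynomial that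
vanishes for all such `e` vanishes. -/
theorem span_monomialVec_eq_top (d k : ℕ) :
    Submodule.span ℝ {c : MultiIndex (d + 1) k → ℝ |
      ∃ e : Fin (d + 1) → ℝ, e 0 = 1 ∧ c = monomialVec e} = ⊤ := by
  by_contra hne
  obtain ⟨ℓ, hℓ0, hℓ⟩ := Submodule.exists_le_ker_of_lt_top _ (lt_top_iff_ne_top.2 hne)
  classical
  set a : MultiIndex (d + 1) k → ℝ := fun α => ℓ (Pi.single α 1) with ha
  have hℓa : ∀ c, ℓ c = ∑ α, c α * a α := fun c => by
    conv_lhs => rw [← Finset.univ_sum_single c]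
    rw [map_sum]
    refine Finset.sum_congr rfl fun α _ => ?_
    rw [ha, ← smul_eq_mul, ← map_smul, ← Pi.single_smul, smul_eq_mul, mul_one]
  have hvan : ∀ e : Fin (d + 1) → ℝ, e 0 ≠ 0 → ∑ α, monomialVec e α * a α = 0 := by
    intro e he
    have h1 : ℓ (monomialVec fun j => e j / e 0) = 0 :=
      hℓ (Submodule.subset_span ⟨fun j => e j / e 0, div_self he, rfl⟩)
    rw [hℓa] at h1
    have h2 : ∀ α : MultiIndex (d + 1) k,
        monomialVec e α = e 0 ^ k * monomialVec (fun j => e j / e 0) α := fun α => by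
      simp only [monomialVec, div_pow, Finset.prod_div_distrib]
      rw [Finset.prod_pow_eq_pow_sum, α.2]
      field_simp
    calc _ = e 0 ^ k * ∑ α, monomialVec (fun j => e j / e 0) α * a α := by
          rw [Finset.mul_sum]
          exact Finset.sum_congr rfl fun α _ => by rw [h2]; ring
      _ = 0 := by rw [h1, mul_zero]
  set ex : MultiIndex (d + 1) k → (Fin (d + 1) →₀ ℕ) := fun α =>
    Finsupp.equivFunOnFinite.symm fun j => (α.1 j : ℕ) with hex
  have hexinj : Function.Injective ex := fun α β h => by
    have := Finsupp.equivFunOnFinite.symm.injective h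
    apply Subtype.ext
    funext j
    exact Fin.ext (congrFun this j)
  set P : MvPolynomial (Fin (d + 1)) ℝ := ∑ α, MvPolynomial.monomial (ex α) (a α) with hP
  have hPe : ∀ x, MvPolynomial.eval x P = ∑ α, monomialVec x α * a α := fun x => by
    rw [hP, map_sum]
    refine Finset.sum_congr rfl fun α _ => ?_
    rw [MvPolynomial.eval_monomial, Finsupp.prod_fintype _ _ (fun i => pow_zero _), mul_comm]
    rfl
  -- The factor `X 0` covers the points with `e 0 = 0`, about which nothing is known.
  have hXP : MvPolynomial.X 0 * P = 0 := by
    apply MvPolynomial.funext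
    intro x
    rw [map_mul, MvPolynomial.eval_X, hPe, map_zero]
    by_cases hx : x 0 = 0
    · rw [hx, zero_mul]
    · rw [hvan x hx, mul_zero]
  have hP0 : P = 0 := by
    rcases mul_eq_zero.1 hXP with h | h
    · exact absurd h (MvPolynomial.X_ne_zero 0)
    · exact h
  apply hℓ0
  ext α
  have h3 := congrArg (MvPolynomial.coeff (ex α)) hP0
  rw [hP, MvPolynomial.coeff_sum, MvPolynomial.coeff_zero] at h3
  simp only [MvPolynomial.coeff_monomial, hexinj.eq_iff, Finset.sum_ite_eq', Finset.mem_univ,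
    if_true] at h3
  simpa [ha] using h3

/-- The estimate for test functions: each `f_α` is a linear combination of components `dirComp e f`
with `e 0 = 1`. -/
theorem exists_abs_integral_component_mul_le (d k : ℕ) (hd : 1 ≤ d) :
    ∃ C : ℝ, 0 ≤ C ∧ ∀ f : MultiIndex (d + 1) k → Eucl (d + 1) → ℝ,
      (∀ α, Integrable (f α) volume) → DivFree f →
      ∀ φ : Eucl (d + 1) → ℝ, ContDiff ℝ ∞ φ → HasCompactSupport φ → ∀ α,
        |∫ x, f α x * φ x| ≤ C * (∫ x, totAbs f x) *
          (∫ x, ‖fderiv ℝ φ x‖ ^ ((d : ℝ) + 1)) ^ (1 / ((d : ℝ) + 1)) := by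
  have key : ∀ c : MultiIndex (d + 1) k → ℝ, ∃ C : ℝ, 0 ≤ C ∧
      ∀ f : MultiIndex (d + 1) k → Eucl (d + 1) → ℝ,
      (∀ α, Integrable (f α) volume) → DivFree f →
      ∀ φ : Eucl (d + 1) → ℝ, ContDiff ℝ ∞ φ → HasCompactSupport φ →
        |∑ α, c α * ∫ x, f α x * φ x| ≤ C * (∫ x, totAbs f x) *
          (∫ x, ‖fderiv ℝ φ x‖ ^ ((d : ℝ) + 1)) ^ (1 / ((d : ℝ) + 1)) := by
    intro c
    have hc : c ∈ Submodule.span ℝ {c : MultiIndex (d + 1) k → ℝ |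
      ∃ e : Fin (d + 1) → ℝ, e 0 = 1 ∧ c = monomialVec e} := by
      rw [span_monomialVec_eq_top]; trivial
    induction hc using Submodule.span_induction with
    | mem c hc =>
      obtain ⟨e, he, rfl⟩ := hc
      obtain ⟨C, hC, h⟩ := exists_abs_integral_dirComp_mul_le d k hd e he
      refine ⟨C, hC, fun f hf hdiv φ hφ hφc => ?_⟩
      have := h f hf hdiv φ hφ hφc
      have e1 : ∑ α, monomialVec e α * ∫ x, f α x * φ x = ∫ x, dirComp e f x * φ x := by
        simp only [← integral_const_mul]
        rw [← integral_finsetSum _ fun α _ =>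
          (integrable_mul_of_compactSupport (hf α) hφ.continuous hφc).const_mul _]
        congr 1
        funext x
        rw [dirComp, Finset.sum_mul]
        exact Finset.sum_congr rfl fun α _ => by ring
      rwa [e1]
    | zero => exact ⟨0, le_rfl, fun f _ _ φ _ _ => by simp⟩
    | add c c' _ _ ih ih' =>
      obtain ⟨C, hC, h⟩ := ih
      obtain ⟨C', hC', h'⟩ := ih'
      refine ⟨C + C', by positivity, fun f hf hdiv φ hφ hφc => ?_⟩
      simp only [Pi.add_apply, add_mul, Finset.sum_add_distrib]
      exact (abs_add_le _ _).trans (add_le_add (h f hf hdiv φ hφ hφc) (h' f hf hdiv φ hφ hφc))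
    | smul r c _ ih =>
      obtain ⟨C, hC, h⟩ := ih
      refine ⟨|r| * C, by positivity, fun f hf hdiv φ hφ hφc => ?_⟩
      simp only [Pi.smul_apply, smul_eq_mul, mul_assoc, ← Finset.mul_sum, abs_mul]
      refine mul_le_mul_of_nonneg_left ?_ (abs_nonneg _)
      simpa only [mul_assoc] using h f hf hdiv φ hφ hφc
  classical
  choose C hC h using fun α : MultiIndex (d + 1) k => key (Pi.single α 1)
  refine ⟨∑ α, C α, Finset.sum_nonneg fun α _ => hC α, fun f hf hdiv φ hφ hφc α => ?_⟩
  have h1 := h α f hf hdiv φ hφ hφc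
  simp only [Pi.single_apply, ite_mul, one_mul, zero_mul, Finset.sum_ite_eq', Finset.mem_univ,
    if_true] at h1
  refine h1.trans ?_
  have h2 : C α ≤ ∑ α, C α := Finset.single_le_sum (fun α _ => hC α) (Finset.mem_univ α)
  have h3 : 0 ≤ ∫ x, totAbs f x := integral_nonneg fun x => totAbs_nonneg x
  gcongr

/-! ### Approximation of Sobolev functions -/

/-- Convolution with a probability density does not increase `L^p` norms. -/
theorem eLpNorm_convolution_le {n : ℕ} {h ρ : Eucl n → ℝ} {p : ℝ≥0∞} (hp1 : 1 ≤ p) (hp : p ≠ ⊤)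
    (hh : AEStronglyMeasurable h volume) (hρ : Continuous ρ) (hρ0 : ∀ x, 0 ≤ ρ x)
    (hρi : Integrable ρ volume) (hρ1 : ∫ x, ρ x = 1) :
    eLpNorm (convolution h ρ (ContinuousLinearMap.lsmul ℝ ℝ) volume) p volume ≤
      eLpNorm h p volume := by
  obtain ⟨h', hh', hae⟩ := hh
  rw [eLpNorm_congr_ae hae, convolution_congr _ hae (Filter.EventuallyEq.refl _ ρ)]
  have hρe : ∫⁻ x, ENNReal.ofReal (ρ x) = 1 := by
    rw [← ofReal_integral_eq_lintegral_ofReal hρi (Filter.Eventually.of_forall hρ0), hρ1]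
    simp
  set ν : Measure (Eucl n) := volume.withDensity fun x => ENNReal.ofReal (ρ x) with hν
  have hνp : IsProbabilityMeasure ν := ⟨by simpa [hν] using hρe⟩
  have hp0 : p ≠ 0 := (zero_lt_one.trans_le hp1).ne'
  have hpt : 0 < p.toReal := ENNReal.toReal_pos hp0 hp
  have hρm : Measurable fun x => ENNReal.ofReal (ρ x) := hρ.measurable.ennreal_ofReal
  have hpoint : ∀ x, ‖convolution h' ρ (ContinuousLinearMap.lsmul ℝ ℝ) volume x‖ₑ ^ p.toReal ≤
      ∫⁻ t, ‖h' (x - t)‖ₑ ^ p.toReal ∂ν := by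
    intro x
    have hm : AEStronglyMeasurable (fun t => h' (x - t)) ν :=
      (hh'.comp_measurable (measurable_const.sub measurable_id)).aestronglyMeasurable
    have h1 : ‖convolution h' ρ (ContinuousLinearMap.lsmul ℝ ℝ) volume x‖ₑ ≤
        eLpNorm (fun t => h' (x - t)) 1 ν := by
      rw [convolution_smul_eq_integral, eLpNorm_one_eq_lintegral_enorm, hν,
        lintegral_withDensity_eq_lintegral_mul₀ hρm.aemeasurable (by
          exact (hh'.comp_measurable (measurable_const.sub measurable_id)).enorm.aemeasurable)]
      refine (enorm_integral_le_lintegral_enorm _).trans (le_of_eq (lintegral_congr fun t => ?_))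
      rw [enorm_mul, Pi.mul_apply, mul_comm, Real.enorm_eq_ofReal (hρ0 t)]
    have h2 := h1.trans (eLpNorm_le_eLpNorm_of_exponent_le hp1 hm)
    rw [eLpNorm_eq_lintegral_rpow_enorm_toReal hp0 hp] at h2
    calc _ ≤ ((∫⁻ t, ‖h' (x - t)‖ₑ ^ p.toReal ∂ν) ^ (1 / p.toReal)) ^ p.toReal := by gcongr
      _ = _ := by rw [← ENNReal.rpow_mul, one_div_mul_cancel hpt.ne', ENNReal.rpow_one]
  rw [eLpNorm_eq_lintegral_rpow_enorm_toReal hp0 hp, eLpNorm_eq_lintegral_rpow_enorm_toReal hp0 hp]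
  gcongr ?_ ^ (1 / p.toReal)
  calc _ ≤ ∫⁻ x, ∫⁻ t, ‖h' (x - t)‖ₑ ^ p.toReal ∂ν := lintegral_mono hpoint
    _ = ∫⁻ t, (∫⁻ x, ‖h' (x - t)‖ₑ ^ p.toReal) ∂ν := by
        refine lintegral_lintegral_swap ?_
        exact ((hh'.comp_measurable (measurable_fst.sub measurable_snd)).enorm.pow_const
          _).aemeasurable
    _ = ∫⁻ _, (∫⁻ x, ‖h' x‖ₑ ^ p.toReal) ∂ν := by
        refine lintegral_congr fun t => ?_
        exact lintegral_sub_right_eq_self (fun x => ‖h' x‖ₑ ^ p.toReal) t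
    _ = _ := by simp

/-- Mollification turns weak derivatives into classical ones. -/
theorem partialDeriv_convolution_of_isWeakPartial {n : ℕ} {j : Fin n} {h v ρ : Eucl n → ℝ}
    (hw : IsWeakPartial j h v) (hρ : ContDiff ℝ ∞ ρ) (hc : HasCompactSupport ρ) :
    partialDeriv j (convolution h ρ (ContinuousLinearMap.lsmul ℝ ℝ) volume) =
      convolution v ρ (ContinuousLinearMap.lsmul ℝ ℝ) volume := by
  have h1 := iterPartial_convolution hw.1 hρ hc [j]
  simp only [iterPartial_cons, iterPartial_nil] at h1
  rw [h1]
  funext x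
  have h2 := hw.2.2 (fun t => ρ (x - t)) (hρ.comp (contDiff_const.sub contDiff_id))
    (hc.comp_homeomorph (Homeomorph.subLeft x))
  have h3 : partialDeriv j (fun t => ρ (x - t)) = fun t => -partialDeriv j ρ (x - t) := by
    funext t
    simp only [partialDeriv]
    have hf : HasFDerivAt (fun t : Eucl n => x - t) (-ContinuousLinearMap.id ℝ (Eucl n)) t :=
      (hasFDerivAt_id t).const_sub x
    have hg := ((hρ.differentiable (by simp) (x - t)).hasFDerivAt).comp t hf
    have hg' : fderiv ℝ (fun t => ρ (x - t)) t = _ := hg.fderiv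
    rw [hg']
    simp
  rw [h3] at h2
  simp only [mul_neg, integral_neg, neg_inj] at h2
  simpa only [convolution, ContinuousLinearMap.lsmul_apply, smul_eq_mul] using h2

/-- The sum of the `L^p` norms of the partial derivatives dominates the `L^p` norm of the norm of
the total derivative. -/
theorem integral_norm_fderiv_rpow_le {n : ℕ} {φ : Eucl n → ℝ} (hφ : ContDiff ℝ ∞ φ)
    (hc : HasCompactSupport φ) {p : ℝ≥0∞} (hp1 : 1 ≤ p) (hp : p ≠ ⊤) :
    (∫ x, ‖fderiv ℝ φ x‖ ^ p.toReal) ^ (1 / p.toReal) ≤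
      ∑ j, (eLpNorm (partialDeriv j φ) p volume).toReal := by
  have hp0 : p ≠ 0 := (zero_lt_one.trans_le hp1).ne'
  have hmem : MemLp (fderiv ℝ φ) p volume :=
    (hφ.continuous_fderiv (by simp)).memLp_of_hasCompactSupport (hc.fderiv ℝ)
  have hmemj : ∀ j, MemLp (partialDeriv j φ) p volume := fun j =>
    (contDiff_partialDeriv hφ j).continuous.memLp_of_hasCompactSupport
      (hasCompactSupport_partialDeriv hc j)
  have h1 : (∫ x, ‖fderiv ℝ φ x‖ ^ p.toReal) ^ (1 / p.toReal) =
      (eLpNorm (fderiv ℝ φ) p volume).toReal := by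
    rw [hmem.eLpNorm_eq_integral_rpow_norm hp0 hp, ENNReal.toReal_ofReal (by positivity), one_div]
  have h2 : eLpNorm (fderiv ℝ φ) p volume ≤ ∑ j, eLpNorm (partialDeriv j φ) p volume := by
    calc _ ≤ eLpNorm (∑ j, fun x => ‖partialDeriv j φ x‖) p volume := by
          refine eLpNorm_mono_real fun x => ?_
          rw [Finset.sum_apply]
          refine ContinuousLinearMap.opNorm_le_bound _ (by positivity) fun y => ?_
          have hy : y = ∑ j, y j • EuclideanSpace.single j (1 : ℝ) := by
            ext i
            simp [Finset.sum_apply, Pi.single_apply]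
          conv_lhs => rw [hy]
          rw [map_sum, Finset.sum_mul]
          refine (norm_sum_le _ _).trans (Finset.sum_le_sum fun j _ => ?_)
          rw [map_smul, norm_smul, mul_comm]
          exact mul_le_mul_of_nonneg_left (PiLp.norm_apply_le y j) (norm_nonneg _)
      _ ≤ ∑ j, eLpNorm (fun x => ‖partialDeriv j φ x‖) p volume :=
          eLpNorm_sum_le (fun j _ => (hmemj j).1.norm) hp1
      _ = _ := by simp only [eLpNorm_norm]
  rw [h1, ← ENNReal.toReal_sum fun j _ => (hmemj j).2.ne]
  exact ENNReal.toReal_mono (ENNReal.sum_ne_top.2 fun j _ => (hmemj j).2.ne) h2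

/-- Bounded functions with weak gradient in `L^p` are limits of test functions, boundedly almost
everywhere and with control of the gradients. -/
theorem exists_approx {n : ℕ} {p : ℝ≥0∞} (hp1 : 1 ≤ p) (hp : p ≠ ⊤) {h : Eucl n → ℝ}
    {Dh : Fin n → Eucl n → ℝ} (hinf : MemLp h ⊤ volume) (hhp : MemLp h p volume)
    (hDp : ∀ j, MemLp (Dh j) p volume) (hw : ∀ j, IsWeakPartial j h (Dh j)) :
    ∃ (φ : ℕ → Eucl n → ℝ) (M c : ℝ), (∀ m, ContDiff ℝ ∞ (φ m)) ∧
      (∀ m, HasCompactSupport (φ m)) ∧ (∀ m x, |φ m x| ≤ M) ∧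
      (∀ᵐ x, Filter.Tendsto (fun m => φ m x) Filter.atTop (nhds (h x))) ∧
      ∀ m j, (eLpNorm (partialDeriv j (φ m)) p volume).toReal ≤
        (eLpNorm (Dh j) p volume).toReal + c * ((m : ℝ) + 1)⁻¹ := by
  have hp0 : p ≠ 0 := (zero_lt_one.trans_le hp1).ne'
  have hloc : LocallyIntegrable h volume := hhp.locallyIntegrable hp1
  have hδ : ∀ m : ℕ, (0 : ℝ) < ((m : ℝ) + 1)⁻¹ := fun m => by positivity
  -- The test functions are mollified at scale `(m + 1)⁻¹` and cut off at radius `m + 1`.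
  let B : ℕ → ContDiffBump (0 : Eucl n) := fun m =>
    ⟨((m : ℝ) + 1)⁻¹ / 2, ((m : ℝ) + 1)⁻¹, half_pos (hδ m), half_lt_self (hδ m)⟩
  let b : ContDiffBump (0 : Eucl n) := ⟨1, 2, one_pos, one_lt_two⟩
  set ρ : ℕ → Eucl n → ℝ := fun m => (B m).normed volume with hρdef
  have hρ : ∀ m, ContDiff ℝ ∞ (ρ m) := fun m => (B m).contDiff_normed
  have hρc : ∀ m, HasCompactSupport (ρ m) := fun m => (B m).hasCompactSupport_normed
  have hρ0 : ∀ m x, 0 ≤ ρ m x := fun m x => (B m).nonneg_normed x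
  have hρ1 : ∀ m, ∫ x, ρ m x = 1 := fun m => (B m).integral_normed
  have hρi : ∀ m, Integrable (ρ m) volume := fun m => (B m).integrable_normed
  set H : ℕ → Eucl n → ℝ := fun m =>
    convolution h (ρ m) (ContinuousLinearMap.lsmul ℝ ℝ) volume with hH
  have hHs : ∀ m, ContDiff ℝ ∞ (H m) := fun m => contDiff_convolution_kernel hloc (hρ m) (hρc m)
  set χ : ℕ → Eucl n → ℝ := fun m x => b (((m : ℝ) + 1)⁻¹ • x) with hχ
  have hχs : ∀ m, ContDiff ℝ ∞ (χ m) := fun m => b.contDiff.comp (contDiff_const_smul _)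
  have hχc : ∀ m, HasCompactSupport (χ m) := fun m =>
    b.hasCompactSupport.comp_smul (hδ m).ne'
  have hχ1 : ∀ m x, |χ m x| ≤ 1 := fun m x => by
    rw [abs_of_nonneg b.nonneg]; exact b.le_one
  obtain ⟨c₀, hc₀0, hc₀⟩ : ∃ c₀ : ℝ, 0 ≤ c₀ ∧ ∀ j x, |partialDeriv j b x| ≤ c₀ := by
    have hb : ∀ j, ∃ c : ℝ, ∀ x, ‖partialDeriv j (b : Eucl n → ℝ) x‖ ≤ c := fun j =>
      (contDiff_partialDeriv b.contDiff j).continuous.bounded_above_of_compact_support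
        (hasCompactSupport_partialDeriv b.hasCompactSupport j)
    choose c hc using hb
    refine ⟨∑ j, |c j|, Finset.sum_nonneg fun _ _ => abs_nonneg _, fun j x => ?_⟩
    exact ((hc j x).trans (le_abs_self _)).trans
      (Finset.single_le_sum (f := fun j => |c j|) (fun _ _ => abs_nonneg _) (Finset.mem_univ j))
  have hχd : ∀ m j x, |partialDeriv j (χ m) x| ≤ c₀ * ((m : ℝ) + 1)⁻¹ := by
    intro m j x
    have h1 := congrFun (iterPartial_comp_smul (u := (b : Eucl n → ℝ)) b.contDiff
      ((m : ℝ) + 1)⁻¹ [j]) x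
    simp only [iterPartial_cons, iterPartial_nil, List.length_singleton, pow_one] at h1
    rw [hχ, h1, abs_mul, abs_of_pos (hδ m), mul_comm]
    exact mul_le_mul_of_nonneg_right (hc₀ j _) (hδ m).le
  set M := (eLpNorm h ⊤ volume).toReal with hM
  have hae : ∀ᵐ x, |h x| ≤ M := by
    have h1 := ae_le_eLpNormEssSup (f := h) (μ := volume)
    filter_upwards [h1] with x hx
    rw [hM, eLpNorm_exponent_top, ← Real.norm_eq_abs, ← toReal_enorm]
    exact ENNReal.toReal_mono (by simpa [eLpNorm_exponent_top] using hinf.2.ne) hx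
  have hHM : ∀ m x, |H m x| ≤ M := by
    intro m x
    have h1 : ∫ t, M * ρ m (x - t) = M := by
      rw [integral_const_mul, integral_sub_left_eq_self (ρ m) volume x, hρ1, mul_one]
    rw [← h1, ← Real.norm_eq_abs]
    refine norm_integral_le_of_norm_le (((hρi m).comp_sub_left x).const_mul M) ?_
    filter_upwards [hae] with t ht
    simp only [ContinuousLinearMap.lsmul_apply, smul_eq_mul, norm_mul, Real.norm_eq_abs]
    rw [abs_of_nonneg (hρ0 m _)]
    exact mul_le_mul_of_nonneg_right ht (hρ0 m _)
  have hM0 : 0 ≤ M := ENNReal.toReal_nonneg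
  refine ⟨fun m x => χ m x * H m x, M, c₀ * (eLpNorm h p volume).toReal,
    fun m => (hχs m).mul (hHs m), fun m => (hχc m).mul_right, fun m x => ?_, ?_, fun m j => ?_⟩
  · rw [abs_mul]
    calc _ ≤ 1 * M := mul_le_mul (hχ1 m x) (hHM m x) (abs_nonneg _) zero_le_one
      _ = M := one_mul M
  · have hlimδ : Filter.Tendsto (fun m : ℕ => ((m : ℝ) + 1)⁻¹) Filter.atTop (nhds 0) := by
      simpa [one_div] using tendsto_one_div_add_atTop_nhds_zero_nat (𝕜 := ℝ)
    have h1 := ContDiffBump.ae_convolution_tendsto_right_of_locallyIntegrable (φ := B)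
      (l := Filter.atTop) (K := 2) (μ := volume) hlimδ
      (Filter.Eventually.of_forall fun m => by simp only [B]; linarith) hloc
    filter_upwards [h1] with x hx
    have h2 : ∀ m, convolution ((B m).normed volume) h (ContinuousLinearMap.lsmul ℝ ℝ) volume x =
        H m x := fun m => by
      simp only [hH, hρdef]
      rw [convolution_smul_eq_integral]
      simp only [convolution, ContinuousLinearMap.lsmul_apply, smul_eq_mul]
      congr 1; funext t; ring
    simp only [h2] at hx
    have h3 : Filter.Tendsto (fun m => χ m x) Filter.atTop (nhds 1) := by
      have h4 : Filter.Tendsto (fun m : ℕ => ((m : ℝ) + 1)⁻¹ • x) Filter.atTop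
          (nhds ((0 : ℝ) • x)) := hlimδ.smul_const x
      rw [zero_smul] at h4
      have h5 := (b.contDiff (n := 0)).continuous.tendsto (0 : Eucl n)
      have h6 : b (0 : Eucl n) = 1 := b.one_of_mem_closedBall (by simp [b])
      rw [h6] at h5
      exact h5.comp h4
    simpa using h3.mul hx
  · have hD : partialDeriv j (H m) =
        convolution (Dh j) (ρ m) (ContinuousLinearMap.lsmul ℝ ℝ) volume :=
      partialDeriv_convolution_of_isWeakPartial (hw j) (hρ m) (hρc m)
    have hDle : eLpNorm (partialDeriv j (H m)) p volume ≤ eLpNorm (Dh j) p volume := by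
      rw [hD]
      exact eLpNorm_convolution_le hp1 hp (hDp j).1 (hρ m).continuous (hρ0 m) (hρi m) (hρ1 m)
    have hHle : eLpNorm (H m) p volume ≤ eLpNorm h p volume :=
      eLpNorm_convolution_le hp1 hp hhp.1 (hρ m).continuous (hρ0 m) (hρi m) (hρ1 m)
    rw [partialDeriv_mul (hχs m) (hHs m)]
    have h1 : eLpNorm (fun x => partialDeriv j (χ m) x * H m x) p volume ≤
        ENNReal.ofReal (c₀ * ((m : ℝ) + 1)⁻¹) * eLpNorm h p volume := by
      have h0 : ∀ x, ‖partialDeriv j (χ m) x * H m x‖ ≤ c₀ * ((m : ℝ) + 1)⁻¹ * ‖H m x‖ := fun x => by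
        rw [norm_mul]
        exact mul_le_mul_of_nonneg_right (hχd m j x) (norm_nonneg _)
      exact (eLpNorm_le_mul_eLpNorm_of_ae_le_mul (Filter.Eventually.of_forall h0) p).trans
        (by gcongr)
    have h2 : eLpNorm (fun x => χ m x * partialDeriv j (H m) x) p volume ≤
        eLpNorm (Dh j) p volume := by
      refine le_trans (eLpNorm_mono fun x => ?_) hDle
      rw [norm_mul]
      exact mul_le_of_le_one_left (norm_nonneg _) (hχ1 m x)
    have h3 : eLpNorm (fun x => partialDeriv j (χ m) x * H m x + χ m x * partialDeriv j (H m) x)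
        p volume ≤ ENNReal.ofReal (c₀ * ((m : ℝ) + 1)⁻¹) * eLpNorm h p volume +
          eLpNorm (Dh j) p volume := by
      refine (eLpNorm_add_le
        (((contDiff_partialDeriv (hχs m) j).continuous.mul
          (hHs m).continuous).aestronglyMeasurable)
        (((hχs m).continuous.mul
          (contDiff_partialDeriv (hHs m) j).continuous).aestronglyMeasurable) hp1).trans
        (add_le_add h1 h2)
    have h4 : ENNReal.ofReal (c₀ * ((m : ℝ) + 1)⁻¹) * eLpNorm h p volume ≠ ⊤ :=
      ENNReal.mul_ne_top ENNReal.ofReal_ne_top hhp.2.ne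
    have h5 := ENNReal.toReal_mono (ENNReal.add_ne_top.2 ⟨h4, (hDp j).2.ne⟩) h3
    rw [ENNReal.toReal_add h4 (hDp j).2.ne, ENNReal.toReal_mul,
      ENNReal.toReal_ofReal (by have := hδ m; positivity)] at h5
    linarith

/-- **Van Schaftingen's estimate.** If `∑ ∂^α f_α = 0` with `f_α` integrable, then each `f_α` acts
on bounded functions with gradient in `L^n` as if it belonged to the dual of the homogeneous
Sobolev space. -/
theorem exists_abs_integral_le_of_divFree (n k : ℕ) (hn : 2 ≤ n) :
    ∃ C : ℝ, 0 ≤ C ∧ ∀ f : MultiIndex n k → Eucl n → ℝ,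
      (∀ α, Integrable (f α) volume) → DivFree f →
      ∀ (h : Eucl n → ℝ) (Dh : Fin n → Eucl n → ℝ), MemLp h ⊤ volume → MemLp h n volume →
        (∀ j, MemLp (Dh j) n volume) → (∀ j, IsWeakPartial j h (Dh j)) → ∀ α,
        |∫ x, f α x * h x| ≤ C * (∫ x, totAbs f x) * ∑ j, (eLpNorm (Dh j) n volume).toReal := by
  obtain ⟨d, rfl⟩ : ∃ d, n = d + 1 := ⟨n - 1, by omega⟩
  obtain ⟨C, hC, hmain⟩ := exists_abs_integral_component_mul_le d k (by omega)
  refine ⟨C, hC, fun f hf hdiv h Dh hinf hhp hDp hw α => ?_⟩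
  have hp1 : (1 : ℝ≥0∞) ≤ ((d + 1 : ℕ) : ℝ≥0∞) := by exact_mod_cast (by omega : 1 ≤ d + 1)
  have hp : ((d + 1 : ℕ) : ℝ≥0∞) ≠ ⊤ := ENNReal.natCast_ne_top _
  have hpr : ((d + 1 : ℕ) : ℝ≥0∞).toReal = (d : ℝ) + 1 := by
    rw [ENNReal.toReal_natCast]; push_cast; rfl
  obtain ⟨φ, M, c, hφ, hφc, hφM, hφlim, hφD⟩ := exists_approx hp1 hp hinf hhp hDp hw
  have hF : 0 ≤ ∫ x, totAbs f x := integral_nonneg fun x => totAbs_nonneg x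
  have hlim : Filter.Tendsto (fun m => ∫ x, f α x * φ m x) Filter.atTop
      (nhds (∫ x, f α x * h x)) := by
    refine tendsto_integral_of_dominated_convergence (fun x => |f α x| * M)
      (fun m => (hf α).1.mul (hφ m).continuous.aestronglyMeasurable) ((hf α).abs.mul_const M)
      (fun m => Filter.Eventually.of_forall fun x => ?_) ?_
    · rw [norm_mul]
      exact mul_le_mul_of_nonneg_left (hφM m x) (norm_nonneg _)
    · filter_upwards [hφlim] with x hx using hx.const_mul _
  have hbound : ∀ m, |∫ x, f α x * φ m x| ≤ C * (∫ x, totAbs f x) *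
      ∑ j, ((eLpNorm (Dh j) ((d + 1 : ℕ) : ℝ≥0∞) volume).toReal + c * ((m : ℝ) + 1)⁻¹) := by
    intro m
    have h1 := hmain f hf hdiv (φ m) (hφ m) (hφc m) α
    have h2 := integral_norm_fderiv_rpow_le (hφ m) (hφc m) hp1 hp
    rw [hpr] at h2
    refine h1.trans (mul_le_mul_of_nonneg_left (h2.trans ?_) (by positivity))
    exact Finset.sum_le_sum fun j _ => hφD m j
  have hlim2 : Filter.Tendsto (fun m : ℕ => C * (∫ x, totAbs f x) *
      ∑ j, ((eLpNorm (Dh j) ((d + 1 : ℕ) : ℝ≥0∞) volume).toReal + c * ((m : ℝ) + 1)⁻¹))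
      Filter.atTop (nhds (C * (∫ x, totAbs f x) *
      ∑ j, ((eLpNorm (Dh j) ((d + 1 : ℕ) : ℝ≥0∞) volume).toReal + c * 0))) := by
    have hlimδ : Filter.Tendsto (fun m : ℕ => ((m : ℝ) + 1)⁻¹) Filter.atTop (nhds 0) := by
      simpa [one_div] using tendsto_one_div_add_atTop_nhds_zero_nat (𝕜 := ℝ)
    exact (tendsto_finsetSum _ fun j _ => (hlimδ.const_mul c).const_add _).const_mul _
  simp only [mul_zero, add_zero] at hlim2
  exact le_of_tendsto_of_tendsto' hlim.abs hlim2 hbound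

/-! ### Signs of labels -/

section Signs

variable {a b c d : ℕ} {h : a + b = c} {A : Fin a → Fin d} {B : Fin b → Fin d} {C : Fin c → Fin d}

theorem range_fin_append (A : Fin a → Fin d) (B : Fin b → Fin d) :
    Set.range (Fin.append A B) = Set.range A ∪ Set.range B := by
  ext x
  constructor
  · rintro ⟨i, rfl⟩
    refine Fin.addCases (fun j => ?_) (fun j => ?_) i
    · rw [Fin.append_left]; exact Or.inl ⟨j, rfl⟩
    · rw [Fin.append_right]; exact Or.inr ⟨j, rfl⟩
  · rintro (⟨j, rfl⟩ | ⟨j, rfl⟩)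
    · exact ⟨Fin.castAdd b j, Fin.append_left _ _ _⟩
    · exact ⟨Fin.natAdd a j, Fin.append_right _ _ _⟩

theorem labelSign_eq_sign (hC : Function.Injective C) (σ : Equiv.Perm (Fin c))
    (hσ : ∀ t, Fin.append A B (Fin.cast h.symm (σ t)) = C t) :
    labelSign h A B C = Equiv.Perm.sign σ := by
  rw [labelSign, Finset.sum_eq_single σ]
  · rw [if_pos hσ]
  · intro τ _ hne
    rw [if_neg]
    intro hτ
    apply hne
    ext t
    have h1 := hσ (σ.symm (τ t))
    rw [Equiv.apply_symm_apply, hτ] at h1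
    have h2 := hC h1
    rw [Equiv.eq_symm_apply] at h2
    rw [h2]
  · simp

theorem abs_labelSign_le_one (hC : Function.Injective C) : |(labelSign h A B C : ℝ)| ≤ 1 := by
  by_cases hex : ∃ σ : Equiv.Perm (Fin c), ∀ t, Fin.append A B (Fin.cast h.symm (σ t)) = C t
  · obtain ⟨σ, hσ⟩ := hex
    rw [labelSign_eq_sign hC σ hσ]
    rcases Int.units_eq_one_or (Equiv.Perm.sign σ) with h1 | h1 <;> simp [h1]
  · have : labelSign h A B C = 0 :=
      Finset.sum_eq_zero fun σ _ => if_neg fun hσ => hex ⟨σ, hσ⟩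
    simp [this]

/-- A nonzero sign means that `C` is the disjoint union of `A` and `B`. -/
theorem range_of_labelSign_ne_zero (hC : Function.Injective C) (hne : labelSign h A B C ≠ 0) :
    Set.range A ∪ Set.range B = Set.range C ∧ Disjoint (Set.range A) (Set.range B) := by
  subst h
  obtain ⟨σ, -, hσ⟩ := Finset.exists_ne_zero_of_sum_ne_zero hne
  have hσ' : ∀ t, Fin.append A B (σ t) = C t := by
    by_contra hcon
    exact hσ (if_neg hcon)
  have hcomp : Fin.append A B = C ∘ σ.symm := by
    funext t
    have := hσ' (σ.symm t)
    rwa [Equiv.apply_symm_apply] at this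
  constructor
  · rw [← range_fin_append, hcomp, EquivLike.range_comp]
  · have hinj : Function.Injective (Fin.append A B) := by
      rw [hcomp]; exact hC.comp σ.symm.injective
    rw [Fin.append_injective_iff] at hinj
    rw [Set.disjoint_left]
    rintro x ⟨i, rfl⟩ ⟨j, hj⟩
    exact hinj.2.2 i j hj.symm

theorem abs_labelSign_eq_one (hA : Function.Injective A) (hB : Function.Injective B)
    (hC : Function.Injective C) (hu : Set.range A ∪ Set.range B = Set.range C)
    (hd : Disjoint (Set.range A) (Set.range B)) : |(labelSign h A B C : ℝ)| = 1 := by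
  subst h
  have hinj : Function.Injective (Fin.append A B) := by
    rw [Fin.append_injective_iff]
    exact ⟨hA, hB, fun i j hij => Set.disjoint_left.1 hd ⟨i, rfl⟩ ⟨j, hij.symm⟩⟩
  have hr : Set.range C = Set.range (Fin.append A B) := by rw [range_fin_append, hu]
  let σ : Equiv.Perm (Fin (a + b)) := (Equiv.ofInjective C hC).trans
    ((Equiv.setCongr hr).trans (Equiv.ofInjective _ hinj).symm)
  have hσ : ∀ t, Fin.append A B (Fin.cast rfl (σ t)) = C t := fun t => by
    simp only [σ, Fin.cast_eq_self, Equiv.trans_apply, Equiv.apply_ofInjective_symm]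
    rfl
  rw [labelSign_eq_sign hC σ hσ]
  rcases Int.units_eq_one_or (Equiv.Perm.sign σ) with h1 | h1 <;> simp [h1]

theorem labelSign_comp {d' : ℕ} {ι : Fin d → Fin d'} (hι : Function.Injective ι) :
    labelSign h (ι ∘ A) (ι ∘ B) (ι ∘ C) = labelSign h A B C := by
  unfold labelSign
  refine Finset.sum_congr rfl fun σ _ => ?_
  have : ∀ i, Fin.append (ι ∘ A) (ι ∘ B) i = ι (Fin.append A B i) := fun i => by
    refine Fin.addCases (fun j => ?_) (fun j => ?_) i
    · simp only [Fin.append_left, Function.comp_apply]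
    · simp only [Fin.append_right, Function.comp_apply]
  simp only [this, Function.comp_apply, hι.eq_iff]

theorem labelSign_lift {n N : ℕ} (hnN : n ≤ N) (I : Label n a) (J : Label n b) (K : Label n c) :
    labelSign h (I.lift hnN).1 (J.lift hnN).1 (K.lift hnN).1 = labelSign h I.1 J.1 K.1 :=
  labelSign_comp (ι := Fin.castLE hnN) (Fin.castLE_injective hnN)

end Signs

/-- A label is determined by its content. -/
theorem Label.ext_range {d q : ℕ} {I J : Label d q} (h : Set.range I.1 = Set.range J.1) : I = J :=
  Subtype.ext ((I.2.range_inj J.2).1 h)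

/-- Every set of indices is the content of a label. -/
theorem exists_label_range_eq {d q : ℕ} (s : Finset (Fin d)) (hs : s.card = q) :
    ∃ I : Label d q, Set.range I.1 = s :=
  ⟨⟨s.orderEmbOfFin hs, (s.orderEmbOfFin hs).strictMono⟩, s.range_orderEmbOfFin hs⟩

theorem card_range_label {d q : ℕ} (I : Label d q) : (Finset.univ.image I.1).card = q := by
  rw [Finset.card_image_of_injective _ I.2.injective, Finset.card_univ, Fintype.card_fin]

theorem card_label_le (d q : ℕ) : Fintype.card (Label d q) ≤ 2 ^ d := by
  have hinj : Function.Injective fun I : Label d q => (Finset.univ.image I.1 : Finset (Fin d)) := by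
    intro I J hIJ
    apply Label.ext_range
    have := congrArg (fun s : Finset (Fin d) => (s : Set (Fin d))) hIJ
    simpa using this
  calc _ ≤ Fintype.card (Finset (Fin d)) := Fintype.card_le_of_injective _ hinj
    _ = 2 ^ d := by simp

theorem lift_injective {n N q : ℕ} (hnN : n ≤ N) :
    Function.Injective (Label.lift hnN : Label n q → Label N q) := by
  intro I J h
  apply Subtype.ext
  funext t
  have := congrFun (congrArg Subtype.val h) t
  exact Fin.castLE_injective hnN this

/-! ### The operators in coordinates -/

theorem multiDeriv_zero {d : ℕ} (β : Fin d → ℕ) :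
    multiDeriv β (fun _ => 0) = fun _ => (0 : ℝ) := by
  have := iterPartial_const_mul (u := fun _ : Eucl d => (0 : ℝ)) contDiff_const 0 (indexList β)
  rw [multiDeriv_eq_iterPartial]
  simpa using this

theorem indexList_extend {n k N : ℕ} (hnN : n ≤ N) (α : MultiIndex n k) :
    indexList (α.extend N) = (indexList fun t => (α.1 t : ℕ)).map (Fin.castLE hnN) := by
  obtain ⟨m, rfl⟩ := Nat.exists_eq_add_of_le hnN
  have h1 : List.finRange (n + m) = (List.finRange n).map (Fin.castLE hnN) ++
      (List.finRange m).map (Fin.natAdd n) := by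
    simp only [← List.ofFn_id, List.map_ofFn]
    rw [List.ofFn_add]
    rfl
  have h2 : ∀ l : List (Fin m), (l.map (Fin.natAdd n)).flatMap
      (fun j => List.replicate (α.extend (n + m) j) j) = [] := by
    intro l
    rw [List.flatMap_eq_nil_iff]
    intro j hj
    obtain ⟨i, -, rfl⟩ := List.mem_map.1 hj
    simp [MultiIndex.extend]
  unfold indexList
  rw [h1, List.flatMap_append, h2, List.append_nil, List.flatMap_map, List.map_flatMap]
  congr 1
  funext j
  rw [List.map_replicate]
  congr 1
  simp [MultiIndex.extend]

theorem proj_embed {n N : ℕ} (hnN : n ≤ N) (x : Eucl n) : proj hnN (embed n N x) = x := by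
  ext t
  simp [proj, embed]

/-- The projection `proj` as a continuous linear map. -/
def projCLM {n N : ℕ} (hnN : n ≤ N) : Eucl N →L[ℝ] Eucl n :=
  LinearMap.toContinuousLinearMap
    { toFun := proj hnN
      map_add' := fun _ _ => rfl
      map_smul' := fun _ _ => rfl }

theorem partialDeriv_comp_proj {n N : ℕ} (hnN : n ≤ N) {u : Eucl n → ℝ} (hu : ContDiff ℝ ∞ u)
    (j : Fin n) : partialDeriv (Fin.castLE hnN j) (fun z => u (proj hnN z)) =
      fun z => partialDeriv j u (proj hnN z) := by
  funext z
  simp only [partialDeriv]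
  have h1 : HasFDerivAt (proj hnN) (projCLM hnN) z := (projCLM hnN).hasFDerivAt
  have h2 := ((hu.differentiable (by simp) (proj hnN z)).hasFDerivAt).comp z h1
  have h3 : fderiv ℝ (fun z => u (proj hnN z)) z = _ := h2.fderiv
  rw [h3, ContinuousLinearMap.comp_apply]
  congr 1
  change proj hnN _ = _
  ext i
  simp [proj]

theorem iterPartial_comp_proj {n N : ℕ} (hnN : n ≤ N) {u : Eucl n → ℝ} (hu : ContDiff ℝ ∞ u)
    (L : List (Fin n)) : iterPartial (L.map (Fin.castLE hnN)) (fun z => u (proj hnN z)) =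
      fun z => iterPartial L u (proj hnN z) := by
  induction L with
  | nil => rfl
  | cons j L ih =>
    rw [List.map_cons, iterPartial_cons, ih]
    exact partialDeriv_comp_proj hnN (contDiff_iterPartial hu L) j

theorem multiDeriv_extend_comp_proj {n k N : ℕ} (hnN : n ≤ N) {u : Eucl n → ℝ}
    (hu : ContDiff ℝ ∞ u) (α : MultiIndex n k) (x : Eucl n) :
    multiDeriv (α.extend N) (fun z => u (proj hnN z)) (embed n N x) =
      multiDeriv (fun t => (α.1 t : ℕ)) u x := by
  rw [multiDeriv_eq_iterPartial, indexList_extend hnN, iterPartial_comp_proj hnN hu,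
    multiDeriv_eq_iterPartial]
  simp only [proj_embed]

/-- The operator `i^* T π^*` in coordinates. -/
theorem opCalT_apply {n k ℓ N q p : ℕ} (hnN : n ≤ N) (aleph : MultiIndex n k ≃ Label N ℓ)
    (h : ℓ + q = p) {f : Form n q} (hf : ∀ I, ContDiff ℝ ∞ (f I)) (L : Label n p) (x : Eucl n) :
    opCalT hnN aleph h f L x = ∑ I : Label n q, ∑ α : MultiIndex n k,
      (labelSign h (aleph α).1 (I.lift hnN).1 (L.lift hnN).1 : ℝ) *
        multiDeriv (fun t => (α.1 t : ℕ)) (f I) x := by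
  classical
  simp only [opCalT, pullbackEmbed, opT]
  symm
  refine Fintype.sum_of_injective (Label.lift hnN) (lift_injective hnN) _ _ ?_ ?_
  · intro J hJ
    refine Finset.sum_eq_zero fun α _ => ?_
    have : pullbackProj hnN f J = fun _ => 0 := by
      funext z
      refine Finset.sum_eq_zero fun I _ => if_neg fun hI => hJ ⟨I, hI⟩
    rw [this, multiDeriv_zero, mul_zero]
  · intro I
    refine Finset.sum_congr rfl fun α _ => ?_
    have : pullbackProj hnN f (I.lift hnN) = fun z => f I (proj hnN z) := by
      funext z
      simp only [pullbackProj, (lift_injective hnN).eq_iff]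
      rw [Finset.sum_eq_single I (fun J _ hJ => if_neg hJ) (by simp), if_pos rfl]
    rw [this, multiDeriv_extend_comp_proj hnN (hf I)]

/-- The form `ψ dx^L`. -/
def singleForm {n q : ℕ} (L : Label n q) (ψ : Eucl n → ℝ) : Form n q :=
  open Classical in fun J => if J = L then ψ else fun _ => 0

theorem isTestForm_singleForm {n q : ℕ} (L : Label n q) {ψ : Eucl n → ℝ} (hψ : ContDiff ℝ ∞ ψ)
    (hc : HasCompactSupport ψ) : IsTestForm (singleForm L ψ) := by
  intro J
  unfold singleForm
  split_ifs
  · exact ⟨hψ, hc⟩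
  · exact ⟨contDiff_const, HasCompactSupport.zero⟩

theorem contDiff_multiDeriv {n : ℕ} (β : Fin n → ℕ) {u : Eucl n → ℝ} (hu : ContDiff ℝ ∞ u) :
    ContDiff ℝ ∞ (multiDeriv β u) := by
  rw [multiDeriv_eq_iterPartial]; exact contDiff_iterPartial hu _

theorem hasCompactSupport_multiDeriv {n : ℕ} (β : Fin n → ℕ) {u : Eucl n → ℝ}
    (hu : HasCompactSupport u) : HasCompactSupport (multiDeriv β u) := by
  rw [multiDeriv_eq_iterPartial]; exact hasCompactSupport_iterPartial hu _

theorem opCalT_singleForm {n k ℓ N q p : ℕ} (hnN : n ≤ N) (aleph : MultiIndex n k ≃ Label N ℓ)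
    (h : ℓ + q = p) (I : Label n q) {ψ : Eucl n → ℝ} (hψ : ContDiff ℝ ∞ ψ) (L : Label n p)
    (x : Eucl n) :
    opCalT hnN aleph h (singleForm I ψ) L x = ∑ α : MultiIndex n k,
      (labelSign h (aleph α).1 (I.lift hnN).1 (L.lift hnN).1 : ℝ) *
        multiDeriv (fun t => (α.1 t : ℕ)) ψ x := by
  have hs : ∀ J, ContDiff ℝ ∞ (singleForm I ψ J) := fun J => by
    unfold singleForm; split_ifs
    · exact hψ
    · exact contDiff_const
  rw [opCalT_apply hnN aleph h hs, Finset.sum_eq_single I]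
  · simp [singleForm]
  · intro J _ hJ
    simp [singleForm, hJ, multiDeriv_zero]
  · simp

/-- The coefficient of `∂^α ψ dx^I` in the adjoint operator applied to `ψ dx^L`. -/
def adjCoeff {n k ℓ N q p : ℕ} (hnN : n ≤ N) (aleph : MultiIndex n k ≃ Label N ℓ)
    (h : ℓ + q = p) (hp : p ≤ n) (L : Label n p) (I : Label n q) (α : MultiIndex n k) : ℝ :=
  (-1 : ℝ) ^ (k + q * (n - p)) * ∑ M : Label n (ℓ + (n - p)), ∑ J : Label n (n - p),
    (labelSign (by omega : (ℓ + (n - p)) + q = n) M.1 I.1 id : ℝ) *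
      (labelSign rfl (aleph α).1 (J.lift hnN).1 (M.lift hnN).1 : ℝ) *
        (labelSign (by omega : p + (n - p) = n) L.1 J.1 id : ℝ)

theorem opCalTAdj_singleForm {n k ℓ N q p : ℕ} (hnN : n ≤ N) (aleph : MultiIndex n k ≃ Label N ℓ)
    (h : ℓ + q = p) (hp : p ≤ n) (L : Label n p) {ψ : Eucl n → ℝ} (hψ : ContDiff ℝ ∞ ψ)
    (I : Label n q) (x : Eucl n) :
    opCalTAdj hnN aleph h hp (singleForm L ψ) I x =
      ∑ α : MultiIndex n k, adjCoeff hnN aleph h hp L I α *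
        multiDeriv (fun t => (α.1 t : ℕ)) ψ x := by
  classical
  have hstar : ∀ J : Label n (n - p), hodgeStar (by omega : p + (n - p) = n) (singleForm L ψ) J =
      fun x => (labelSign (by omega : p + (n - p) = n) L.1 J.1 id : ℝ) * ψ x := by
    intro J
    funext x
    simp only [hodgeStar]
    rw [Finset.sum_eq_single L]
    · simp [singleForm]
    · intro K _ hK
      simp [singleForm, hK]
    · simp
  have hsm : ∀ J : Label n (n - p),
      ContDiff ℝ ∞ (hodgeStar (by omega : p + (n - p) = n) (singleForm L ψ) J) := fun J => by
    rw [hstar]; exact contDiff_const.mul hψ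
  simp only [opCalTAdj]
  rw [hodgeStar]
  simp only [opCalT_apply hnN aleph rfl hsm, hstar]
  have hmd : ∀ (c : ℝ) (α : MultiIndex n k),
      multiDeriv (fun t => (α.1 t : ℕ)) (fun x => c * ψ x) x =
        c * multiDeriv (fun t => (α.1 t : ℕ)) ψ x := fun c α => by
    simp only [multiDeriv_eq_iterPartial, iterPartial_const_mul hψ]
  simp only [hmd, adjCoeff, Finset.mul_sum, Finset.sum_mul]
  rw [Finset.sum_comm]
  conv_rhs => rw [Finset.sum_comm]
  rw [Finset.sum_comm]
  refine Finset.sum_congr rfl fun M _ => ?_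
  rw [Finset.sum_comm]
  refine Finset.sum_congr rfl fun α _ => Finset.sum_congr rfl fun J _ => ?_
  ring

/-! ### Norms of forms -/

section Norms

variable {n : ℕ} {ι : Type*} [Fintype ι]

theorem abs_le_sqrt_sum_sq (v : ι → ℝ) (i : ι) : |v i| ≤ √(∑ i, v i ^ 2) := by
  rw [← Real.sqrt_sq_eq_abs]
  exact Real.sqrt_le_sqrt (Finset.single_le_sum (f := fun i => v i ^ 2)
    (fun i _ => sq_nonneg _) (Finset.mem_univ i))

theorem sqrt_sum_sq_le (v : ι → ℝ) : √(∑ i, v i ^ 2) ≤ ∑ i, |v i| := by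
  rw [Real.sqrt_le_iff]
  refine ⟨Finset.sum_nonneg fun _ _ => abs_nonneg _, ?_⟩
  calc ∑ i, v i ^ 2 = ∑ i, |v i| ^ 2 := by simp
    _ ≤ (∑ i, |v i|) ^ 2 := Finset.sum_sq_le_sq_sum_of_nonneg fun _ _ => abs_nonneg _

theorem toReal_eLpNorm_le_sqrt_sum_sq {p : ℝ≥0∞} (hp1 : 1 ≤ p) {v : ι → Eucl n → ℝ}
    (hv : ∀ i, MemLp (v i) p volume) (i : ι) :
    (eLpNorm (v i) p volume).toReal ≤
      (eLpNorm (fun x => √(∑ i, v i x ^ 2)) p volume).toReal := by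
  have hfin : eLpNorm (fun x => √(∑ i, v i x ^ 2)) p volume ≠ ⊤ := by
    refine ne_top_of_le_ne_top (b := ∑ i, eLpNorm (fun x => |v i x|) p volume) ?_ ?_
    · exact ENNReal.sum_ne_top.2 fun i _ => (hv i).abs.2.ne
    · refine le_trans (eLpNorm_mono_real (g := ∑ i, fun x => |v i x|) fun x => ?_)
        (eLpNorm_sum_le (fun i _ => (hv i).abs.1) hp1)
      rw [Real.norm_eq_abs, abs_of_nonneg (Real.sqrt_nonneg _), Finset.sum_apply]
      exact sqrt_sum_sq_le _
  refine ENNReal.toReal_mono hfin (eLpNorm_mono_real fun x => ?_)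
  rw [Real.norm_eq_abs]
  exact abs_le_sqrt_sum_sq (fun i => v i x) i

theorem integral_abs_le_lpNormForm {q : ℕ} {f : Form n q} (hf : MemLpForm 1 f) (I : Label n q) :
    ∫ x, |f I x| ≤ lpNormForm 1 f := by
  refine le_trans (le_of_eq ?_) (toReal_eLpNorm_le_sqrt_sum_sq le_rfl hf I)
  rw [eLpNorm_one_eq_lintegral_enorm, ← integral_norm_eq_lintegral_enorm (hf I).1]
  rfl

theorem toReal_eLpNorm_le_lpNormGrad {q : ℕ} {p : ℝ≥0∞} (hp1 : 1 ≤ p)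
    {Dh : Fin n → Form n q} (hD : ∀ j, MemLpForm p (Dh j)) (j : Fin n) (I : Label n q) :
    (eLpNorm (Dh j I) p volume).toReal ≤ lpNormGrad p Dh := by
  have h := toReal_eLpNorm_le_sqrt_sum_sq (v := fun r : Fin n × Label n q => Dh r.1 r.2) hp1
    (fun r => hD r.1 r.2) (j, I)
  simp only [Fintype.sum_prod_type] at h
  exact h

end Norms

/-! ### The estimate for forms -/

/-- The component `f_{I₀}` can be isolated: some family `(∑_I c I α f_I)_α` with `|c I α| ≤ Γ` is
annihilated by `∑_α ∂^α` in the sense of distributions, and its member of some index `α₀` is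
`± f_{I₀}`. -/
def Isolates {n k q : ℕ} (Γ : ℝ) (f : Form n q) (I₀ : Label n q) : Prop :=
  ∃ (c : Label n q → MultiIndex n k → ℝ) (α₀ : MultiIndex n k),
    (∀ I α, |c I α| ≤ Γ) ∧ (∀ I, c I α₀ ≠ 0 → I = I₀) ∧ |c I₀ α₀| = 1 ∧
      ∀ ψ : Eucl n → ℝ, ContDiff ℝ ∞ ψ → HasCompactSupport ψ →
        ∫ x, ∑ I, f I x * ∑ α, c I α * multiDeriv (fun t => (α.1 t : ℕ)) ψ x = 0

/-- The `L¹` estimate for a form all of whose components can be isolated: for each `I₀`, the family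
`(∑_I c I α f_I)_α` satisfies the hypothesis of `exists_abs_integral_le_of_divFree`, and its member
of index `α₀` is `± f_{I₀}`. -/
theorem exists_abs_pairing_le (n k : ℕ) (hn : 2 ≤ n) : ∃ C : ℝ, ∀ (q : ℕ) (f : Form n q),
    MemLpForm 1 f → (∀ I₀, Isolates (k := k) ((2 ^ n) ^ 2) f I₀) →
    ∀ (h : Form n q) (Dh : Fin n → Form n q), MemLpForm ⊤ h →
      MemW1WithGrad (n : ℝ≥0∞) h Dh →
      |pairing f h| ≤ C * lpNormForm 1 f * lpNormGrad (n : ℝ≥0∞) Dh := by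
  obtain ⟨C, hC, hVS⟩ := exists_abs_integral_le_of_divFree n k hn
  have hp1 : (1 : ℝ≥0∞) ≤ (n : ℝ≥0∞) := by exact_mod_cast (by omega : 1 ≤ n)
  set S : ℝ := ((Fintype.card (MultiIndex n k) : ℕ) : ℝ) with hS
  refine ⟨2 ^ n * (C * (S * ((2 ^ n) ^ 2 * 2 ^ n)) * n), ?_⟩
  intro q f hf hiso h Dh hinf hW
  set F := lpNormForm 1 f with hF
  set G := lpNormGrad (n : ℝ≥0∞) Dh with hG
  have hF0 : 0 ≤ F := ENNReal.toReal_nonneg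
  have hG0 : 0 ≤ G := ENNReal.toReal_nonneg
  have hfi : ∀ I, Integrable (f I) volume := fun I => memLp_one_iff_integrable.1 (hf I)
  have hcard : (Fintype.card (Label n q) : ℝ) ≤ 2 ^ n := by exact_mod_cast card_label_le n q
  have hcomp : ∀ I₀, |∫ x, f I₀ x * h I₀ x| ≤ C * (S * ((2 ^ n) ^ 2 * 2 ^ n)) * n * F * G := by
    intro I₀
    obtain ⟨c, α₀, hcΓ, hc0, hc1, hdiv⟩ := hiso I₀
    set g : MultiIndex n k → Eucl n → ℝ := fun α x => ∑ I, c I α * f I x with hg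
    have hgi : ∀ α, Integrable (g α) volume := fun α =>
      integrable_finsetSum _ fun I _ => (hfi I).const_mul _
    have hgdiv : DivFree g := by
      intro ψ hψ hψc
      have hint : ∀ α, Integrable (fun x => g α x * multiDeriv (fun t => (α.1 t : ℕ)) ψ x)
          volume := fun α => integrable_mul_of_compactSupport (hgi α)
        (contDiff_multiDeriv _ hψ).continuous (hasCompactSupport_multiDeriv _ hψc)
      rw [← integral_finsetSum _ fun α _ => hint α, ← hdiv ψ hψ hψc]
      congr 1
      funext x
      simp only [hg, Finset.sum_mul, Finset.mul_sum]
      rw [Finset.sum_comm]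
      exact Finset.sum_congr rfl fun I _ => Finset.sum_congr rfl fun α _ => by ring
    have h1 := hVS g hgi hgdiv (h I₀) (fun j => Dh j I₀) (hinf I₀) (hW.1 I₀)
      (fun j => hW.2.1 j I₀) (fun j => hW.2.2 j I₀) α₀
    have hgα₀ : g α₀ = fun x => c I₀ α₀ * f I₀ x := by
      funext x
      simp only [hg]
      refine Finset.sum_eq_single I₀ (fun I _ hI => ?_) (by simp)
      have : c I α₀ = 0 := by
        by_contra hne
        exact hI (hc0 I hne)
      rw [this, zero_mul]
    have h2 : |∫ x, g α₀ x * h I₀ x| = |∫ x, f I₀ x * h I₀ x| := by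
      simp only [hgα₀, mul_assoc, integral_const_mul, abs_mul, hc1, one_mul]
    rw [h2] at h1
    have htot : ∫ x, totAbs g x ≤ S * ((2 ^ n) ^ 2 * 2 ^ n) * F := by
      calc ∫ x, totAbs g x ≤ ∫ x, ∑ _α : MultiIndex n k, ∑ I, (2 ^ n) ^ 2 * |f I x| := by
            refine integral_mono (integrable_totAbs hgi)
              (integrable_finsetSum _ fun α _ => integrable_finsetSum _ fun I _ =>
                (hfi I).abs.const_mul _) fun x => ?_
            refine Finset.sum_le_sum fun α _ => ?_
            refine (Finset.abs_sum_le_sum_abs _ _).trans (Finset.sum_le_sum fun I _ => ?_)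
            rw [abs_mul]
            exact mul_le_mul_of_nonneg_right (hcΓ I α) (abs_nonneg _)
        _ = S * ((2 ^ n) ^ 2 * ∑ I, ∫ x, |f I x|) := by
            simp only [Finset.sum_const, Finset.card_univ, nsmul_eq_mul, ← Finset.mul_sum]
            rw [integral_const_mul, integral_const_mul, integral_finsetSum _ fun I _ => (hfi I).abs]
        _ ≤ S * ((2 ^ n) ^ 2 * ∑ _I : Label n q, F) := by
            gcongr with I _
            exact integral_abs_le_lpNormForm hf I
        _ = S * ((2 ^ n) ^ 2 * (Fintype.card (Label n q) * F)) := by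
            rw [Finset.sum_const, Finset.card_univ, nsmul_eq_mul]
        _ ≤ S * ((2 ^ n) ^ 2 * (2 ^ n * F)) := by gcongr
        _ = _ := by ring
    have hgrad : ∑ j, (eLpNorm (Dh j I₀) n volume).toReal ≤ n * G := by
      calc _ ≤ ∑ _j : Fin n, G :=
            Finset.sum_le_sum fun j _ => toReal_eLpNorm_le_lpNormGrad hp1 hW.2.1 j I₀
        _ = n * G := by simp
    have htot0 : 0 ≤ ∫ x, totAbs g x := integral_nonneg fun x => totAbs_nonneg x
    calc _ ≤ _ := h1
      _ ≤ C * (S * ((2 ^ n) ^ 2 * 2 ^ n) * F) * (n * G) :=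
          mul_le_mul (mul_le_mul_of_nonneg_left htot hC) hgrad
            (Finset.sum_nonneg fun _ _ => ENNReal.toReal_nonneg)
            (mul_nonneg hC (htot0.trans htot))
      _ = C * (S * ((2 ^ n) ^ 2 * 2 ^ n)) * n * F * G := by ring
  have hpair : pairing f h = ∑ I, ∫ x, f I x * h I x := by
    unfold pairing
    exact integral_finsetSum _ fun I _ => (hfi I).mul_of_top_left (hinf I)
  rw [hpair]
  calc _ ≤ ∑ I, |∫ x, f I x * h I x| := Finset.abs_sum_le_sum_abs _ _
    _ ≤ ∑ _I : Label n q, C * (S * ((2 ^ n) ^ 2 * 2 ^ n)) * n * F * G :=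
        Finset.sum_le_sum fun I _ => hcomp I
    _ = Fintype.card (Label n q) * (C * (S * ((2 ^ n) ^ 2 * 2 ^ n)) * n * F * G) := by
        rw [Finset.sum_const, Finset.card_univ, nsmul_eq_mul]
    _ ≤ 2 ^ n * (C * (S * ((2 ^ n) ^ 2 * 2 ^ n)) * n * F * G) := by gcongr
    _ = _ := by ring

section Isolation

variable {n k ℓ N : ℕ} (hnN : n ≤ N) (aleph : MultiIndex n k ≃ Label N ℓ)

theorem abs_adjCoeff_le {q p : ℕ} (h : ℓ + q = p) (hp : p ≤ n) (L : Label n p) (I : Label n q)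
    (α : MultiIndex n k) : |adjCoeff hnN aleph h hp L I α| ≤ (2 ^ n) ^ 2 := by
  rw [adjCoeff, abs_mul, abs_pow, abs_neg, abs_one, one_pow, one_mul]
  calc _ ≤ ∑ _M : Label n (ℓ + (n - p)), ∑ _J : Label n (n - p), (1 : ℝ) := by
        refine (Finset.abs_sum_le_sum_abs _ _).trans (Finset.sum_le_sum fun M _ => ?_)
        refine (Finset.abs_sum_le_sum_abs _ _).trans (Finset.sum_le_sum fun J _ => ?_)
        rw [abs_mul, abs_mul]
        have h1 := abs_labelSign_le_one (h := (by omega : (ℓ + (n - p)) + q = n)) (A := M.1)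
          (B := I.1) (C := id) Function.injective_id
        have h2 := abs_labelSign_le_one (h := rfl) (A := (aleph α).1)
          (B := (J.lift hnN).1) (C := (M.lift hnN).1) (M.lift hnN).2.injective
        have h3 := abs_labelSign_le_one (h := (by omega : p + (n - p) = n)) (A := L.1)
          (B := J.1) (C := id) Function.injective_id
        exact mul_le_one₀ (mul_le_one₀ h1 (abs_nonneg _) h2) (abs_nonneg _) h3
    _ = (Fintype.card (Label n (ℓ + (n - p))) : ℝ) * Fintype.card (Label n (n - p)) := by simp
    _ ≤ 2 ^ n * 2 ^ n := by
        have h1 : (Fintype.card (Label n (ℓ + (n - p))) : ℝ) ≤ 2 ^ n := by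
          exact_mod_cast card_label_le n _
        have h2 : (Fintype.card (Label n (n - p)) : ℝ) ≤ 2 ^ n := by
          exact_mod_cast card_label_le n _
        gcongr
    _ = _ := by ring

/-- If `A ⊔ I₀ = L`, then in the adjoint operator applied to a multiple of `dx^L` the derivative
labelled by `A` occurs in the component `I₀` only, because `A ⊔ J = M`, `L ⊔ J = {1, …, n}` and
`M ⊔ I = {1, …, n}` determine first `J`, then `M` and `I`. -/
theorem adjCoeff_isolates {q p : ℕ} (h : ℓ + q = p) (hp : p ≤ n) {L : Label n p} {I₀ : Label n q}
    {A : Label n ℓ} (hL : Set.range L.1 = Set.range A.1 ∪ Set.range I₀.1)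
    (hd : Disjoint (Set.range A.1) (Set.range I₀.1)) :
    (∀ I, adjCoeff hnN aleph h hp L I (aleph.symm (A.lift hnN)) ≠ 0 → I = I₀) ∧
      |adjCoeff hnN aleph h hp L I₀ (aleph.symm (A.lift hnN))| = 1 := by
  classical
  have hcoef : ∀ I, adjCoeff hnN aleph h hp L I (aleph.symm (A.lift hnN)) =
      (-1 : ℝ) ^ (k + q * (n - p)) * ∑ M : Label n (ℓ + (n - p)), ∑ J : Label n (n - p),
      (labelSign (by omega : (ℓ + (n - p)) + q = n) M.1 I.1 id : ℝ) *
      (labelSign rfl A.1 J.1 M.1 : ℝ) *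
        (labelSign (by omega : p + (n - p) = n) L.1 J.1 id : ℝ) := by
    intro I
    simp only [adjCoeff, Equiv.apply_symm_apply, labelSign_lift]
  have hdet : ∀ (I : Label n q) (M : Label n (ℓ + (n - p))) (J : Label n (n - p)),
      (labelSign (by omega : (ℓ + (n - p)) + q = n) M.1 I.1 id : ℝ) *
      (labelSign rfl A.1 J.1 M.1 : ℝ) *
        (labelSign (by omega : p + (n - p) = n) L.1 J.1 id : ℝ) ≠ 0 →
      Set.range J.1 = (Set.range L.1)ᶜ ∧ Set.range M.1 = (Set.range I₀.1)ᶜ ∧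
        Set.range I.1 = Set.range I₀.1 := by
    intro I M J hne
    have h1 := left_ne_zero_of_mul (left_ne_zero_of_mul hne)
    have h2 := right_ne_zero_of_mul (left_ne_zero_of_mul hne)
    have h3 := right_ne_zero_of_mul hne
    obtain ⟨u1, d1⟩ := range_of_labelSign_ne_zero Function.injective_id (Int.cast_ne_zero.1 h1)
    obtain ⟨u2, d2⟩ := range_of_labelSign_ne_zero M.2.injective (Int.cast_ne_zero.1 h2)
    obtain ⟨u3, d3⟩ := range_of_labelSign_ne_zero Function.injective_id (Int.cast_ne_zero.1 h3)
    rw [Set.range_id] at u1 u3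
    have hJ : Set.range J.1 = (Set.range L.1)ᶜ :=
      ((isCompl_iff.2 ⟨d3, codisjoint_iff.2 u3⟩).compl_eq).symm
    have hI : Set.range I.1 = (Set.range M.1)ᶜ :=
      ((isCompl_iff.2 ⟨d1, codisjoint_iff.2 u1⟩).compl_eq).symm
    have hM : Set.range M.1 = (Set.range I₀.1)ᶜ := by
      rw [← u2, hJ, hL]
      ext x
      have : x ∈ Set.range A.1 → x ∉ Set.range I₀.1 := fun hx => Set.disjoint_left.1 hd hx
      simp only [Set.mem_union, Set.mem_compl_iff]
      tauto
    exact ⟨hJ, hM, by rw [hI, hM, compl_compl]⟩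
  constructor
  · intro I hne
    rw [hcoef] at hne
    obtain ⟨M, -, hM⟩ := Finset.exists_ne_zero_of_sum_ne_zero (right_ne_zero_of_mul hne)
    obtain ⟨J, -, hJ⟩ := Finset.exists_ne_zero_of_sum_ne_zero hM
    exact Label.ext_range (hdet I M J hJ).2.2
  · obtain ⟨J₀, hJ₀⟩ := exists_label_range_eq (q := n - p) (Finset.univ.image L.1)ᶜ
      (by rw [Finset.card_compl, card_range_label, Fintype.card_fin])
    obtain ⟨M₀, hM₀⟩ := exists_label_range_eq (q := ℓ + (n - p)) (Finset.univ.image I₀.1)ᶜ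
      (by rw [Finset.card_compl, card_range_label, Fintype.card_fin]; omega)
    simp only [Finset.coe_compl, Finset.coe_image, Finset.coe_univ, Set.image_univ] at hJ₀ hM₀
    rw [hcoef, abs_mul, abs_pow, abs_neg, abs_one, one_pow, one_mul,
      Finset.sum_eq_single M₀, Finset.sum_eq_single J₀]
    · have e1 := abs_labelSign_eq_one (h := (by omega : (ℓ + (n - p)) + q = n)) (A := M₀.1)
        (B := I₀.1) (C := id) M₀.2.injective I₀.2.injective Function.injective_id
        (by rw [hM₀, Set.range_id, Set.compl_union_self]) (by rw [hM₀]; exact disjoint_compl_left)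
      have e2 := abs_labelSign_eq_one (h := rfl) (A := A.1) (B := J₀.1) (C := M₀.1)
        A.2.injective J₀.2.injective M₀.2.injective
        (by
          rw [hM₀, hJ₀, hL]
          ext x
          have : x ∈ Set.range A.1 → x ∉ Set.range I₀.1 := fun hx => Set.disjoint_left.1 hd hx
          simp only [Set.mem_union, Set.mem_compl_iff]
          tauto)
        (by
          rw [hJ₀, hL]
          exact (disjoint_compl_right).mono_left Set.subset_union_left)
      have e3 := abs_labelSign_eq_one (h := (by omega : p + (n - p) = n)) (A := L.1)
        (B := J₀.1) (C := id) L.2.injective J₀.2.injective Function.injective_id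
        (by rw [hJ₀, Set.range_id, Set.union_compl_self]) (by rw [hJ₀]; exact disjoint_compl_right)
      rw [abs_mul, abs_mul, e1, e2, e3]
      norm_num
    · intro J _ hJ
      by_contra hne
      exact hJ (Label.ext_range ((hdet I₀ M₀ J hne).1.trans hJ₀.symm))
    · simp
    · intro M _ hM
      refine Finset.sum_eq_zero fun J _ => ?_
      by_contra hne
      exact hM (Label.ext_range ((hdet I₀ M J hne).2.1.trans hM₀.symm))
    · simp

/-- As `ℓ + q ≤ n`, there is a label `A` of length `ℓ` disjoint from `I₀`. Testing `𝒯 f = 0` against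
`ψ dx^L`, `L = A ⊔ I₀`, isolates the component `f_{I₀}` at the multi-index of label `A`. -/
theorem isolates_of_calTVanishes {q : ℕ} (hq : ℓ + q ≤ n) {f : Form n q}
    (hf : CalTVanishes hnN aleph f) (I₀ : Label n q) : Isolates (k := k) ((2 ^ n) ^ 2) f I₀ := by
  classical
  obtain ⟨s, hs, hsc⟩ := Finset.exists_subset_card_eq (s := (Finset.univ.image I₀.1)ᶜ) (n := ℓ)
    (by rw [Finset.card_compl, card_range_label, Fintype.card_fin]; omega)
  obtain ⟨A, hA⟩ := exists_label_range_eq s hsc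
  have hdf : Disjoint s (Finset.univ.image I₀.1) := by
    rw [Finset.disjoint_left]
    intro x hx hx'
    exact Finset.mem_compl.1 (hs hx) hx'
  obtain ⟨L, hL⟩ := exists_label_range_eq (q := ℓ + q) (s ∪ Finset.univ.image I₀.1)
    (by rw [Finset.card_union_of_disjoint hdf, hsc, card_range_label])
  have hL' : Set.range L.1 = Set.range A.1 ∪ Set.range I₀.1 := by rw [hL, hA]; simp
  have hd : Disjoint (Set.range A.1) (Set.range I₀.1) := by
    rw [hA]
    have := Finset.disjoint_coe.2 hdf
    simpa using this
  obtain ⟨h1, h2⟩ := adjCoeff_isolates hnN aleph rfl hq hL' hd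
  refine ⟨adjCoeff hnN aleph rfl hq L, aleph.symm (A.lift hnN),
    abs_adjCoeff_le hnN aleph rfl hq L, h1, h2, fun ψ hψ hψc => ?_⟩
  have h3 := hf (ℓ + q) rfl hq (singleForm L ψ) (isTestForm_singleForm L hψ hψc)
  simpa only [pairing, opCalTAdj_singleForm hnN aleph rfl hq L hψ] using h3

/-- As `ℓ ≤ p`, there is a label `A` of length `ℓ` contained in `L₀`. Testing `𝒯^* g = 0` against
`ψ dx^I`, `L₀ = A ⊔ I`, isolates the component `g_{L₀}` at the multi-index of label `A`. -/
theorem isolates_of_calTAdjVanishes {p : ℕ} (hp : ℓ ≤ p) {g : Form n p}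
    (hg : CalTAdjVanishes hnN aleph g) (L₀ : Label n p) :
    Isolates (k := k) ((2 ^ n) ^ 2) g L₀ := by
  classical
  obtain ⟨s, hs, hsc⟩ := Finset.exists_subset_card_eq (s := Finset.univ.image L₀.1) (n := ℓ)
    (by rw [card_range_label]; omega)
  obtain ⟨A, hA⟩ := exists_label_range_eq s hsc
  obtain ⟨I, hI⟩ := exists_label_range_eq (q := p - ℓ) (Finset.univ.image L₀.1 \ s)
    (by rw [Finset.card_sdiff_of_subset hs, card_range_label, hsc])
  have hu : Set.range A.1 ∪ Set.range I.1 = Set.range L₀.1 := by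
    rw [hA, hI, ← Finset.coe_union, Finset.union_sdiff_of_subset hs]; simp
  have hd : Disjoint (Set.range A.1) (Set.range I.1) := by
    rw [hA, hI, Finset.disjoint_coe]
    exact Finset.disjoint_sdiff
  have hℓp : ℓ + (p - ℓ) = p := by omega
  refine ⟨fun L α => (labelSign hℓp (aleph α).1 (I.lift hnN).1 (L.lift hnN).1 : ℝ),
    aleph.symm (A.lift hnN), fun L α => ?_, fun L hne => ?_, ?_, fun ψ hψ hψc => ?_⟩
  · refine (abs_labelSign_le_one (L.lift hnN).2.injective).trans ?_
    exact one_le_pow₀ (one_le_pow₀ one_le_two)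
  · simp only [Equiv.apply_symm_apply, labelSign_lift] at hne
    have := (range_of_labelSign_ne_zero L.2.injective (Int.cast_ne_zero.1 hne)).1
    exact Label.ext_range (this.symm.trans hu)
  · simp only [Equiv.apply_symm_apply, labelSign_lift]
    exact abs_labelSign_eq_one A.2.injective I.2.injective L₀.2.injective hu hd
  · have h3 := hg (p - ℓ) hℓp (singleForm I ψ) (isTestForm_singleForm I hψ hψc)
    simpa only [pairing, opCalT_singleForm hnN aleph hℓp I hψ] using h3

end Isolation

end KthOrderComplex

end

theorem theorem2p4 (n k : ℕ) (hn : 2 ≤ n) (hk : 1 ≤ k) :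
    ∃ C : ℝ, ∀ (ℓ : ℕ) (hℓ : KthOrderComplex.IsAdmissible n k ℓ), ℓ ≤ n →
      ∀ (N : ℕ) (hN : KthOrderComplex.IsInflatedDim n k ℓ N)
        (aleph : KthOrderComplex.MultiIndex n k ≃ KthOrderComplex.Label N ℓ),
        (∀ q : ℕ, q ≤ n - ℓ → ∀ f : KthOrderComplex.Form n q,
          KthOrderComplex.MemLpForm 1 f →
          KthOrderComplex.CalTVanishes (hN.le hℓ.1) aleph f →
          ∀ (h : KthOrderComplex.Form n q) (Dh : Fin n → KthOrderComplex.Form n q),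
            KthOrderComplex.MemLpForm ⊤ h →
            KthOrderComplex.MemW1WithGrad (n : ENNReal) h Dh →
            |KthOrderComplex.pairing f h| ≤
              C * KthOrderComplex.lpNormForm 1 f *
                KthOrderComplex.lpNormGrad (n : ENNReal) Dh) ∧
        (∀ p : ℕ, ℓ ≤ p → p ≤ n → ∀ g : KthOrderComplex.Form n p,
          KthOrderComplex.MemLpForm 1 g →
          KthOrderComplex.CalTAdjVanishes (hN.le hℓ.1) aleph g →
          ∀ (h : KthOrderComplex.Form n p) (Dh : Fin n → KthOrderComplex.Form n p),
            KthOrderComplex.MemLpForm ⊤ h →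
            KthOrderComplex.MemW1WithGrad (n : ENNReal) h Dh →
            |KthOrderComplex.pairing g h| ≤
              C * KthOrderComplex.lpNormForm 1 g *
                KthOrderComplex.lpNormGrad (n : ENNReal) Dh) := by
  obtain ⟨C, hC⟩ := KthOrderComplex.exists_abs_pairing_le n k hn
  refine ⟨C, fun ℓ hℓ hℓn N hN aleph => ⟨fun q hq f hf hvan h Dh hinf hW => ?_,
    fun p hp _ g hg hvan h Dh hinf hW => ?_⟩⟩
  · exact hC q f hf (KthOrderComplex.isolates_of_calTVanishes _ aleph (by omega) hvan) h Dh hinf hW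
  · exact hC p g hg (KthOrderComplex.isolates_of_calTAdjVanishes _ aleph hp hvan) h Dh hinf hW
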